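/- Let $X$ be a compact connected Riemannian manifold (without boundary), let $V$ be a real vector space of finite dimension $d$, let $\Gamma\subset V$ be a lattice, and let $\varphi:X\to V/\Gamma$ be a continuous map that induces a surjection of fundamental groups. Identify $H_1(V/\Gamma;\mathbb R)$ with $V$ in the usual way (the class of the loop $t\mapsto t\gamma+\Gamma$, $0\le t\le 1$, corresponds to $\gamma\in\Gamma$). The stable norm $\|\beta\|_{st}$ of $\beta\in H_1(X;\mathbb R)$ is the infimum of $\sum_i|r_i|\,\mathrm{length}(\sigma_i)$ over all real Lipschitz $1$-cycles $\sum_i r_i\sigma_i$ that represent $\beta$, and the relative stable norm of $v\in V$ is $$\|v\|_{st/\varphi}=\inf\{\|\beta\|_{st} : \beta\in H_1(X;\mathbb R),\ \varphi_*(\beta)=v\}.$$ Then the unit ball $\{v\in V:\|v\|_{st/\varphi}\le 1\}$ has a John ellipsoid, that is, an ellipsoid of largest volume among all ellipsoids inscribed in it that is centred at the origin. Let $\|\cdot\|_E$ be the Euclidean norm on $V$ whose unit ball is this ellipsoid. Then there exists a map $A:X\to V/\Gamma$ homotopic to $\varphi$ which is Lipschitz with respect to the Riemannian distance of $X$ and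 the flat metric on $V/\Gamma$ given by $\|\cdot\|_E$, and which is non-expanding on all $d$-dimensional areas: for every smooth $d$-dimensional submanifold $Y$ of $X$, $$\mathrm{vol}_d(A(Y))\le \mathrm{vol}_d(Y).$$ -/

import Mathlib

open scoped Bundle Manifold ContDiff ENNReal NNReal unitInterval Simplicial MeasureTheory
open CategoryTheory

universe u

noncomputable section

namespace AreaMap

/-! ### Real singular homology in degree one, and the stable norm -/

/-- The coefficient module `ℝ`, in the universe of the spaces considered. -/
abbrev coeff : ModuleCat.{u} ℝ := ModuleCat.of ℝ (ULift.{u} ℝ)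

/-- The real singular chain complex of `X`. -/
abbrev singularComplex (X : Type u) [TopologicalSpace X] : ChainComplex (ModuleCat.{u} ℝ) ℕ :=
  (TopCat.toSSet.obj (TopCat.of X)).chainComplex coeff

/-- The first real singular homology `H₁(X; ℝ)`. -/
abbrev H1 (X : Type u) [TopologicalSpace X] : ModuleCat.{u} ℝ :=
  (singularComplex X).homology 1

/-- The map `φ_* : H₁(X; ℝ) → H₁(Y; ℝ)` induced by a continuous map `φ`. -/
def H1map {X Y : Type u} [TopologicalSpace X] [TopologicalSpace Y] (φ : C(X, Y)) :
    H1 X →ₗ[ℝ] H1 Y :=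
  (SSet.homologyMap (TopCat.toSSet.map (TopCat.ofHom φ)) coeff 1).hom

/-- `H₁` is Mathlib's singular homology functor, on objects and on maps. -/
theorem H1_eq (X : Type u) [TopologicalSpace X] :
    H1 X = ((AlgebraicTopology.singularHomologyFunctor (ModuleCat.{u} ℝ) 1).obj coeff).obj
      (TopCat.of X) := rfl

theorem H1map_eq {X Y : Type u} [TopologicalSpace X] [TopologicalSpace Y] (φ : C(X, Y)) :
    H1map φ = (((AlgebraicTopology.singularHomologyFunctor (ModuleCat.{u} ℝ) 1).obj coeff).map
      (TopCat.ofHom φ)).hom := rfl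

/-- A path `s : [0,1] → X` as a singular `1`-simplex; `[0,1]` is identified with the standard
`1`-simplex in such a way that `0` is the vertex number `0` and `1` is the vertex number `1`. -/
def pathSimplex {X : Type u} [TopologicalSpace X] (s : C(I, X)) :
    (TopCat.toSSet.obj (TopCat.of X)) _⦋1⦌ :=
  ((TopCat.of X).toSSetObjEquiv (.op ⦋1⦌)).symm
    (s.comp (stdSimplexHomeomorphUnitInterval : C(stdSimplex ℝ (Fin 2), I)))

/-- The singular `1`-chain `∑ᵢ rᵢ sᵢ`, as an element of the singular chain complex. -/
def toChain {X : Type u} [TopologicalSpace X] (c : C(I, X) →₀ ℝ) : (singularComplex X).X 1 :=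
  c.sum fun s r =>
    (((TopCat.toSSet.obj (TopCat.of X)).ιChainComplex (R := coeff) (pathSimplex s)).hom
      (ULift.up r) : (singularComplex X).X 1)

/-- The `1`-chain `c = ∑ᵢ rᵢ sᵢ` is a cycle and represents the homology class `β`. -/
def Represents {X : Type u} [TopologicalSpace X] (c : C(I, X) →₀ ℝ) (β : H1 X) : Prop :=
  ∃ z : (singularComplex X).cycles 1,
    ((singularComplex X).iCycles 1).hom z = toChain c ∧
      ((singularComplex X).homologyπ 1).hom z = β

section Riemannian

variable {n : ℕ} {X : Type u} [EMetricSpace X] [ChartedSpace (EuclideanSpace ℝ (Fin n)) X]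
  [Bundle.RiemannianBundle (fun x : X => TangentSpace (𝓡 n) x)]

variable (n) in
/-- The length `∫₀¹ |s'(t)| dt` of a path `s : [0,1] → X` in a Riemannian manifold. -/
def pathLength (s : C(I, X)) : ℝ≥0∞ :=
  Manifold.pathELength (𝓡 n) (Set.IccExtend zero_le_one s) 0 1

variable (n) in
/-- The stable norm of `β ∈ H₁(X; ℝ)`: the infimum of `∑ᵢ |rᵢ| length(sᵢ)` over all real Lipschitz
cycles `∑ᵢ rᵢ sᵢ` that represent `β`. -/
def stableNorm (β : H1 X) : ℝ≥0∞ :=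
  ⨅ (c : C(I, X) →₀ ℝ) (_ : ∀ s ∈ c.support, ∃ K : ℝ≥0, LipschitzWith K s)
    (_ : Represents c β), c.sum fun s r => ‖r‖ₑ * pathLength n s

end Riemannian

/-! ### Tori and the relative stable norm -/

section Torus

variable {V : Type u} [NormedAddCommGroup V] [NormedSpace ℝ V]

/-- The projection `V → V/Γ`. -/
def torusMk (Γ : Submodule ℤ V) : C(V, V ⧸ Γ) :=
  ⟨Submodule.Quotient.mk, continuous_quot_mk⟩

/-- The usual identification of `H₁(V/Γ; ℝ)` with `V`, as a relation: `α ∈ H₁(V/Γ; ℝ)` corresponds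
to `v ∈ V` if `v` is the integral over `α` of the tautological `V`-valued `1`-form of `V/Γ`, that
is, if `α` is represented by a cycle `∑ᵢ rᵢ (p ∘ τᵢ)`, where the `τᵢ` are paths in `V` and `p` is
the projection, with `∑ᵢ rᵢ (τᵢ(1) - τᵢ(0)) = v`. (Every cycle of `V/Γ` is of this form by
path lifting; the class of the loop `t ↦ p (t γ)` corresponds to `γ`, for every `γ ∈ Γ`.) -/
def CorrespondsTo (Γ : Submodule ℤ V) (α : H1 (V ⧸ Γ)) (v : V) : Prop :=
  ∃ c : C(I, V) →₀ ℝ, Represents (c.mapDomain fun τ => (torusMk Γ).comp τ) α ∧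
    (c.sum fun τ r => r • (τ 1 - τ 0)) = v

/-- The relative stable norm on `V = H₁(V/Γ; ℝ)` of a map `φ : X → V/Γ`:
`‖v‖ = inf {‖β‖ : β ∈ H₁(X; ℝ), φ_* β = v}`, where `‖β‖` is the stable norm of `β`. -/
def relStableNorm (n : ℕ) {X : Type u} [EMetricSpace X]
    [ChartedSpace (EuclideanSpace ℝ (Fin n)) X]
    [Bundle.RiemannianBundle (fun x : X => TangentSpace (𝓡 n) x)]
    (Γ : Submodule ℤ V) (φ : C(X, V ⧸ Γ)) (v : V) : ℝ≥0∞ :=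
  ⨅ (β : H1 X) (_ : CorrespondsTo Γ (H1map φ β) v), stableNorm n β

/-! ### Euclidean structures, the John ellipsoid, and flat tori -/

/-- The ellipsoid centred at the origin given by a Euclidean structure on `V`, that is, the unit
ball of its norm. -/
def ellipsoid (E : InnerProductSpace.Core ℝ V) : Set V := {v | E.inner v v ≤ 1}

/-- The Euclidean structure `E` is defined by the John ellipsoid of `B`, that is, the unit ball of
`E` is inscribed in `B`, and has the largest volume among all ellipsoids (with any centre)
inscribed in `B`. -/
def IsJohn [FiniteDimensional ℝ V] [MeasurableSpace V] [BorelSpace V]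
    (E : InnerProductSpace.Core ℝ V) (B : Set V) : Prop :=
  ellipsoid E ⊆ B ∧
    ∀ (E' : InnerProductSpace.Core ℝ V) (x : V), (fun v => x + v) '' ellipsoid E' ⊆ B →
      MeasureTheory.Measure.addHaar ((fun v => x + v) '' ellipsoid E') ≤
        MeasureTheory.Measure.addHaar (ellipsoid E)

/-- The torus `V/Γ`, considered with the flat metric of the Euclidean structure `E` on `V`. -/
def FlatTorus (_E : InnerProductSpace.Core ℝ V) (Γ : Submodule ℤ V) : Type u := V ⧸ Γ

/-- The identity map from `V/Γ` to `V/Γ` with its flat metric. -/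
def toFlat (E : InnerProductSpace.Core ℝ V) (Γ : Submodule ℤ V) (x : V ⧸ Γ) : FlatTorus E Γ := x

theorem isClosed_preimage_linear {W U : Type*} [NormedAddCommGroup W] [NormedSpace ℝ W]
    [FiniteDimensional ℝ W] [NormedAddCommGroup U] [NormedSpace ℝ U] (f : W →ₗ[ℝ] U) {S : Set U}
    (hS : IsClosed S) : IsClosed (f ⁻¹' S) :=
  hS.preimage f.continuous_of_finiteDimensional

/-- A lattice is closed, also in the topology of the norm of `E`. -/
theorem isClosed_lattice [FiniteDimensional ℝ V] (E : InnerProductSpace.Core ℝ V)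
    (Γ : Submodule ℤ V) [DiscreteTopology Γ] :
    @IsClosed V E.toNormedAddCommGroup.toMetricSpace.toUniformSpace.toTopologicalSpace
      (Γ : Set V) := by
  have h : IsClosed (Γ : Set V) := by
    have : DiscreteTopology Γ.toAddSubgroup := inferInstanceAs (DiscreteTopology Γ)
    exact AddSubgroup.isClosed_of_discrete (H := Γ.toAddSubgroup)
  exact @isClosed_preimage_linear V V E.toNormedAddCommGroup
    (@InnerProductSpace.Core.toNormedSpace ℝ V _ _ _ E.toCore) (by assumption) _ _
    LinearMap.id _ h

/-- The flat metric: the quotient metric on `V/Γ` of the Euclidean metric of `E`. -/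
instance [FiniteDimensional ℝ V] (E : InnerProductSpace.Core ℝ V) (Γ : Submodule ℤ V)
    [DiscreteTopology Γ] : MetricSpace (FlatTorus E Γ) :=
  (@QuotientAddGroup.instNormedAddCommGroup V
    E.toNormedAddCommGroup.toSeminormedAddCommGroup Γ.toAddSubgroup
    (isClosed_lattice E Γ)).toMetricSpace

/-- The distance of the classes of `v` and `w` is the distance, in the norm of `E`, from `v - w`
to `Γ`. -/
theorem dist_toFlat [FiniteDimensional ℝ V] (E : InnerProductSpace.Core ℝ V) (Γ : Submodule ℤ V)
    [DiscreteTopology Γ] (v w : V) :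
    dist (toFlat E Γ (torusMk Γ v)) (toFlat E Γ (torusMk Γ w)) =
      ⨅ γ : Γ, √(E.inner (v - w - γ) (v - w - γ)) := by
  have h := @QuotientAddGroup.norm_mk V E.toNormedAddCommGroup.toSeminormedAddCommGroup
    Γ.toAddSubgroup (v - w)
  have h' := h.trans (@Metric.infDist_eq_iInf V
    E.toNormedAddCommGroup.toSeminormedAddCommGroup.toPseudoMetricSpace _ _)
  have key := @dist_eq_norm_sub _ (@QuotientAddGroup.instSeminormedAddCommGroup V
    E.toNormedAddCommGroup.toSeminormedAddCommGroup Γ.toAddSubgroup)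
    (toFlat E Γ (torusMk Γ v)) (toFlat E Γ (torusMk Γ w))
  exact (key.trans h').trans (iInf_congr fun γ : Γ => @dist_eq_norm_sub V
    E.toNormedAddCommGroup.toSeminormedAddCommGroup (v - w) γ)

instance [FiniteDimensional ℝ V] (E : InnerProductSpace.Core ℝ V) (Γ : Submodule ℤ V)
    [DiscreteTopology Γ] : MeasurableSpace (FlatTorus E Γ) := borel _

instance [FiniteDimensional ℝ V] (E : InnerProductSpace.Core ℝ V) (Γ : Submodule ℤ V)
    [DiscreteTopology Γ] : BorelSpace (FlatTorus E Γ) := ⟨rfl⟩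

end Torus

/-! ### Submanifolds and areas -/

/-- `Y` is a smooth (embedded) `d`-dimensional submanifold of the `n`-dimensional smooth
manifold `X`: around each of its points, some smooth chart of `X` straightens it to a
`d`-dimensional linear subspace. -/
def IsSmoothSubmanifold (n d : ℕ) {X : Type u} [TopologicalSpace X]
    [ChartedSpace (EuclideanSpace ℝ (Fin n)) X] (Y : Set X) : Prop :=
  ∀ y ∈ Y, ∃ e ∈ IsManifold.maximalAtlas (𝓡 n) ∞ X, y ∈ e.source ∧
    ∃ W : Submodule ℝ (EuclideanSpace ℝ (Fin n)), Module.finrank ℝ W = d ∧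
      ∀ x ∈ e.source, x ∈ Y ↔ e x ∈ W

/-- The map `f` does not expand `d`-dimensional areas: `vol_d (f(Y)) ≤ vol_d (Y)` for every smooth
`d`-dimensional submanifold `Y` of `X`. Here `vol_d` is the `d`-dimensional Hausdorff measure of
the Riemannian distance. (Mathlib's normalization differs from the Riemannian one by a positive
factor that depends only on `d`, and thus does not affect the inequality.) -/
def AreaNonexpanding (n d : ℕ) {X M : Type u} [EMetricSpace X] [MeasurableSpace X] [BorelSpace X]
    [ChartedSpace (EuclideanSpace ℝ (Fin n)) X] [EMetricSpace M] [MeasurableSpace M] [BorelSpace M]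
    (f : X → M) : Prop :=
  ∀ Y : Set X, IsSmoothSubmanifold n d Y →
    MeasureTheory.Measure.hausdorffMeasure d (f '' Y) ≤
      MeasureTheory.Measure.hausdorffMeasure d Y

end AreaMap

end

set_option linter.unusedSectionVars false

noncomputable section

/-! The torus is covered by `V`, so a path in it has a displacement in `V`, and displacement is a
closed singular 1-cochain. Hence the relative stable norm is the least mass of a Lipschitz cycle
with prescribed displacement (`relStableNorm_eq`), and no further homology is needed. It is finite
because a functional vanishing on all displacements of cycles of finite mass would be a coboundary,
hence zero on loops, whereas the loops realize all of `Γ` by surjectivity on fundamental groups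
(`relStableNorm_ne_top`). It is positive because `φ` can be deformed to a Lipschitz map, under which
displacement is bounded by a multiple of mass (`exists_isTorusLipschitz`,
`IsTorusLipschitz.enorm_chainDisp_le`). So its unit ball is a symmetric convex body, and compactness
gives a John ellipsoid.

Two dualities then produce the map. John's theorem (`exists_john_decomposition`) writes the identity
of the Euclidean space as `∑ lᵢ aᵢ ⊗ aᵢ` with `lᵢ ≥ 0`, `∑ lᵢ = d`, where each functional `⟨aᵢ, ·⟩`
is dominated by the stable norm. Each dominated functional `fᵢ` is calibrated
(`exists_calibration`): there is a function `gᵢ` on `X` for which the pullback of `fᵢ`, corrected by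
`dgᵢ`, has norm at most one. Translating the Lipschitz representative `ψ` by `∑ lᵢ gᵢ aᵢ` stays in
the homotopy class. If `τ` is a local lift of `ψ`, the new map is locally `∑ lᵢ uᵢ aᵢ`, where `uᵢ =
gᵢ + fᵢ ∘ τ` is 1-Lipschitz for the Riemannian metric, up to the distortion of a chart.

The area bound is linear algebra: if `D = ∑ lᵢ wᵢ ⊗ aᵢ` with all `‖wᵢ‖ ≤ 1`, then the
Hilbert–Schmidt norm satisfies `‖D‖² ≤ ∑ lᵢ ‖wᵢ‖² ≤ d`, so Hadamard's inequality and the inequality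
of arithmetic and geometric means give `|det D| ≤ 1` (`abs_det_sum_le`). Rademacher's theorem and
the area inequality carry this over to Lipschitz maps. On a submanifold it is applied in charts that
straighten the submanifold and distort the metric by at most `1 + ε`; then `ε` tends to zero. -/

namespace AreaMap

/-! ### Degree-one singular homology by chains and cochains -/

section Cochains

variable {M : Type u} [AddCommGroup M] [Module ℝ M]

/-- The linear map on simplicial `k`-chains that takes prescribed values on simplices. -/
def evalChain {S : SSet.{u}} {k : ℕ} (f : S _⦋k⦌ → M) :
    (S.chainComplex coeff).X k ⟶ ModuleCat.of ℝ M :=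
  Limits.Cofan.IsColimit.desc (S.isColimitChainComplexXCofan coeff k) fun x =>
    ModuleCat.ofHom ((LinearMap.toSpanSingleton ℝ M (f x)).comp ULift.moduleEquiv.toLinearMap)

theorem ι_evalChain {S : SSet.{u}} {k : ℕ} (f : S _⦋k⦌ → M) (x : S _⦋k⦌) :
    S.ιChainComplex (R := coeff) x ≫ evalChain f =
      ModuleCat.ofHom ((LinearMap.toSpanSingleton ℝ M (f x)).comp
        ULift.moduleEquiv.toLinearMap) :=
  Limits.Cofan.IsColimit.fac (S.isColimitChainComplexXCofan coeff k) _ x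

theorem evalChain_ι {S : SSet.{u}} {k : ℕ} (f : S _⦋k⦌ → M) (x : S _⦋k⦌) (r : ℝ) :
    (evalChain f).hom ((S.ιChainComplex (R := coeff) x).hom (ULift.up r)) = r • f x := by
  have h := congrArg (fun g => g.hom (ULift.up r)) (ι_evalChain f x)
  simpa using h

theorem chain_d_evalChain {S : SSet.{u}} {k : ℕ} (f : S _⦋k⦌ → M)
    (hf : ∀ x : S _⦋k + 1⦌, ∑ i : Fin (k + 2), (-1 : ℤ) ^ i.val • f (S.δ i x) = 0) :
    (S.chainComplex coeff).d (k + 1) k ≫ evalChain f = 0 := by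
  apply SSet.chainComplex_hom_ext
  intro x
  rw [← Category.assoc, SSet.ιChainComplex_d, Preadditive.sum_comp, Limits.comp_zero]
  simp only [Preadditive.zsmul_comp, ι_evalChain]
  ext r
  have : (∑ i : Fin (k + 2), (-1 : ℤ) ^ i.val • (r.down • f (S.δ i x))) = 0 := by
    have h := congrArg (fun v => r.down • v) (hf x)
    simp only [smul_zero, Finset.smul_sum] at h
    rw [← h]
    exact Finset.sum_congr rfl fun i _ => smul_comm _ _ _
  simpa [ModuleCat.hom_sum, ModuleCat.hom_zsmul] using this

theorem evalChain_toChain {X : Type u} [TopologicalSpace X]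
    (f : (TopCat.toSSet.obj (TopCat.of X)) _⦋1⦌ → M) (c : C(I, X) →₀ ℝ) :
    (evalChain f).hom (toChain c) = c.sum fun s r => r • f (pathSimplex s) := by
  simp only [toChain, Finsupp.sum, map_sum]
  exact Finset.sum_congr rfl fun s _ => evalChain_ι f (pathSimplex s) (c s)

end Cochains

variable {X : Type u} [TopologicalSpace X]

/-- A point of `X` as a singular `0`-simplex. -/
def pointSimplex (x : X) : (TopCat.toSSet.obj (TopCat.of X)) _⦋0⦌ :=
  ((TopCat.of X).toSSetObjEquiv (.op ⦋0⦌)).symm (ContinuousMap.const _ x)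

/-- The point of a singular `0`-simplex. -/
def simplexPoint (q : (TopCat.toSSet.obj (TopCat.of X)) _⦋0⦌) : X :=
  (TopCat.of X).toSSetObjEquiv (.op ⦋0⦌) q (stdSimplex.vertex (0 : Fin 1))

theorem pointSimplex_simplexPoint (q : (TopCat.toSSet.obj (TopCat.of X)) _⦋0⦌) :
    pointSimplex (simplexPoint q) = q := by
  apply ((TopCat.of X).toSSetObjEquiv (.op ⦋0⦌)).injective
  ext z
  rw [pointSimplex, Equiv.apply_symm_apply]
  exact congrArg ((TopCat.of X).toSSetObjEquiv (.op ⦋0⦌) q)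
    (Subsingleton.elim (α := stdSimplex ℝ (Fin 1)) _ _)

/-- A singular `1`-simplex as a path. -/
def simplexPath (q : (TopCat.toSSet.obj (TopCat.of X)) _⦋1⦌) : C(I, X) :=
  ((TopCat.of X).toSSetObjEquiv (.op ⦋1⦌) q).comp
    (stdSimplexHomeomorphUnitInterval.symm : C(I, stdSimplex ℝ (Fin 2)))

theorem simplexPath_pathSimplex (s : C(I, X)) : simplexPath (pathSimplex s) = s := by
  ext t
  simp [simplexPath, pathSimplex]

theorem symm_zero_eq_vertex :
    stdSimplexHomeomorphUnitInterval.symm 0 = stdSimplex.vertex (S := ℝ) (0 : Fin 2) := by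
  rw [Homeomorph.symm_apply_eq]
  exact stdSimplexHomeomorphUnitInterval_zero.symm

theorem symm_one_eq_vertex :
    stdSimplexHomeomorphUnitInterval.symm 1 = stdSimplex.vertex (S := ℝ) (1 : Fin 2) := by
  rw [Homeomorph.symm_apply_eq]
  exact stdSimplexHomeomorphUnitInterval_one.symm

theorem simplexPath_zero (q : (TopCat.toSSet.obj (TopCat.of X)) _⦋1⦌) :
    simplexPath q 0 = (TopCat.of X).toSSetObjEquiv (.op ⦋1⦌) q (stdSimplex.vertex (0 : Fin 2)) :=
  congrArg ((TopCat.of X).toSSetObjEquiv (.op ⦋1⦌) q) symm_zero_eq_vertex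

theorem simplexPath_one (q : (TopCat.toSSet.obj (TopCat.of X)) _⦋1⦌) :
    simplexPath q 1 = (TopCat.of X).toSSetObjEquiv (.op ⦋1⦌) q (stdSimplex.vertex (1 : Fin 2)) :=
  congrArg ((TopCat.of X).toSSetObjEquiv (.op ⦋1⦌) q) symm_one_eq_vertex

theorem simplexPoint_δ_zero (q : (TopCat.toSSet.obj (TopCat.of X)) _⦋1⦌) :
    simplexPoint ((TopCat.toSSet.obj (TopCat.of X)).δ 0 q) = simplexPath q 1 := by
  rw [simplexPath_one, simplexPoint]
  refine (TopCat.toSSetObjEquiv_δ_apply (X := TopCat.of X) q 0 _).trans ?_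
  rw [stdSimplex.map_vertex]
  rfl

theorem simplexPoint_δ_one (q : (TopCat.toSSet.obj (TopCat.of X)) _⦋1⦌) :
    simplexPoint ((TopCat.toSSet.obj (TopCat.of X)).δ 1 q) = simplexPath q 0 := by
  rw [simplexPath_zero, simplexPoint]
  refine (TopCat.toSSetObjEquiv_δ_apply (X := TopCat.of X) q 1 _).trans ?_
  rw [stdSimplex.map_vertex]
  rfl

/-- The formal boundary of a `1`-chain. -/
def formalBoundary : (C(I, X) →₀ ℝ) →ₗ[ℝ] X →₀ ℝ :=
  Finsupp.linearCombination ℝ fun s => Finsupp.single (s 1) 1 - Finsupp.single (s 0) 1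

/-- A cycle has vanishing formal boundary. -/
theorem Represents.formalBoundary_eq_zero {c : C(I, X) →₀ ℝ} {β : H1 X} (h : Represents c β) :
    formalBoundary c = 0 := by
  obtain ⟨z, hz, -⟩ := h
  -- The tautological 0-cochain, with values in the free module on the points; its coboundary,
  -- evaluated on `c`, is the formal boundary.
  let g : (TopCat.toSSet.obj (TopCat.of X)) _⦋0⦌ → (X →₀ ℝ) := fun q =>
    Finsupp.single (simplexPoint q) 1
  have h1 : (singularComplex X).d 1 0 ≫ evalChain g =
      evalChain fun q => g ((TopCat.toSSet.obj (TopCat.of X)).δ 0 q) -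
        g ((TopCat.toSSet.obj (TopCat.of X)).δ 1 q) := by
    apply SSet.chainComplex_hom_ext
    intro x
    rw [← Category.assoc, SSet.ιChainComplex_d, Preadditive.sum_comp]
    simp only [Preadditive.zsmul_comp, ι_evalChain]
    ext r : 2
    simp [Fin.sum_univ_two, sub_eq_add_neg]
  have h2 : ((singularComplex X).iCycles 1 ≫ (singularComplex X).d 1 0) = 0 :=
    HomologicalComplex.iCycles_d _ _ _
  have h3 : ((singularComplex X).d 1 0 ≫ evalChain g).hom (toChain c) = 0 := by
    rw [← hz]
    exact (congrArg (fun f => (evalChain g).hom (f.hom z)) h2).trans (map_zero _)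
  rw [h1, evalChain_toChain] at h3
  rw [formalBoundary, Finsupp.linearCombination_apply, ← h3]
  refine Finsupp.sum_congr fun s _ => ?_
  simp only [g, simplexPoint_δ_zero, simplexPoint_δ_one, simplexPath_pathSimplex]

/-- A chain with vanishing formal boundary represents a homology class. -/
theorem exists_represents {c : C(I, X) →₀ ℝ} (h : formalBoundary c = 0) :
    ∃ β : H1 X, Represents c β := by
  let J : X → ℝ →ₗ[ℝ] (singularComplex X).X 0 := fun x =>
    ((TopCat.toSSet.obj (TopCat.of X)).ιChainComplex (R := coeff) (pointSimplex x)).hom.comp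
      ULift.moduleEquiv.symm.toLinearMap
  have hd : ∀ (s : C(I, X)) (r : ℝ), ((singularComplex X).d 1 0).hom
      (((TopCat.toSSet.obj (TopCat.of X)).ιChainComplex (R := coeff) (pathSimplex s)).hom
      (ULift.up r) : (singularComplex X).X 1) = J (s 1) r - J (s 0) r := by
    intro s r
    have h1 := congrArg (fun f => f.hom (ULift.up r))
      (SSet.ιChainComplex_d (X := TopCat.toSSet.obj (TopCat.of X)) (R := coeff) (pathSimplex s))
    have e0 : (TopCat.toSSet.obj (TopCat.of X)).δ 0 (pathSimplex s) = pointSimplex (s 1) := by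
      rw [← pointSimplex_simplexPoint (X := X) ((TopCat.toSSet.obj (TopCat.of X)).δ 0 _), simplexPoint_δ_zero,
        simplexPath_pathSimplex]
    have e1 : (TopCat.toSSet.obj (TopCat.of X)).δ 1 (pathSimplex s) = pointSimplex (s 0) := by
      rw [← pointSimplex_simplexPoint (X := X) ((TopCat.toSSet.obj (TopCat.of X)).δ 1 _), simplexPoint_δ_one,
        simplexPath_pathSimplex]
    refine h1.trans ?_
    rw [Fin.sum_univ_two, e0, e1]
    simp [sub_eq_add_neg, J]
  have hc : ((singularComplex X).d 1 0).hom (toChain c) = 0 := by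
    -- The singular boundary factors through the formal one, since a singular 0-simplex is
    -- determined by its point.
    have : ((singularComplex X).d 1 0).hom (toChain c) = Finsupp.lsum ℝ J (formalBoundary c) := by
      rw [toChain, formalBoundary, Finsupp.linearCombination_apply]
      simp only [Finsupp.sum, map_sum, map_sub, map_smul, Finsupp.lsum_single]
      refine Finset.sum_congr rfl fun s _ => (hd s (c s)).trans ?_
      rw [smul_sub, ← map_smul, ← map_smul, smul_eq_mul, mul_one]
    rw [this, h, map_zero]
  -- The chain becomes a morphism from the coefficient module, so that it lifts to the cycles by
  -- their universal property.
  let k : coeff ⟶ (singularComplex X).X 1 := ModuleCat.ofHom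
    ((LinearMap.toSpanSingleton ℝ ((singularComplex X).X 1) (toChain c)).comp
      ULift.moduleEquiv.toLinearMap)
  have hk : k ≫ (singularComplex X).d 1 0 = 0 := by
    ext r
    change ((singularComplex X).d 1 0).hom (r.down • toChain c) = 0
    rw [map_smul, hc, smul_zero]
  let z := ((singularComplex X).liftCycles k 0 (by simp) hk).hom (ULift.up 1)
  refine ⟨_, z, ?_, rfl⟩
  exact (congrArg (fun f => f.hom (ULift.up (1 : ℝ)))
    ((singularComplex X).liftCycles_i k 0 (by simp) hk)).trans (one_smul ℝ (toChain c))

/-- Two cycles that represent the same class have the same value under every closed cochain. -/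
theorem Represents.eval_eq {M : Type u} [AddCommGroup M] [Module ℝ M]
    {f : (TopCat.toSSet.obj (TopCat.of X)) _⦋1⦌ → M}
    (hf : ∀ x : (TopCat.toSSet.obj (TopCat.of X)) _⦋2⦌,
      ∑ i : Fin 3, (-1 : ℤ) ^ i.val • f ((TopCat.toSSet.obj (TopCat.of X)).δ i x) = 0)
    {c c' : C(I, X) →₀ ℝ} {β : H1 X} (h : Represents c β) (h' : Represents c' β) :
    (c.sum fun s r => r • f (pathSimplex s)) = c'.sum fun s r => r • f (pathSimplex s) := by
  let K := singularComplex X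
  have hd : K.d 2 1 ≫ evalChain f = 0 := chain_d_evalChain f hf
  -- A closed cochain vanishes on boundaries, so it descends to chains modulo boundaries, where
  -- homology embeds.
  let g : K.opcycles 1 ⟶ ModuleCat.of ℝ M := K.descOpcycles (evalChain f) 2 (by simp) hd
  have key : K.homologyπ 1 ≫ K.homologyι 1 ≫ g = K.iCycles 1 ≫ evalChain f := by
    rw [HomologicalComplex.homology_π_ι_assoc, HomologicalComplex.p_descOpcycles]
  have aux : ∀ {c : C(I, X) →₀ ℝ}, Represents c β →
      (c.sum fun s r => r • f (pathSimplex s)) = (K.homologyι 1 ≫ g).hom β := by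
    rintro c ⟨z, hz, rfl⟩
    rw [← evalChain_toChain, ← hz]
    exact (congrArg (fun f => f.hom z) key).symm
  rw [aux h, aux h']

theorem Represents.map {Y : Type u} [TopologicalSpace Y] (φ : C(X, Y)) {c : C(I, X) →₀ ℝ}
    {β : H1 X} (h : Represents c β) :
    Represents (c.mapDomain fun s => φ.comp s) (H1map φ β) := by
  obtain ⟨z, hz, rfl⟩ := h
  let F := SSet.chainComplexMap (TopCat.toSSet.map (TopCat.ofHom φ)) coeff.{u}
  refine ⟨(HomologicalComplex.cyclesMap F 1).hom z, ?_, ?_⟩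
  · have h1 := congrArg (fun f => f.hom z) (HomologicalComplex.cyclesMap_i F 1)
    have h2 : (F.f 1).hom (toChain c) = toChain (c.mapDomain fun s => φ.comp s) := by
      rw [toChain, toChain, Finsupp.sum_mapDomain_index]
      · simp only [Finsupp.sum, map_sum]
        refine Finset.sum_congr rfl fun s _ => ?_
        exact congrArg (fun f => ModuleCat.Hom.hom f (ULift.up (c s)))
          (SSet.ι_chainComplexMap_f _ _ (f := TopCat.toSSet.map (TopCat.ofHom φ)) (R := coeff)
            (pathSimplex s))
      · intro s
        exact map_zero _
      · intro s a b
        exact map_add _ (ULift.up a) (ULift.up b)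
    rw [← h2, ← hz]
    exact h1
  · have h1 := congrArg (fun f => f.hom z) (HomologicalComplex.homologyπ_naturality F 1)
    exact h1.symm

end AreaMap

namespace AreaMap

/-! ### Lifting to the universal cover of the torus, and displacement. -/

section Covering

variable {V : Type u} [NormedAddCommGroup V] [NormedSpace ℝ V] (Γ : Submodule ℤ V)

theorem torusMk_eq_iff {v w : V} : torusMk Γ v = torusMk Γ w ↔ v - w ∈ Γ :=
  Submodule.Quotient.eq Γ

theorem torusMk_add (v w : V) : torusMk Γ (v + w) = torusMk Γ v + torusMk Γ w := rfl

theorem torusMk_sub (v w : V) : torusMk Γ (v - w) = torusMk Γ v - torusMk Γ w := rfl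

theorem torusMk_surjective : Function.Surjective (torusMk Γ) := Submodule.Quotient.mk_surjective Γ

variable [DiscreteTopology Γ]

theorem isCoveringMap_torusMk : IsCoveringMap (torusMk Γ) := by
  have hd : IsDiscrete (Γ.toAddSubgroup : Set V) := ⟨inferInstanceAs (DiscreteTopology Γ)⟩
  have hq : Topology.IsQuotientMap (torusMk Γ) := isQuotientMap_quot_mk
  refine (hq.isAddQuotientCoveringMap_of_addSubgroup Γ.toAddSubgroup hd
    fun {e₁ e₂} => ?_).isCoveringMap
  rw [eq_comm, torusMk_eq_iff, sub_eq_add_neg]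
  rfl

/-- A contraction of `A` composed with `f` is a homotopy from a constant map, which lifts, to `f`;
the homotopy lifting property gives a lift of its end. -/
theorem exists_lift_of_contractible {A : Type*} [TopologicalSpace A] [ContractibleSpace A]
    (f : C(A, V ⧸ Γ)) : ∃ F : C(A, V), (torusMk Γ).comp F = f := by
  obtain ⟨a, ⟨H⟩⟩ := id_nullhomotopic A
  obtain ⟨v, hv⟩ := torusMk_surjective Γ (f a)
  let H' : C(I × A, V ⧸ Γ) := f.comp (H.symm : C(I × A, A))
  have h0 : ∀ x, H' (0, x) = torusMk Γ (ContinuousMap.const A v x) := by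
    intro x
    simp [H', hv]
  let G := (isCoveringMap_torusMk Γ).liftHomotopy H' (ContinuousMap.const A v) h0
  refine ⟨G.comp ((ContinuousMap.const A (1 : I)).prodMk (ContinuousMap.id A)), ?_⟩
  ext x
  have := congrFun ((isCoveringMap_torusMk Γ).liftHomotopy_lifts H' _ h0) (1, x)
  refine this.trans ?_
  simp [H']

theorem exists_lift_path (s : C(I, V ⧸ Γ)) : ∃ τ : C(I, V), (torusMk Γ).comp τ = s := by
  obtain ⟨v, hv⟩ := torusMk_surjective Γ (s 0)
  refine ⟨(isCoveringMap_torusMk Γ).liftPath s v hv.symm, ?_⟩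
  ext t
  exact congrFun ((isCoveringMap_torusMk Γ).liftPath_lifts s v hv.symm) t

/-- A lift of a path in `V/Γ` to `V`. -/
def pathLift (s : C(I, V ⧸ Γ)) : C(I, V) := (exists_lift_path Γ s).choose

theorem torusMk_comp_pathLift (s : C(I, V ⧸ Γ)) : (torusMk Γ).comp (pathLift Γ s) = s :=
  (exists_lift_path Γ s).choose_spec

theorem torusMk_pathLift (s : C(I, V ⧸ Γ)) (t : I) : torusMk Γ (pathLift Γ s t) = s t :=
  congrArg (fun f : C(I, V ⧸ Γ) => f t) (torusMk_comp_pathLift Γ s)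

/-- The displacement of a path in `V/Γ`: the difference of the endpoints of a lift. -/
def disp (s : C(I, V ⧸ Γ)) : V := pathLift Γ s 1 - pathLift Γ s 0

/-- Two lifts of the same map differ by a constant. -/
theorem lift_sub_lift_eq {A : Type*} [TopologicalSpace A] [PreconnectedSpace A] {F G : A → V}
    (hF : Continuous F) (hG : Continuous G) (h : ∀ a, torusMk Γ (F a) = torusMk Γ (G a)) (a b : A) :
    F a - F b = G a - G b := by
  -- Translating `G` by the lattice vector `F a - G a` gives a lift that agrees with `F` at `a`,
  -- hence everywhere.
  have := (isCoveringMap_torusMk Γ).eq_of_comp_eq (g₁ := F) (g₂ := fun x => G x + (F a - G a)) hF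
    (hG.add continuous_const) (by
      ext x
      have h1 : torusMk Γ (F a - G a) = 0 := by rw [torusMk_sub, h, sub_self]
      simp [torusMk_add, h1, h]) a (by simp)
  rw [show F b = G b + (F a - G a) from congrFun this b]
  abel

/-- Lifts of one path differ by a constant, so the choice made in `pathLift` is immaterial. -/
theorem disp_torusMk_comp (τ : C(I, V)) : disp Γ ((torusMk Γ).comp τ) = τ 1 - τ 0 :=
  lift_sub_lift_eq Γ (pathLift Γ _).continuous τ.continuous (fun a => torusMk_pathLift Γ _ a) 1 0

instance contractibleSpace_stdSimplex : ContractibleSpace (stdSimplex ℝ (Fin 3)) :=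
  (convex_stdSimplex ℝ (Fin 3)).contractibleSpace ⟨_, single_mem_stdSimplex ℝ 0⟩

/-- The displacement is a closed singular `1`-cochain of `V/Γ`. -/
theorem disp_closed (x : (TopCat.toSSet.obj (TopCat.of (V ⧸ Γ))) _⦋2⦌) :
    ∑ i : Fin 3, (-1 : ℤ) ^ i.val •
      disp Γ (simplexPath ((TopCat.toSSet.obj (TopCat.of (V ⧸ Γ))).δ i x)) = 0 := by
  -- One lift of the whole 2-simplex computes the displacements of all three edges, and their
  -- alternating sum telescopes.
  obtain ⟨F, hF⟩ := exists_lift_of_contractible Γ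
    (A := stdSimplex ℝ (Fin 3)) ((TopCat.of (V ⧸ Γ)).toSSetObjEquiv (.op ⦋2⦌) x)
  have key : ∀ i : Fin 3, disp Γ (simplexPath ((TopCat.toSSet.obj (TopCat.of (V ⧸ Γ))).δ i x)) =
      F (stdSimplex.vertex (i.succAbove 1)) - F (stdSimplex.vertex (i.succAbove 0)) := by
    intro i
    have h1 : simplexPath ((TopCat.toSSet.obj (TopCat.of (V ⧸ Γ))).δ i x) =
        (torusMk Γ).comp ((F.comp ⟨_, stdSimplex.continuous_map i.succAbove⟩).comp
          (stdSimplexHomeomorphUnitInterval.symm : C(I, stdSimplex ℝ (Fin 2)))) := by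
      ext t
      refine (TopCat.toSSetObjEquiv_δ_apply (X := TopCat.of (V ⧸ Γ)) x i _).trans ?_
      exact (congrArg (fun f : C(stdSimplex ℝ (Fin 3), V ⧸ Γ) => f (stdSimplex.map i.succAbove
        (stdSimplexHomeomorphUnitInterval.symm t))) hF).symm
    rw [h1, disp_torusMk_comp]
    simp only [ContinuousMap.comp_apply, ContinuousMap.coe_mk]
    have e1 := congrArg (stdSimplex.map i.succAbove) symm_one_eq_vertex
    have e0 := congrArg (stdSimplex.map i.succAbove) symm_zero_eq_vertex
    rw [stdSimplex.map_vertex] at e1 e0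
    exact congrArg₂ (fun a b => F a - F b) e1 e0
  simp only [key, Fin.sum_univ_three]
  have h01 : (0 : Fin 3).succAbove 1 = 2 := rfl
  have h00 : (0 : Fin 3).succAbove 0 = 1 := rfl
  have h11 : (1 : Fin 3).succAbove 1 = 2 := rfl
  have h10 : (1 : Fin 3).succAbove 0 = 0 := rfl
  have h21 : (2 : Fin 3).succAbove 1 = 1 := rfl
  have h20 : (2 : Fin 3).succAbove 0 = 0 := rfl
  rw [h01, h00, h11, h10, h21, h20]
  simp

end Covering

/-! ### The relative stable norm without homology. -/

section RelStableNorm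

variable {V : Type u} [NormedAddCommGroup V] [NormedSpace ℝ V] (Γ : Submodule ℤ V)
  [DiscreteTopology Γ]

/-- The displacement of a `1`-chain under a map to `V/Γ`. -/
def chainDisp {X : Type u} [TopologicalSpace X] (φ : C(X, V ⧸ Γ)) : (C(I, X) →₀ ℝ) →ₗ[ℝ] V :=
  Finsupp.linearCombination ℝ fun s => disp Γ (φ.comp s)

variable (n : ℕ) {X : Type u} [EMetricSpace X]
  [ChartedSpace (EuclideanSpace ℝ (Fin n)) X]
  [Bundle.RiemannianBundle (fun x : X => TangentSpace (𝓡 n) x)]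

/-- All paths of the chain are Lipschitz. -/
def IsLipChain {X : Type u} [EMetricSpace X] (c : C(I, X) →₀ ℝ) : Prop :=
  ∀ s ∈ c.support, ∃ K : ℝ≥0, LipschitzWith K s

/-- The mass `∑ᵢ |rᵢ| length(sᵢ)` of a chain. -/
def mass (c : C(I, X) →₀ ℝ) : ℝ≥0∞ := c.sum fun s r => ‖r‖ₑ * pathLength n s

/-- The relative stable norm in terms of cycles and displacements, without homology. -/
theorem relStableNorm_eq (φ : C(X, V ⧸ Γ)) (v : V) :
    relStableNorm n Γ φ v = ⨅ (c : C(I, X) →₀ ℝ) (_ : IsLipChain c)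
      (_ : formalBoundary c = 0 ∧ chainDisp Γ φ c = v), mass n c := by
  apply le_antisymm
  · refine le_iInf fun c => le_iInf fun hc => le_iInf fun h => ?_
    obtain ⟨β, hβ⟩ := exists_represents h.1
    have hcor : CorrespondsTo Γ (H1map φ β) v := by
      refine ⟨c.mapDomain fun s => pathLift Γ (φ.comp s), ?_, ?_⟩
      · rw [← Finsupp.mapDomain_comp]
        convert hβ.map φ using 2
        ext1 s
        exact torusMk_comp_pathLift Γ _
      · rw [Finsupp.sum_mapDomain_index (by simp) (by simp [add_smul])]
        rw [← h.2, chainDisp, Finsupp.linearCombination_apply]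
        rfl
    exact iInf₂_le_of_le β hcor (iInf₂_le_of_le c hc (iInf_le_of_le hβ le_rfl))
  · refine le_iInf fun β => le_iInf fun hβ => le_iInf fun c => le_iInf fun hc => le_iInf fun h => ?_
    refine iInf₂_le_of_le c hc (iInf_le_of_le ⟨h.formalBoundary_eq_zero, ?_⟩ le_rfl)
    obtain ⟨c', hc', rfl⟩ := hβ
    -- The image of `c` and the cycle witnessing the correspondence represent the same class, so the
    -- closed cochain `disp` takes the same value on both.
    have := (h.map φ).eval_eq (f := fun q => disp Γ (simplexPath q)) (disp_closed Γ) hc'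
    rw [Finsupp.sum_mapDomain_index (by simp) (by simp [add_smul]),
      Finsupp.sum_mapDomain_index (by simp) (by simp [add_smul])] at this
    simp only [simplexPath_pathSimplex, disp_torusMk_comp] at this
    rw [← this, chainDisp, Finsupp.linearCombination_apply]

end RelStableNorm

end AreaMap

namespace AreaMap

open Filter Topology Metric

/-! ### Almost isometric charts. -/

section Charts

variable (n : ℕ) {X : Type u} [EMetricSpace X] [ChartedSpace (EuclideanSpace ℝ (Fin n)) X]
  [Bundle.RiemannianBundle (fun x : X => TangentSpace (𝓡 n) x)]

/-- The derivative of a chart, with values in the model vector space. -/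
def dchart (h : OpenPartialHomeomorph X (EuclideanSpace ℝ (Fin n))) (x : X) :
    TangentSpace (𝓡 n) x →L[ℝ] EuclideanSpace ℝ (Fin n) :=
  mfderiv (𝓡 n) (𝓡 n) h x

/-- A chart which is isometric up to a factor `1 + ε`, infinitesimally. -/
structure IsAlmostIsometricChart (ε : ℝ)
    (h : OpenPartialHomeomorph X (EuclideanSpace ℝ (Fin n))) : Prop where
  mem_maximalAtlas : h ∈ IsManifold.maximalAtlas (𝓡 n) 1 X
  norm_le : ∀ x ∈ h.source, ∀ w : TangentSpace (𝓡 n) x, ‖dchart n h x w‖ ≤ (1 + ε) * ‖w‖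
  le_norm : ∀ x ∈ h.source, ∀ w : TangentSpace (𝓡 n) x, ‖w‖ ≤ (1 + ε) * ‖dchart n h x w‖

variable [IsManifold (𝓡 n) ∞ X]
  [IsContMDiffRiemannianBundle (𝓡 n) ∞ (EuclideanSpace ℝ (Fin n))
      (fun x : X => TangentSpace (𝓡 n) x)]

theorem mfderiv_chart_trans {e χ : OpenPartialHomeomorph X (EuclideanSpace ℝ (Fin n))}
    (he : e ∈ IsManifold.maximalAtlas (𝓡 n) 1 X) (hχ : χ ∈ IsManifold.maximalAtlas (𝓡 n) 1 X)
    {x : X} (hx : x ∈ e.source) (hx' : x ∈ χ.source) (w : TangentSpace (𝓡 n) x) :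
    dchart n e x w = fderiv ℝ (e ∘ χ.symm) (χ x) (dchart n χ x w) := by
  have h1 : MDifferentiableAt (𝓡 n) (𝓡 n) χ x :=
    mdifferentiableAt_of_mem_maximalAtlas hχ hx'
  have h2 : MDifferentiableAt (𝓡 n) (𝓡 n) χ.symm (χ x) :=
    mdifferentiableAt_symm_of_mem_maximalAtlas hχ (χ.map_source hx')
  have h3 : MDifferentiableAt (𝓡 n) (𝓡 n) e (χ.symm (χ x)) := by
    rw [χ.left_inv hx']
    exact mdifferentiableAt_of_mem_maximalAtlas he hx
  have h4 : MDifferentiableAt (𝓡 n) (𝓡 n) (e ∘ χ.symm) (χ x) := h3.comp _ h2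
  have h5 : (e ∘ χ.symm) ∘ χ =ᶠ[𝓝 x] e := by
    filter_upwards [χ.open_source.mem_nhds hx'] with z hz
    simp [χ.left_inv hz]
  have h6 : mfderiv (𝓡 n) (𝓡 n) ((e ∘ χ.symm) ∘ χ) x = mfderiv (𝓡 n) (𝓡 n) e x := h5.mfderiv_eq
  rw [mfderiv_comp x h4 h1] at h6
  have h7 := congrArg (fun f => f w) h6
  rw [mfderiv_eq_fderiv] at h7
  exact h7.symm

theorem continuousAt_fderiv_chart_trans
    {e χ : OpenPartialHomeomorph X (EuclideanSpace ℝ (Fin n))}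
    (he : e ∈ IsManifold.maximalAtlas (𝓡 n) 1 X) (hχ : χ ∈ IsManifold.maximalAtlas (𝓡 n) 1 X)
    {x : X} (hx : x ∈ e.source) (hx' : x ∈ χ.source) :
    ContinuousAt (fun z => fderiv ℝ (e ∘ χ.symm) (χ z)) x := by
  have h2 : ContMDiffAt (𝓡 n) (𝓡 n) 1 χ.symm (χ x) :=
    contMDiffAt_symm_of_mem_maximalAtlas hχ (χ.map_source hx')
  have h3 : ContMDiffAt (𝓡 n) (𝓡 n) 1 e (χ.symm (χ x)) := by
    rw [χ.left_inv hx']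
    exact contMDiffAt_of_mem_maximalAtlas he hx
  have h4 : ContDiffAt ℝ 1 (e ∘ χ.symm) (χ x) := contMDiffAt_iff_contDiffAt.1 (h3.comp _ h2)
  exact ContinuousAt.comp (f := χ) (g := fun p => fderiv ℝ (e ∘ χ.symm) p)
    (h4.fderiv_right (m := 0) (by simp)).continuousAt (χ.continuousAt hx')

/-- The linear map is chosen so that the corrected chart is isometric at `y` itself. Near `y` the
transition derivative and the metric, compared through the tangent trivialization, vary
continuously, so each spoils the isometry only by a factor close to one. -/
theorem exists_chart_estimate (e : OpenPartialHomeomorph X (EuclideanSpace ℝ (Fin n)))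
    (he : e ∈ IsManifold.maximalAtlas (𝓡 n) 1 X) {y : X} (hy : y ∈ e.source) {ε : ℝ} (hε : 0 < ε) :
    ∃ T : EuclideanSpace ℝ (Fin n) ≃L[ℝ] EuclideanSpace ℝ (Fin n),
      ∀ᶠ x in 𝓝 y, ∀ w : TangentSpace (𝓡 n) x,
        ‖T (dchart n e x w)‖ ≤ (1 + ε) * ‖w‖ ∧ ‖w‖ ≤ (1 + ε) * ‖T (dchart n e x w)‖ := by
  have : IsManifold (𝓡 n) 1 X := IsManifold.of_le (n := ∞) (by simp)
  let F := EuclideanSpace ℝ (Fin n)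
  have hcont : IsContinuousRiemannianBundle F (fun x : X => TangentSpace (𝓡 n) x) := by
    obtain ⟨g, hg, hg'⟩ := IsContMDiffRiemannianBundle.exists_contMDiff (IB := 𝓡 n) (n := ∞)
      (F := F) (E := fun x : X => TangentSpace (𝓡 n) x)
    exact ⟨g, hg.continuous, hg'⟩
  have hfd : FiniteDimensional ℝ (TangentSpace (𝓡 n) y) := inferInstanceAs (FiniteDimensional ℝ F)
  have hfr : Module.finrank ℝ (TangentSpace (𝓡 n) y) = n := finrank_euclideanSpace_fin (𝕜 := ℝ)
  let J : TangentSpace (𝓡 n) y ≃ₗᵢ[ℝ] F :=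
    ((stdOrthonormalBasis ℝ (TangentSpace (𝓡 n) y)).reindex (finCongr hfr)).repr
  have he' : e.MDifferentiable (𝓡 n) (𝓡 n) :=
    ⟨fun x hx => (mdifferentiableAt_of_mem_maximalAtlas he hx).mdifferentiableWithinAt,
      fun x hx => (mdifferentiableAt_symm_of_mem_maximalAtlas he hx).mdifferentiableWithinAt⟩
  let D : TangentSpace (𝓡 n) y ≃L[ℝ] F := he'.mfderiv hy
  -- With this choice `T` composed with the derivative of `e` at `y` is the isometry `J`.
  let T : F ≃L[ℝ] F := D.symm.trans J.toContinuousLinearEquiv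
  let χ := chartAt F y
  have hχ : χ ∈ IsManifold.maximalAtlas (𝓡 n) 1 X := IsManifold.chart_mem_maximalAtlas y
  let triv := trivializationAt F (fun x : X => TangentSpace (𝓡 n) x) y
  have htriv : ∀ x ∈ χ.source, ∀ w : TangentSpace (𝓡 n) x,
      triv.continuousLinearMapAt ℝ x w = dchart n χ x w := by
    intro x hx w
    have : triv.continuousLinearMapAt ℝ x = mfderiv (𝓡 n) (𝓡 n) (extChartAt (𝓡 n) y) x :=
      TangentBundle.continuousLinearMapAt_trivializationAt hx
    exact congrArg (fun f => f w) this
  have hyχ : y ∈ χ.source := mem_chart_source F y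
  have hbase : ∀ x ∈ χ.source, x ∈ triv.baseSet := fun x hx => by
    simpa [triv, TangentBundle.trivializationAt_baseSet] using hx
  -- the transition from the metric at `y` to the metric at `x`
  let G : X → F →L[ℝ] F := fun x => (((J.toContinuousLinearEquiv : TangentSpace (𝓡 n) y →L[ℝ] F).comp
    (D.symm : F →L[ℝ] TangentSpace (𝓡 n) y)).comp (fderiv ℝ (e ∘ χ.symm) (χ x))).comp
      ((triv.continuousLinearMapAt ℝ y).comp
        (J.symm.toContinuousLinearEquiv : F →L[ℝ] TangentSpace (𝓡 n) y))
  have hG : ContinuousAt G y := by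
    have := continuousAt_fderiv_chart_trans n he hχ hy hyχ
    exact (continuousAt_const.clm_comp this).clm_comp continuousAt_const
  have hGy : G y = ContinuousLinearMap.id ℝ F := by
    ext1 u
    change J (D.symm (fderiv ℝ (e ∘ χ.symm) (χ y) (triv.continuousLinearMapAt ℝ y (J.symm u)))) = u
    rw [htriv y hyχ, ← mfderiv_chart_trans n he hχ hy hyχ]
    have : D.symm (dchart n e y (J.symm u)) = J.symm u := D.symm_apply_apply _
    rw [this, J.apply_symm_apply]
  -- Transport of tangent vectors from `x` to `y` through the trivialization; continuity of the
  -- metric makes it nearly isometric.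
  let a : ∀ x, TangentSpace (𝓡 n) x → TangentSpace (𝓡 n) y := fun x w =>
    triv.symmL ℝ y (triv.continuousLinearMapAt ℝ x w)
  have hTG : ∀ x ∈ χ.source ∩ e.source, ∀ w, T (dchart n e x w) = G x (J (a x w)) := by
    intro x hx w
    change J (D.symm _) = J (D.symm (fderiv ℝ (e ∘ χ.symm) (χ x)
      (triv.continuousLinearMapAt ℝ y (J.symm (J (a x w))))))
    rw [J.symm_apply_apply, triv.continuousLinearMapAt_symmL (hbase y hyχ), htriv x hx.1,
      ← mfderiv_chart_trans n he hχ hx.2 hx.1]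
  -- Two errors of factor `r` are multiplied below, one from `G` and one from the transport `a`.
  obtain ⟨r, hr1, hr2⟩ : ∃ r : ℝ, 1 < r ∧ r * r < 1 + ε := by
    have h : ∀ᶠ r : ℝ in 𝓝 1, r * r < 1 + ε := by
      have : Tendsto (fun r : ℝ => r * r) (𝓝 1) (𝓝 (1 * 1)) := tendsto_id.mul tendsto_id
      exact this.eventually (gt_mem_nhds (by linarith))
    exact ((h.filter_mono nhdsWithin_le_nhds).and
      (self_mem_nhdsWithin : Set.Ioi (1 : ℝ) ∈ 𝓝[>] 1)).exists.imp fun r h => ⟨h.2, h.1⟩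
  have hr0 : 0 < r := by linarith
  have hδ : 0 < 1 - r⁻¹ := by
    have := inv_lt_one_of_one_lt₀ hr1
    linarith
  -- If `G x` is this close to the identity, it stretches norms by at most `r` and shrinks them by
  -- at most `r⁻¹`.
  have hδ' : 0 < min (1 - r⁻¹) (r - 1) := lt_min hδ (by linarith)
  refine ⟨T, ?_⟩
  filter_upwards [χ.open_source.mem_nhds hyχ, e.open_source.mem_nhds hy,
    eventually_norm_symmL_trivializationAt_self_comp_lt F
      (fun x : X => TangentSpace (𝓡 n) x) y hr1,
    eventually_norm_symmL_trivializationAt_comp_self_lt F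
      (fun x : X => TangentSpace (𝓡 n) x) y hr1,
    hG.eventually (Metric.ball_mem_nhds (G y) hδ')] with x hx1 hx2 hx3 hx4 hx5 w
  have hx5' : ‖G x - ContinuousLinearMap.id ℝ F‖ < min (1 - r⁻¹) (r - 1) := by
    rw [← hGy, ← dist_eq_norm]
    exact hx5
  have hdiff : ∀ u : F, ‖G x u - u‖ ≤ min (1 - r⁻¹) (r - 1) * ‖u‖ := fun u =>
    ((G x - ContinuousLinearMap.id ℝ F).le_opNorm u).trans
      (mul_le_mul_of_nonneg_right hx5'.le (norm_nonneg _))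
  have hup : ∀ u : F, ‖G x u‖ ≤ r * ‖u‖ := fun u => by
    have h1 := hdiff u
    have h2 : min (1 - r⁻¹) (r - 1) * ‖u‖ ≤ (r - 1) * ‖u‖ :=
      mul_le_mul_of_nonneg_right (min_le_right _ _) (norm_nonneg _)
    have h3 := norm_le_norm_add_norm_sub' (G x u) u
    nlinarith
  have hlow : ∀ u : F, ‖u‖ ≤ r * ‖G x u‖ := fun u => by
    have h1 := hdiff u
    have h2 : min (1 - r⁻¹) (r - 1) * ‖u‖ ≤ (1 - r⁻¹) * ‖u‖ :=
      mul_le_mul_of_nonneg_right (min_le_left _ _) (norm_nonneg _)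
    have h3 := norm_le_norm_add_norm_sub (G x u) u
    have h4 : r⁻¹ * ‖u‖ ≤ ‖G x u‖ := by linarith
    rwa [inv_mul_le_iff₀ hr0] at h4
  have ha : ‖a x w‖ ≤ r * ‖w‖ :=
    (((triv.symmL ℝ y).comp (triv.continuousLinearMapAt ℝ x)).le_opNorm w).trans
      (mul_le_mul_of_nonneg_right hx3.le (norm_nonneg _))
  have hb : ‖w‖ ≤ r * ‖a x w‖ := by
    have h1 : (triv.symmL ℝ x).comp (triv.continuousLinearMapAt ℝ y) (a x w) = w := by
      change triv.symmL ℝ x (triv.continuousLinearMapAt ℝ y (triv.symmL ℝ y _)) = w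
      rw [triv.continuousLinearMapAt_symmL (hbase y hyχ),
        triv.symmL_continuousLinearMapAt (hbase x hx1)]
    calc ‖w‖ = ‖(triv.symmL ℝ x).comp (triv.continuousLinearMapAt ℝ y) (a x w)‖ := by rw [h1]
      _ ≤ r * ‖a x w‖ := (((triv.symmL ℝ x).comp (triv.continuousLinearMapAt ℝ y)).le_opNorm
          _).trans (mul_le_mul_of_nonneg_right hx4.le (norm_nonneg _))
  rw [hTG x ⟨hx1, hx2⟩ w]
  have hJ : ‖J (a x w)‖ = ‖a x w‖ := J.norm_map _
  constructor
  · have h1 := hup (J (a x w))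
    rw [hJ] at h1
    calc _ ≤ r * (r * ‖w‖) := h1.trans (mul_le_mul_of_nonneg_left ha hr0.le)
      _ = r * r * ‖w‖ := by ring
      _ ≤ _ := mul_le_mul_of_nonneg_right hr2.le (norm_nonneg _)
  · have h1 := hlow (J (a x w))
    rw [hJ] at h1
    calc _ ≤ r * (r * _) := hb.trans (mul_le_mul_of_nonneg_left h1 hr0.le)
      _ = r * r * _ := by ring
      _ ≤ _ := mul_le_mul_of_nonneg_right hr2.le (norm_nonneg _)

end Charts

end AreaMap

namespace AreaMap

open Filter Topology Metric MeasureTheory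

section Charts

variable (n : ℕ) {X : Type u} [EMetricSpace X] [ChartedSpace (EuclideanSpace ℝ (Fin n)) X]
  [Bundle.RiemannianBundle (fun x : X => TangentSpace (𝓡 n) x)]
  [IsManifold (𝓡 n) ∞ X]
  [IsContMDiffRiemannianBundle (𝓡 n) ∞ (EuclideanSpace ℝ (Fin n))
      (fun x : X => TangentSpace (𝓡 n) x)]

/-- Around every point, every chart becomes almost isometric after a linear change of coordinates
and a restriction to a small ball. -/
theorem exists_almostIsometricChart (e : OpenPartialHomeomorph X (EuclideanSpace ℝ (Fin n)))
    (he : e ∈ IsManifold.maximalAtlas (𝓡 n) 1 X) {y : X} (hy : y ∈ e.source) {ε : ℝ} (hε : 0 < ε) :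
    ∃ (T : EuclideanSpace ℝ (Fin n) ≃L[ℝ] EuclideanSpace ℝ (Fin n))
      (h : OpenPartialHomeomorph X (EuclideanSpace ℝ (Fin n))), y ∈ h.source ∧
      h.source ⊆ e.source ∧ (∀ x, h x = T (e x)) ∧ Convex ℝ h.target ∧
      IsAlmostIsometricChart n ε h := by
  have hM : IsManifold (𝓡 n) 1 X := IsManifold.of_le (n := ∞) (by simp)
  obtain ⟨T, hT⟩ := exists_chart_estimate n e he hy hε
  obtain ⟨U, hU, hUo, hyU⟩ := eventually_nhds_iff.1 hT
  let h₀ := (e.restrOpen U hUo).transHomeomorph T.toHomeomorph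
  have hs₀ : h₀.source = e.source ∩ U := rfl
  have hy₀ : y ∈ h₀.source := ⟨hy, hyU⟩
  obtain ⟨r, hr, hball⟩ := Metric.isOpen_iff.1 h₀.open_target (h₀ y) (h₀.map_source hy₀)
  -- The restriction is made on the target side, so that the image of the chart is a ball and
  -- therefore convex.
  let h := (h₀.symm.restrOpen (ball (h₀ y) r) isOpen_ball).symm
  have htarget : h.target = ball (h₀ y) r := Set.inter_eq_right.2 hball
  have happ : ∀ x, h x = T (e x) := fun x => rfl
  have hsource : h.source ⊆ e.source ∩ U := fun x hx => by
    have : h.symm (h x) ∈ h₀.source := h₀.map_target (hball (htarget ▸ h.map_source hx))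
    rwa [h.left_inv hx] at this
  have hmem : h ∈ IsManifold.maximalAtlas (𝓡 n) 1 X := by
    rw [IsManifold.mem_maximalAtlas_iff_contMDiffOn]
    constructor
    · have h1 : ContMDiff (𝓡 n) (𝓡 n) 1 T := T.contDiff.contMDiff
      exact h1.comp_contMDiffOn
        ((contMDiffOn_of_mem_maximalAtlas he).mono fun x hx => (hsource hx).1)
    · have h1 : ContMDiff (𝓡 n) (𝓡 n) 1 T.symm := T.symm.contDiff.contMDiff
      refine (contMDiffOn_symm_of_mem_maximalAtlas he).comp h1.contMDiffOn fun p hp => ?_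
      have hp' : p ∈ h₀.target := hball (htarget ▸ hp)
      exact hp'.1
  have hder : ∀ x ∈ h.source, ∀ w, dchart n h x w = T (dchart n e x w) := by
    intro x hx w
    have h1 : MDifferentiableAt (𝓡 n) (𝓡 n) e x :=
      mdifferentiableAt_of_mem_maximalAtlas he (hsource hx).1
    have h2 : MDifferentiableAt (𝓡 n) (𝓡 n) T (e x) :=
      T.differentiableAt.mdifferentiableAt
    have h3 := mfderiv_comp x h2 h1
    have h4 := congrArg (fun f => f w) h3
    rw [mfderiv_eq_fderiv, T.fderiv] at h4
    exact h4
  refine ⟨T, h, ?_, fun x hx => (hsource hx).1, happ, htarget ▸ convex_ball _ _, hmem, ?_, ?_⟩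
  · exact ⟨hy₀, mem_ball_self hr⟩
  · intro x hx w
    rw [hder x hx]
    exact (hU x (hsource hx).2 w).1
  · intro x hx w
    rw [hder x hx]
    exact (hU x (hsource hx).2 w).2

end Charts

/-! ### Riemannian distance compared with chart distance. -/

section Distances

variable {n : ℕ} {X : Type u} [EMetricSpace X] [ChartedSpace (EuclideanSpace ℝ (Fin n)) X]
  [Bundle.RiemannianBundle (fun x : X => TangentSpace (𝓡 n) x)]
  [IsManifold (𝓡 n) ∞ X]
  [IsContMDiffRiemannianBundle (𝓡 n) ∞ (EuclideanSpace ℝ (Fin n))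
      (fun x : X => TangentSpace (𝓡 n) x)]
  [IsRiemannianManifold (𝓡 n) X]

theorem edist_eq_riemannianEDist (x z : X) :
    edist x z = Manifold.riemannianEDist (𝓡 n) x z :=
  IsRiemannianManifold.out x z

/-- A path that is `C¹` on `[0,1]`, with speed at most `L`, is Lipschitz and has length at most
`L`. -/
theorem exists_lipschitz_of_speed_le {γ : ℝ → X} (hγ : ContMDiffOn 𝓘(ℝ) (𝓡 n) 1 γ (Set.Icc 0 1))
    {L : ℝ≥0} (hL : ∀ t ∈ Set.Ioo (0 : ℝ) 1, ‖mfderiv 𝓘(ℝ) (𝓡 n) γ t 1‖ₑ ≤ L) :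
    ∃ s : C(I, X), (∀ t : I, s t = γ t) ∧ LipschitzWith L s ∧ pathLength n s ≤ L := by
  have key : ∀ a b : ℝ, 0 ≤ a → b ≤ 1 →
      Manifold.pathELength (𝓡 n) γ a b ≤ L * ENNReal.ofReal (b - a) := by
    intro a b ha hb
    rw [Manifold.pathELength_eq_lintegral_mfderiv_Ioo]
    refine (setLIntegral_mono' measurableSet_Ioo fun t ht => hL t
      ⟨ha.trans_lt ht.1, ht.2.trans_le hb⟩).trans_eq ?_
    rw [setLIntegral_const, Real.volume_Ioo]
  have hlip : ∀ a b : ℝ, 0 ≤ a → a ≤ b → b ≤ 1 → edist (γ a) (γ b) ≤ L * edist a b := by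
    intro a b ha hab hb
    rw [edist_eq_riemannianEDist (n := n), edist_comm, edist_dist, Real.dist_eq,
      abs_of_nonneg (sub_nonneg.2 hab)]
    exact (Manifold.riemannianEDist_le_pathELength (hγ.mono (Set.Icc_subset_Icc ha hb)) rfl rfl
      hab).trans (key a b ha hb)
  have hs : LipschitzWith L fun t : I => γ t := by
    intro a b
    rcases le_total a b with h | h
    · exact hlip a b a.2.1 h b.2.2
    · rw [edist_comm, edist_comm a]
      exact hlip b a b.2.1 h a.2.2
  refine ⟨⟨fun t => γ t, hs.continuous⟩, fun _ => rfl, hs, ?_⟩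
  rw [pathLength, Manifold.pathELength_congr (γ' := γ)]
  · simpa using key 0 1 le_rfl le_rfl
  · intro t ht
    rw [Set.IccExtend_of_mem _ _ ht]
    rfl

/-- In an almost isometric chart with convex image, segments give short paths. -/
theorem IsAlmostIsometricChart.exists_path {ε : ℝ}
    {h : OpenPartialHomeomorph X (EuclideanSpace ℝ (Fin n))}
    (hh : IsAlmostIsometricChart n ε h) (hc : Convex ℝ h.target) {x z : X} (hx : x ∈ h.source)
    (hz : z ∈ h.source) :
    ∃ s : C(I, X), s 0 = x ∧ s 1 = z ∧ (∀ t, s t ∈ h.source) ∧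
      LipschitzWith (Real.toNNReal ((1 + ε) * ‖h x - h z‖)) s ∧
      pathLength n s ≤ ENNReal.ofReal ((1 + ε) * ‖h x - h z‖) := by
  have hM : IsManifold (𝓡 n) 1 X := IsManifold.of_le (n := ∞) (by simp)
  let F := EuclideanSpace ℝ (Fin n)
  let η : ℝ → F := fun t => AffineMap.lineMap (h x) (h z) t
  have hη : ∀ t, HasDerivAt η (h z - h x) t := fun t => AffineMap.hasDerivAt_lineMap
  have hηs : ContDiff ℝ 1 η := by
    simp only [η, AffineMap.lineMap_apply_module]
    fun_prop
  have hmaps : Set.MapsTo η (Set.Icc 0 1) h.target := fun t ht =>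
    hc.lineMap_mem (h.map_source hx) (h.map_source hz) ht
  have hγ : ContMDiffOn 𝓘(ℝ) (𝓡 n) 1 (h.symm ∘ η) (Set.Icc 0 1) :=
    (contMDiffOn_symm_of_mem_maximalAtlas hh.mem_maximalAtlas).comp hηs.contMDiff.contMDiffOn hmaps
  obtain ⟨s, hs, hK, hlen⟩ := exists_lipschitz_of_speed_le hγ
    (L := Real.toNNReal ((1 + ε) * ‖h x - h z‖)) (by
    intro t ht
    have ht' := Set.Ioo_subset_Icc_self ht
    have hd1 : MDifferentiableAt 𝓘(ℝ) (𝓡 n) (h.symm ∘ η) t :=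
      (hγ.mdifferentiableOn one_ne_zero t ht').mdifferentiableAt (Icc_mem_nhds ht.1 ht.2)
    have hsrc : (h.symm ∘ η) t ∈ h.source := h.map_target (hmaps ht')
    have hd2 : MDifferentiableAt (𝓡 n) (𝓡 n) h ((h.symm ∘ η) t) :=
      mdifferentiableAt_of_mem_maximalAtlas hh.mem_maximalAtlas hsrc
    have hcomp := mfderiv_comp t hd2 hd1
    have heq : h ∘ (h.symm ∘ η) =ᶠ[𝓝 t] η := by
      filter_upwards [Icc_mem_nhds ht.1 ht.2] with u hu
      exact h.right_inv (hmaps hu)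
    rw [heq.mfderiv_eq, mfderiv_eq_fderiv] at hcomp
    have hval : dchart n h _ (mfderiv 𝓘(ℝ) (𝓡 n) (h.symm ∘ η) t 1) = h z - h x := by
      refine (congrArg (fun f => f (1 : ℝ)) hcomp).symm.trans ?_
      exact (hη t).deriv
    have hle := hh.le_norm _ hsrc (mfderiv 𝓘(ℝ) (𝓡 n) (h.symm ∘ η) t 1)
    rw [hval, norm_sub_rev] at hle
    rw [← ofReal_norm]
    exact ENNReal.ofReal_le_ofReal hle)
  refine ⟨s, (hs 0).trans ?_, (hs 1).trans ?_, fun t => ?_, hK, hlen⟩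
  · simp [η, h.left_inv hx]
  · simp [η, h.left_inv hz]
  · rw [hs t]
    exact h.map_target (hmaps t.2)

theorem IsAlmostIsometricChart.edist_le {ε : ℝ} (hε : 0 ≤ ε)
    {h : OpenPartialHomeomorph X (EuclideanSpace ℝ (Fin n))}
    (hh : IsAlmostIsometricChart n ε h) (hc : Convex ℝ h.target) {x z : X} (hx : x ∈ h.source)
    (hz : z ∈ h.source) : edist x z ≤ ENNReal.ofReal (1 + ε) * edist (h x) (h z) := by
  obtain ⟨s, rfl, rfl, -, hK, -⟩ := hh.exists_path hc hx hz
  refine (hK 0 1).trans ?_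
  have : edist (0 : I) 1 = 1 := by
    rw [edist_dist, Subtype.dist_eq]
    simp
  rw [this, mul_one, edist_eq_enorm_sub, ← ofReal_norm, ← ENNReal.ofReal_mul (by linarith)]
  rfl

/-- An almost isometric chart does not increase small distances by more than the factor. -/
theorem IsAlmostIsometricChart.eventually_edist_le {ε : ℝ} (hε : 0 ≤ ε)
    {h : OpenPartialHomeomorph X (EuclideanSpace ℝ (Fin n))}
    (hh : IsAlmostIsometricChart n ε h) {y : X} (hy : y ∈ h.source) :
    ∃ ρ > 0, eball y ρ ⊆ h.source ∧ ∀ x ∈ eball y ρ, ∀ z ∈ eball y ρ,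
      edist (h x) (h z) ≤ ENNReal.ofReal (1 + ε) * edist x z := by
  have hM : IsManifold (𝓡 n) 1 X := IsManifold.of_le (n := ∞) (by simp)
  obtain ⟨R, hR, hsub⟩ := EMetric.isOpen_iff.1 h.open_source y hy
  -- A path of length less than `ρ + ρ` that starts within `ρ` of `y` then stays in the ball of
  -- radius `R`, where the chart is defined.
  obtain ⟨ρ, hρ, hρR⟩ : ∃ ρ : ℝ≥0∞, 0 < ρ ∧ ρ + (ρ + ρ) ≤ R := by
    refine ⟨R / 3, ENNReal.div_pos hR.ne' (by simp), ?_⟩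
    rw [← add_assoc, ENNReal.add_thirds]
  refine ⟨ρ, hρ, fun x hx => hsub (lt_of_lt_of_le hx (le_self_add.trans hρR)), ?_⟩
  intro x hx z hz
  have hxz : edist x z < ρ + ρ := (edist_triangle_right x z y).trans_lt (ENNReal.add_lt_add hx hz)
  refine le_of_forall_gt_imp_ge_of_dense fun B hB => ?_
  have hpos : ENNReal.ofReal (1 + ε) ≠ 0 := by
    rw [Ne, ENNReal.ofReal_eq_zero]
    linarith
  -- The first bound keeps a nearly minimizing path in the chart domain; the second makes it short
  -- enough for the estimate.
  have hlt : edist x z < min (ρ + ρ) (B / ENNReal.ofReal (1 + ε)) := by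
    refine lt_min hxz ?_
    rwa [ENNReal.lt_div_iff_mul_lt (.inl hpos) (.inl ENNReal.ofReal_ne_top), mul_comm]
  rw [edist_eq_riemannianEDist (n := n)] at hlt
  obtain ⟨γ, h0, h1, hγ, hlen⟩ := Manifold.exists_lt_of_riemannianEDist_lt hlt
  have hin : ∀ t ∈ Set.Icc (0 : ℝ) 1, γ t ∈ h.source := by
    intro t ht
    have h2 : edist x (γ t) < ρ + ρ := by
      rw [edist_eq_riemannianEDist (n := n)]
      refine (Manifold.riemannianEDist_le_pathELength (hγ.mono (Set.Icc_subset_Icc le_rfl ht.2))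
        h0 rfl ht.1).trans_lt ?_
      exact (Manifold.pathELength_mono le_rfl ht.2).trans_lt (hlen.trans_le (min_le_left _ _))
    apply hsub
    rw [mem_eball]
    calc edist (γ t) y ≤ edist x (γ t) + edist x y := edist_triangle_left _ _ _
      _ < (ρ + ρ) + ρ := ENNReal.add_lt_add h2 hx
      _ ≤ R := by rwa [add_comm]
  have hhγ : ContDiffOn ℝ 1 (h ∘ γ) (Set.Icc 0 1) := by
    rw [← contMDiffOn_iff_contDiffOn]
    exact (contMDiffOn_of_mem_maximalAtlas hh.mem_maximalAtlas).comp hγ hin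
  have hint := enorm_sub_le_lintegral_derivWithin_Icc_of_contDiffOn_Icc hhγ zero_le_one
  rw [edist_comm, edist_eq_enorm_sub, ← h0, ← h1]
  refine hint.trans ?_
  have hstep : ∫⁻ t in Set.Icc (0 : ℝ) 1, ‖derivWithin (h ∘ γ) (Set.Icc 0 1) t‖ₑ ≤
      ENNReal.ofReal (1 + ε) * Manifold.pathELength (𝓡 n) γ 0 1 := by
    rw [Manifold.pathELength_eq_lintegral_mfderivWithin_Icc,
      ← lintegral_const_mul' _ _ ENNReal.ofReal_ne_top]
    refine setLIntegral_mono' measurableSet_Icc fun t ht => ?_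
    have hu : UniqueMDiffWithinAt 𝓘(ℝ) (Set.Icc (0 : ℝ) 1) t := by
      rw [uniqueMDiffWithinAt_iff_uniqueDiffWithinAt]
      exact uniqueDiffOn_Icc zero_lt_one _ ht
    have hcomp := mfderiv_comp_mfderivWithin t
      (mdifferentiableAt_of_mem_maximalAtlas hh.mem_maximalAtlas (hin t ht))
      (hγ.mdifferentiableOn one_ne_zero t ht) hu
    rw [mfderivWithin_eq_fderivWithin] at hcomp
    have hval : derivWithin (h ∘ γ) (Set.Icc 0 1) t =
        dchart n h (γ t) (mfderivWithin 𝓘(ℝ) (𝓡 n) γ (Set.Icc 0 1) t 1) := by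
      rw [← fderivWithin_derivWithin]
      exact congrArg (fun f => f (1 : ℝ)) hcomp
    rw [hval, ← ofReal_norm, ← ofReal_norm, ← ENNReal.ofReal_mul (by linarith)]
    exact ENNReal.ofReal_le_ofReal (hh.norm_le _ (hin t ht) _)
  refine hstep.trans ?_
  calc _ ≤ ENNReal.ofReal (1 + ε) * (B / ENNReal.ofReal (1 + ε)) := by
        gcongr
        exact (hlen.trans_le (min_le_right _ _)).le
    _ = B := ENNReal.mul_div_cancel hpos ENNReal.ofReal_ne_top

end Distances

end AreaMap

namespace AreaMap

open Filter Topology Metric MeasureTheory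

/-! ### Lipschitz paths: almost everywhere differentiability and length. -/

section PathLength

variable {n : ℕ} {X : Type u} [EMetricSpace X] [ChartedSpace (EuclideanSpace ℝ (Fin n)) X]
  [Bundle.RiemannianBundle (fun x : X => TangentSpace (𝓡 n) x)]
  [IsManifold (𝓡 n) ∞ X]
  [IsContMDiffRiemannianBundle (𝓡 n) ∞ (EuclideanSpace ℝ (Fin n))
      (fun x : X => TangentSpace (𝓡 n) x)]
  [IsRiemannianManifold (𝓡 n) X]

variable (n) in
theorem exists_almostIsometricChart_at (x : X) {ε : ℝ} (hε : 0 < ε) :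
    ∃ h : OpenPartialHomeomorph X (EuclideanSpace ℝ (Fin n)), x ∈ h.source ∧
      Convex ℝ h.target ∧ IsAlmostIsometricChart n ε h := by
  have hM : IsManifold (𝓡 n) 1 X := IsManifold.of_le (n := ∞) (by simp)
  obtain ⟨-, h, hx, -, -, hc, hh⟩ := exists_almostIsometricChart n (chartAt _ x)
    (IsManifold.chart_mem_maximalAtlas x) (mem_chart_source _ x) hε
  exact ⟨h, hx, hc, hh⟩

/-- A locally Lipschitz path in a Riemannian manifold is differentiable almost everywhere. -/
theorem ae_mdifferentiableAt_of_lipschitzOnWith {γ : ℝ → X} {K : ℝ≥0}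
    (hγ : LipschitzOnWith K γ (Set.Icc 0 1)) :
    ∀ᵐ t ∂(volume.restrict (Set.Ioo (0 : ℝ) 1)), MDifferentiableAt 𝓘(ℝ) (𝓡 n) γ t := by
  have hM : IsManifold (𝓡 n) 1 X := IsManifold.of_le (n := ∞) (by simp)
  rw [ae_restrict_iff' measurableSet_Ioo, ae_iff]
  -- Locally the path lies in one chart, where Rademacher's theorem applies to its coordinate
  -- expression.
  apply measure_null_of_locally_null
  intro t ht
  have ht' : t ∈ Set.Ioo (0 : ℝ) 1 := by
    by_contra h
    exact ht fun h' => absurd h' h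
  obtain ⟨h, hx, -, hh⟩ := exists_almostIsometricChart_at n (γ t) one_pos
  obtain ⟨ρ, hρ, hsub, hdist⟩ := hh.eventually_edist_le zero_le_one hx
  have hcont : ContinuousAt γ t := hγ.continuousOn.continuousAt (Icc_mem_nhds ht'.1 ht'.2)
  have hmem : {u | u ∈ Set.Ioo (0 : ℝ) 1 ∧ γ u ∈ eball (γ t) ρ} ∈ 𝓝 t :=
    inter_mem (Ioo_mem_nhds ht'.1 ht'.2) (hcont.eventually (eball_mem_nhds _ hρ))
  obtain ⟨U, hU, hUo, htU⟩ := _root_.mem_nhds_iff.1 hmem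
  refine ⟨{u | ¬(u ∈ Set.Ioo (0 : ℝ) 1 → MDifferentiableAt 𝓘(ℝ) (𝓡 n) γ u)} ∩ U,
    inter_mem_nhdsWithin _ (hUo.mem_nhds htU), ?_⟩
  have hlip : LipschitzOnWith (Real.toNNReal (1 + 1) * K) (h ∘ γ) U := by
    intro a ha b hb
    refine (hdist _ (hU ha).2 _ (hU hb).2).trans ?_
    rw [ENNReal.coe_mul, mul_assoc]
    exact mul_le_mul_right (hγ (Set.Ioo_subset_Icc_self (hU ha).1)
      (Set.Ioo_subset_Icc_self (hU hb).1)) _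
  have hae := hlip.ae_differentiableWithinAt_of_mem (μ := volume)
  rw [ae_iff] at hae
  refine measure_mono_null ?_ hae
  rintro u ⟨hu, huU⟩ hd
  apply hu
  intro hu'
  have hd' : MDifferentiableAt 𝓘(ℝ) (𝓡 n) (h ∘ γ) u :=
    ((hd huU).differentiableAt (hUo.mem_nhds huU)).mdifferentiableAt
  have hsymm : MDifferentiableAt (𝓡 n) (𝓡 n) h.symm ((h ∘ γ) u) :=
    mdifferentiableAt_symm_of_mem_maximalAtlas hh.mem_maximalAtlas
      (h.map_source (hsub (hU huU).2))
  refine (hsymm.comp u hd').congr_of_eventuallyEq ?_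
  filter_upwards [hUo.mem_nhds huU] with v hv
  exact (h.left_inv (hsub (hU hv).2)).symm

/-- A function along a Lipschitz path that varies at most `K` times as fast as the point on the
path varies by at most `4 K` times the length of the path. -/
theorem edist_le_mul_pathLength {s : C(I, X)} {K₀ : ℝ≥0} (hs : LipschitzWith K₀ s) {K : ℝ≥0}
    {g : ℝ → ℝ} (hg : ∀ t ∈ Set.Icc (0 : ℝ) 1, ∃ u ∈ 𝓝[Set.Icc 0 1] t, ∀ a ∈ u, ∀ b ∈ u,
      edist (g a) (g b) ≤ K * edist (Set.IccExtend zero_le_one s a)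
        (Set.IccExtend zero_le_one s b)) :
    edist (g 0) (g 1) ≤ 4 * K * pathLength n s := by
  have hM : IsManifold (𝓡 n) 1 X := IsManifold.of_le (n := ∞) (by simp)
  set γ : ℝ → X := Set.IccExtend zero_le_one s with hγ
  have hγlip : LipschitzWith K₀ γ := by
    have h1 : LipschitzWith 1 (Set.projIcc (0 : ℝ) 1 zero_le_one) := LipschitzWith.projIcc _
    have h2 := hs.comp h1
    rwa [mul_one] at h2
  have hloc : LocallyLipschitzOn (Set.Icc (0 : ℝ) 1) g := by
    intro t ht
    obtain ⟨u, hu, hgu⟩ := hg t ht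
    refine ⟨K * K₀, u, hu, fun a ha b hb => (hgu a ha b hb).trans ?_⟩
    rw [ENNReal.coe_mul, mul_assoc]
    exact mul_le_mul_right (hγlip a b) _
  obtain ⟨C, hC⟩ := hloc.exists_lipschitzOnWith_of_compact isCompact_Icc
  rw [← Set.uIcc_of_le zero_le_one] at hC
  have hftc := hC.absolutelyContinuousOnInterval.integral_deriv_eq_sub
  -- The factor 4 is `2 * 2`: a chart of distortion `1 + 1` is used once to compare distances with
  -- chart differences and once to compare the chart speed with the Riemannian speed.
  have hbound : ∀ᵐ t ∂(volume.restrict (Set.Ioo (0 : ℝ) 1)),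
      ‖deriv g t‖ₑ ≤ 4 * K * ‖mfderiv 𝓘(ℝ) (𝓡 n) γ t 1‖ₑ := by
    filter_upwards [ae_mdifferentiableAt_of_lipschitzOnWith (n := n)
      (hγlip.lipschitzOnWith (s := Set.Icc 0 1)), self_mem_ae_restrict measurableSet_Ioo] with t ht ht'
    by_cases hd : DifferentiableAt ℝ g t
    swap
    · simp [deriv_zero_of_not_differentiableAt hd]
    obtain ⟨h, hx, hc, hh⟩ := exists_almostIsometricChart_at n (γ t) one_pos
    have hd1 : MDifferentiableAt (𝓡 n) (𝓡 n) h (γ t) :=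
      mdifferentiableAt_of_mem_maximalAtlas hh.mem_maximalAtlas hx
    have hcomp := mfderiv_comp t hd1 ht
    have hd2 : DifferentiableAt ℝ (h ∘ γ) t := (hd1.comp t ht).differentiableAt
    rw [mfderiv_eq_fderiv] at hcomp
    have hval : deriv (h ∘ γ) t = dchart n h (γ t) (mfderiv 𝓘(ℝ) (𝓡 n) γ t 1) := by
      rw [← fderiv_apply_one_eq_deriv]
      exact congrArg (fun f => f (1 : ℝ)) hcomp
    have hle1 : ‖deriv (h ∘ γ) t‖ ≤ (1 + 1) * ‖mfderiv 𝓘(ℝ) (𝓡 n) γ t 1‖ := by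
      rw [hval]
      exact hh.norm_le _ hx _
    -- The inequality holds for difference quotients near `t` and passes to the limit.
    have hle2 : ‖deriv g t‖ ≤ K * 2 * ‖deriv (h ∘ γ) t‖ := by
      have h1 := (hasDerivAt_iff_tendsto_slope.1 hd.hasDerivAt).norm
      have h2 := ((hasDerivAt_iff_tendsto_slope.1 hd2.hasDerivAt).norm).const_mul ((K : ℝ) * 2)
      refine le_of_tendsto_of_tendsto h1 h2 ?_
      obtain ⟨u, hu, hgu⟩ := hg t (Set.Ioo_subset_Icc_self ht')
      rw [nhdsWithin_eq_nhds.2 (Icc_mem_nhds ht'.1 ht'.2)] at hu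
      have hsrc : ∀ᶠ a in 𝓝 t, γ a ∈ h.source :=
        hγlip.continuous.continuousAt.eventually (h.open_source.mem_nhds hx)
      refine Filter.Eventually.filter_mono nhdsWithin_le_nhds ?_
      filter_upwards [hu, hsrc] with a ha ha'
      have h3 : edist (g a) (g t) ≤ K * (ENNReal.ofReal (1 + 1) * edist (h (γ a)) (h (γ t))) :=
        (hgu a ha t (mem_of_mem_nhds hu)).trans
          (mul_le_mul_right (hh.edist_le zero_le_one hc ha' hx) _)
      have h4 : ‖g a - g t‖ ≤ K * 2 * ‖h (γ a) - h (γ t)‖ := by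
        rw [edist_dist, edist_dist, ← ENNReal.ofReal_mul (by norm_num), ← ENNReal.ofReal_coe_nnreal,
          ← ENNReal.ofReal_mul (by positivity), ENNReal.ofReal_le_ofReal_iff (by positivity),
          dist_eq_norm, dist_eq_norm] at h3
        linarith
      rw [slope_def_module, slope_def_module, norm_smul, norm_smul]
      have := mul_le_mul_of_nonneg_left h4 (norm_nonneg (a - t)⁻¹)
      simp only [Function.comp_apply]
      linarith
    rw [← ofReal_norm, ← ofReal_norm]
    have h4K : (4 * K : ℝ≥0∞) = ENNReal.ofReal (4 * K) := by
      rw [ENNReal.ofReal_mul (by norm_num)]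
      simp
    rw [h4K, ← ENNReal.ofReal_mul (by positivity)]
    apply ENNReal.ofReal_le_ofReal
    calc ‖deriv g t‖ ≤ K * 2 * ((1 + 1) * ‖mfderiv 𝓘(ℝ) (𝓡 n) γ t 1‖) :=
          hle2.trans (mul_le_mul_of_nonneg_left hle1 (by positivity))
      _ = _ := by ring
  rw [edist_comm, edist_eq_enorm_sub, ← hftc, intervalIntegral.integral_of_le zero_le_one]
  refine (enorm_integral_le_lintegral_enorm _).trans ?_
  rw [restrict_Ioc_eq_restrict_Icc, ← restrict_Ioo_eq_restrict_Icc, pathLength,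
    Manifold.pathELength_eq_lintegral_mfderiv_Ioo,
    ← lintegral_const_mul' _ _ (by finiteness)]
  exact lintegral_mono_ae hbound

end PathLength

end AreaMap

namespace AreaMap

open Filter Topology Metric

/-! ### A Lipschitz map in the homotopy class. -/

section LipschitzApprox

variable {V : Type u} [NormedAddCommGroup V] [NormedSpace ℝ V] (Γ : Submodule ℤ V)
  [DiscreteTopology Γ]

/-- This gap turns an equality in the torus between classes of short vectors into an equality in
`V`. -/
theorem exists_pos_forall_mem_lattice : ∃ η : ℝ, 0 < η ∧ ∀ γ ∈ Γ, ‖γ‖ < η → γ = 0 := by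
  have h : ({0} : Set Γ) ∈ 𝓝 (0 : Γ) := by simp [nhds_discrete]
  obtain ⟨η, hη, hball⟩ := Metric.mem_nhds_iff.1 h
  refine ⟨η, hη, fun γ hγ hn => ?_⟩
  have h1 : (⟨γ, hγ⟩ : Γ) ∈ ball (0 : Γ) η := by
    rw [mem_ball_zero_iff]
    exact hn
  exact congrArg Subtype.val (hball h1)

variable {X : Type u} [EMetricSpace X]

/-- The map `ψ` to the torus is Lipschitz at small scales. -/
def IsTorusLipschitz (ψ : C(X, V ⧸ Γ)) (K : ℝ≥0) (δ : ℝ≥0∞) : Prop :=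
  ∀ x z, edist x z < δ → ∃ w : V, torusMk Γ w = ψ z - ψ x ∧ ‖w‖ₑ ≤ K * edist x z

/-- Used for the bump functions `r - edist x j`: truncated subtraction is 1-Lipschitz, and
finiteness of `r` and `d` lets this survive `toReal`. -/
theorem abs_toReal_tsub_sub_le {r a b d : ℝ≥0∞} (hr : r ≠ ⊤) (hd : d ≠ ⊤) (h1 : a ≤ b + d)
    (h2 : b ≤ a + d) : |(r - a).toReal - (r - b).toReal| ≤ d.toReal := by
  have key : ∀ {a b : ℝ≥0∞}, b ≤ a + d → (r - a).toReal ≤ (r - b).toReal + d.toReal := by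
    intro a b h
    have hb : r - b ≠ ⊤ := ne_top_of_le_ne_top hr tsub_le_self
    rw [← ENNReal.toReal_add hb hd]
    refine ENNReal.toReal_mono (ENNReal.add_ne_top.2 ⟨hb, hd⟩) ?_
    rw [tsub_le_iff_right]
    calc r ≤ (r - b) + b := le_tsub_add
      _ ≤ (r - b) + (a + d) := by gcongr
      _ = _ := by ring
  rw [abs_sub_le_iff]
  constructor
  · linarith [key h2]
  · linarith [key h1]

/-- A compact extended metric space has finite Lipschitz partitions of unity of small mesh. -/
theorem exists_lipschitz_partition [CompactSpace X] {r : ℝ≥0∞} (hr : 0 < r) :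
    ∃ (t : Finset X) (ρ : X → X → ℝ) (C : ℝ), 0 ≤ C ∧ (∀ x, ∑ j ∈ t, ρ j x = 1) ∧
      (∀ j x, ρ j x ≠ 0 → edist x j < r) ∧
      ∀ x z, edist x z ≠ ⊤ → ∀ j ∈ t, |ρ j x - ρ j z| ≤ C * (edist x z).toReal := by
  -- A finite radius is needed for the bump functions to be real-valued.
  set r' : ℝ≥0∞ := min r 1 with hr'
  have hr'0 : 0 < r' := lt_min hr one_pos
  have hr't : r' ≠ ⊤ := ne_top_of_le_ne_top ENNReal.one_ne_top (min_le_right _ _)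
  have hhalf : 0 < r' / 2 := ENNReal.half_pos hr'0.ne'
  obtain ⟨t, -, ht⟩ := (isCompact_univ (X := X)).elim_nhds_subcover (fun x => eball x (r' / 2))
    fun x _ => eball_mem_nhds x hhalf
  let v : X → X → ℝ := fun j x => (r' - edist x j).toReal
  let S : X → ℝ := fun x => ∑ j ∈ t, v j x
  set c : ℝ := (r' / 2).toReal with hc
  have hc0 : 0 < c := ENNReal.toReal_pos hhalf.ne' (ENNReal.div_ne_top hr't (by simp))
  have hv0 : ∀ j x, 0 ≤ v j x := fun j x => ENNReal.toReal_nonneg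
  have hS : ∀ x, c ≤ S x := by
    intro x
    obtain ⟨j, hj, hxj⟩ := Set.mem_iUnion₂.1 (ht (Set.mem_univ x))
    refine le_trans ?_ (Finset.single_le_sum (f := fun j => v j x) (fun j _ => hv0 j x) hj)
    refine ENNReal.toReal_mono (ne_top_of_le_ne_top hr't tsub_le_self) ?_
    refine ENNReal.le_sub_of_add_le_right (ne_top_of_lt hxj) ?_
    calc r' / 2 + edist x j ≤ r' / 2 + r' / 2 := by
          gcongr
          exact le_of_lt hxj
      _ = r' := ENNReal.add_halves r'
  have hS0 : ∀ x, 0 < S x := fun x => hc0.trans_le (hS x)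
  have hvL : ∀ j x z, edist x z ≠ ⊤ → |v j x - v j z| ≤ (edist x z).toReal := by
    intro j x z hxz
    refine abs_toReal_tsub_sub_le hr't hxz ?_ ?_
    · rw [add_comm]
      exact edist_triangle _ _ _
    · rw [add_comm, edist_comm x z]
      exact edist_triangle _ _ _
  have hSL : ∀ x z, edist x z ≠ ⊤ → |S x - S z| ≤ t.card * (edist x z).toReal := by
    intro x z hxz
    rw [← Finset.sum_sub_distrib]
    refine (Finset.abs_sum_le_sum_abs _ _).trans ?_
    refine (Finset.sum_le_sum fun j _ => hvL j x z hxz).trans_eq ?_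
    simp
  refine ⟨t, fun j x => v j x / S x, (1 + t.card) / c, by positivity, ?_, ?_, ?_⟩
  · intro x
    rw [← Finset.sum_div, div_self (hS0 x).ne']
  · intro j x h
    have h1 : v j x ≠ 0 := fun h0 => h (by simp [h0])
    have h2 : r' - edist x j ≠ 0 := fun h0 => h1 (by simp [v, h0])
    exact (tsub_pos_iff_lt.1 (pos_iff_ne_zero.2 h2)).trans_le (min_le_left _ _)
  · intro x z hxz j hj
    set D := (edist x z).toReal
    have hD : 0 ≤ D := ENNReal.toReal_nonneg
    have hle : v j z ≤ S z := Finset.single_le_sum (f := fun j => v j z) (fun j _ => hv0 j z) hj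
    have e : v j x / S x - v j z / S z =
        ((v j x - v j z) + (v j z / S z) * (S z - S x)) / S x := by
      have h1 := (hS0 x).ne'
      have h2 := (hS0 z).ne'
      field_simp
      ring
    have h3 : |(v j x - v j z) + (v j z / S z) * (S z - S x)| ≤ (1 + t.card) * D := by
      refine (abs_add_le _ _).trans ?_
      have h4 : |(v j z / S z) * (S z - S x)| ≤ 1 * (t.card * D) := by
        rw [abs_mul, abs_of_nonneg (div_nonneg (hv0 j z) (hS0 z).le), abs_sub_comm]
        exact mul_le_mul ((div_le_one (hS0 z)).2 hle) (hSL x z hxz) (abs_nonneg _) zero_le_one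
      linarith [hvL j x z hxz]
    rw [e, abs_div, abs_of_pos (hS0 x), div_le_iff₀ (hS0 x)]
    calc _ ≤ (1 + t.card) * D := h3
      _ = (1 + t.card) / c * D * c := by field_simp
      _ ≤ _ := mul_le_mul_of_nonneg_left (hS x) (by positivity)

variable [CompactSpace X]

/-- A continuous map from a compact space to a torus has a Lipschitz map in its homotopy class, in
the form of a translation by a continuous vector-valued map. -/
theorem exists_isTorusLipschitz (φ : C(X, V ⧸ Γ)) :
    ∃ (G : C(X, V)) (K : ℝ≥0) (δ : ℝ≥0∞), 0 < δ ∧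
      IsTorusLipschitz Γ (φ + (torusMk Γ).comp G) K δ := by
  obtain ⟨η, hη, hΓ⟩ := exists_pos_forall_mem_lattice Γ
  have huniq : ∀ {w w' : V}, torusMk Γ w = torusMk Γ w' → ‖w‖ + ‖w'‖ < η → w = w' := by
    intro w w' h h'
    have := hΓ (w - w') ((torusMk_eq_iff Γ).1 h) ((norm_sub_le _ _).trans_lt h')
    exact sub_eq_zero.1 this
  have hopen : ∀ {ε : ℝ}, 0 < ε → torusMk Γ '' ball 0 ε ∈ 𝓝 (0 : V ⧸ Γ) := by
    intro ε hε
    exact (isCoveringMap_torusMk Γ).isOpenMap.image_mem_nhds (ball_mem_nhds (0 : V) hε)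
  have hnear : ∀ {ε : ℝ}, 0 < ε → ∀ y : X, ∀ᶠ x in 𝓝 y, φ x - φ y ∈ torusMk Γ '' ball 0 ε := by
    intro ε hε y
    have : ContinuousAt (fun x => φ x - φ y) y := by fun_prop
    have h0 := hopen hε
    rw [← sub_self (φ y)] at h0
    exact this.eventually h0
  -- Differences of two lifts are then at most `η / 4`, and three such vectors have total norm below
  -- the gap `η`, which makes the cocycle identity for `q` exact.
  have hη8 : 0 < η / 8 := by positivity
  obtain ⟨δ', hδ', hleb⟩ := lebesgue_number_lemma_of_emetric_nhds (isCompact_univ (X := X))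
    fun y _ => hnear hη8 y
  set δ := min δ' 1
  have hδ : 0 < δ := lt_min hδ' one_pos
  have hex : ∀ x z, edist x z < δ → ∃ w : V, torusMk Γ w = φ z - φ x ∧ ‖w‖ ≤ η / 4 := by
    intro x z hxz
    obtain ⟨y, hy⟩ := hleb x (Set.mem_univ x)
    have hlt := hxz.trans_le (min_le_left δ' 1)
    obtain ⟨a, ha, hax⟩ := hy (mem_eball_self hδ')
    obtain ⟨b, hb, hbz⟩ := hy (show z ∈ eball x δ' by rwa [mem_eball'])
    rw [mem_ball_zero_iff] at ha hb
    refine ⟨b - a, ?_, ?_⟩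
    · rw [torusMk_sub, hax, hbz, sub_sub_sub_cancel_right]
    · linarith [norm_sub_le b a]
  choose! q hq hqn using hex
  have hhalf : 0 < δ / 2 := ENNReal.half_pos hδ.ne'
  have hhalfδ : δ / 2 ≤ δ := ENNReal.half_le_self
  obtain ⟨t, ρ, C, hC, hsum, hsupp, hρ⟩ := exists_lipschitz_partition (X := X) hhalf
  -- The average of the displacements from `x` to the centres. By the cocycle identity, adding the
  -- increment of `G₀` to `q x z` leaves only the increments of the Lipschitz weights, with bounded
  -- coefficients.
  let G₀ : X → V := fun x => ∑ j ∈ t, ρ j x • q x j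
  have hlt_top : ∀ {x z : X}, edist x z < δ / 2 → edist x z ≠ ⊤ := fun h => ne_top_of_lt h
  have hcocycle : ∀ x z, edist x z < δ / 2 →
      q x z + G₀ z - G₀ x = ∑ j ∈ t, (ρ j z - ρ j x) • q x j := by
    intro x z hxz
    have h1 : q x z = ∑ j ∈ t, ρ j z • q x z := by rw [← Finset.sum_smul, hsum, one_smul]
    rw [h1, ← Finset.sum_add_distrib, ← Finset.sum_sub_distrib]
    refine Finset.sum_congr rfl fun j _ => ?_
    by_cases hz : ρ j z = 0
    · simp [hz]
    have hzj := hsupp j z hz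
    have hxj : edist x j < δ := by
      calc edist x j ≤ edist x z + edist z j := edist_triangle _ _ _
        _ < δ / 2 + δ / 2 := ENNReal.add_lt_add hxz hzj
        _ = δ := ENNReal.add_halves δ
    have h2 : q x z + q z j = q x j := by
      apply huniq
      · rw [torusMk_add, hq x z (hxz.trans_le hhalfδ), hq z j (hzj.trans_le hhalfδ), hq x j hxj]
        abel
      · have := norm_add_le (q x z) (q z j)
        have := hqn x z (hxz.trans_le hhalfδ)
        have := hqn z j (hzj.trans_le hhalfδ)
        have := hqn x j hxj
        linarith
    rw [← smul_add, h2, sub_smul]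
  set M : ℝ := t.card * (C * (η / 4))
  have hM : 0 ≤ M := by positivity
  have hbound : ∀ x z, edist x z < δ / 2 →
      ‖q x z + G₀ z - G₀ x‖ ≤ M * (edist x z).toReal := by
    intro x z hxz
    have hD : 0 ≤ (edist x z).toReal := ENNReal.toReal_nonneg
    rw [hcocycle x z hxz]
    refine (norm_sum_le _ _).trans ?_
    have hterm : ∀ j ∈ t, ‖(ρ j z - ρ j x) • q x j‖ ≤ C * (η / 4) * (edist x z).toReal := by
      intro j hj
      by_cases h : edist x j < δ
      · rw [norm_smul, Real.norm_eq_abs, abs_sub_comm]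
        calc _ ≤ (C * (edist x z).toReal) * (η / 4) :=
              mul_le_mul (hρ x z (hlt_top hxz) j hj) (hqn x j h) (norm_nonneg _) (by positivity)
          _ = _ := by ring
      · have hx0 : ρ j x = 0 := by
          by_contra h0
          exact h ((hsupp j x h0).trans_le hhalfδ)
        have hz0 : ρ j z = 0 := by
          by_contra h0
          apply h
          calc edist x j ≤ edist x z + edist z j := edist_triangle _ _ _
            _ < δ / 2 + δ / 2 := ENNReal.add_lt_add hxz (hsupp j z h0)
            _ = δ := ENNReal.add_halves δ
        rw [hx0, hz0, sub_zero, zero_smul, norm_zero]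
        positivity
    refine (Finset.sum_le_sum hterm).trans_eq ?_
    rw [Finset.sum_const, nsmul_eq_mul]
    ring
  -- The corrected increment is small by `hbound`, and `q x z` itself is small because it must equal
  -- the short lift supplied by the continuity of `φ`.
  have hG : Continuous G₀ := by
    rw [continuous_iff_continuousAt]
    intro x
    rw [ContinuousAt, Metric.tendsto_nhds]
    intro ε hε
    have hε' : 0 < min (ε / 2) (η / 2) := lt_min (by positivity) (by positivity)
    have h1 : ∀ᶠ z in 𝓝 x, edist z x < min (δ / 2) (ENNReal.ofReal (ε / (2 * (M + 1)))) :=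
      eball_mem_nhds x (lt_min hhalf (by rw [ENNReal.ofReal_pos]; positivity))
    filter_upwards [hnear hε' x, h1] with z ⟨b, hb, hbz⟩ hz
    rw [edist_comm] at hz
    have hz1 := hz.trans_le (min_le_left _ _)
    have hz2 := hz.trans_le (min_le_right _ _)
    rw [mem_ball_zero_iff] at hb
    have hqb : q x z = b := by
      apply huniq
      · rw [hq x z (hz1.trans_le hhalfδ), hbz]
      · have := hqn x z (hz1.trans_le hhalfδ)
        have := hb.trans_le (min_le_right _ _)
        linarith
    have hD : (edist x z).toReal < ε / (2 * (M + 1)) := by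
      rwa [← ENNReal.lt_ofReal_iff_toReal_lt (hlt_top hz1)]
    have h2 := hbound x z hz1
    have h3 : M * (edist x z).toReal ≤ ε / 2 := by
      have : (M + 1) * (edist x z).toReal ≤ (M + 1) * (ε / (2 * (M + 1))) :=
        mul_le_mul_of_nonneg_left hD.le (by positivity)
      have h4 : (M + 1) * (ε / (2 * (M + 1))) = ε / 2 := by field_simp
      have h5 : 0 ≤ (edist x z).toReal := ENNReal.toReal_nonneg
      linarith
    have h6 := hb.trans_le (min_le_left _ _)
    rw [dist_eq_norm]
    have h7 : G₀ z - G₀ x = (q x z + G₀ z - G₀ x) - b := by rw [hqb]; abel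
    rw [h7]
    linarith [norm_sub_le (q x z + G₀ z - G₀ x) b]
  refine ⟨⟨G₀, hG⟩, Real.toNNReal M, δ / 2, hhalf, fun x z hxz => ?_⟩
  refine ⟨q x z + G₀ z - G₀ x, ?_, ?_⟩
  · rw [torusMk_sub, torusMk_add, hq x z (hxz.trans_le hhalfδ)]
    change _ = φ z + torusMk Γ (G₀ z) - (φ x + torusMk Γ (G₀ x))
    abel
  · rw [← ofReal_norm]
    refine (ENNReal.ofReal_le_ofReal (hbound x z hxz)).trans_eq ?_
    rw [ENNReal.ofReal_mul hM, ENNReal.ofReal_toReal (hlt_top hxz)]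
    rfl

end LipschitzApprox

end AreaMap

namespace AreaMap

open Filter Topology Metric MeasureTheory

/-! ### Displacement is bounded by length. -/

section Displacement

variable {V : Type u} [NormedAddCommGroup V] [NormedSpace ℝ V] (Γ : Submodule ℤ V)
  [DiscreteTopology Γ] {X : Type u} [EMetricSpace X]

/-- Lifts of a path under a torus-Lipschitz map satisfy the same Lipschitz estimate locally. -/
theorem IsTorusLipschitz.exists_nhds_lift_le {ψ : C(X, V ⧸ Γ)} {K : ℝ≥0} {δ : ℝ≥0∞} (hδ : 0 < δ)
    (h : IsTorusLipschitz Γ ψ K δ) {T : Type*} [TopologicalSpace T] {D : Set T} {τ : T → V}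
    {s : T → X} (hτ : ContinuousOn τ D) (hs : ContinuousOn s D)
    (hlift : ∀ t ∈ D, torusMk Γ (τ t) = ψ (s t)) {t : T} (ht : t ∈ D) :
    ∃ u ∈ 𝓝[D] t, ∀ a ∈ u, ∀ b ∈ u, ‖τ b - τ a‖ₑ ≤ K * edist (s a) (s b) := by
  obtain ⟨η, hη, hΓ⟩ := exists_pos_forall_mem_lattice Γ
  -- The radius is such that the Lipschitz vector has norm at most `η / 2`; adding `1` to `K` avoids
  -- division by zero.
  obtain ⟨r, hr, hrδ, hrη⟩ : ∃ r : ℝ≥0∞, 0 < r ∧ r ≤ δ ∧ K * r ≤ ENNReal.ofReal (η / 2) := by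
    refine ⟨min δ (ENNReal.ofReal (η / 2) / (K + 1)), lt_min hδ (ENNReal.div_pos ?_ (by simp)),
      min_le_left _ _, ?_⟩
    · rw [← pos_iff_ne_zero, ENNReal.ofReal_pos]
      positivity
    · calc (K : ℝ≥0∞) * min δ (ENNReal.ofReal (η / 2) / (K + 1))
          ≤ (K + 1) * (ENNReal.ofReal (η / 2) / (K + 1)) := by
            gcongr
            · exact le_self_add
            · exact min_le_right _ _
        _ ≤ _ := ENNReal.mul_div_le
  have hhalf : 0 < r / 2 := ENNReal.half_pos hr.ne'
  refine ⟨D ∩ (s ⁻¹' eball (s t) (r / 2) ∩ τ ⁻¹' ball (τ t) (η / 4)), ?_, ?_⟩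
  · exact inter_mem self_mem_nhdsWithin (inter_mem ((hs t ht) (eball_mem_nhds _ hhalf))
      ((hτ t ht) (ball_mem_nhds _ (by positivity))))
  · rintro a ⟨haD, has, haτ⟩ b ⟨hbD, hbs, hbτ⟩
    have hab : edist (s a) (s b) < r := by
      calc edist (s a) (s b) ≤ edist (s a) (s t) + edist (s b) (s t) := edist_triangle_right _ _ _
        _ < r / 2 + r / 2 := ENNReal.add_lt_add has hbs
        _ = r := ENNReal.add_halves r
    obtain ⟨w, hw, hwn⟩ := h _ _ (hab.trans_le hrδ)
    have hw2 : ‖w‖ ≤ η / 2 := by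
      have : ‖w‖ₑ ≤ ENNReal.ofReal (η / 2) := hwn.trans (le_trans (by gcongr) hrη)
      rwa [← ofReal_norm, ENNReal.ofReal_le_ofReal_iff (by positivity)] at this
    have hd : ‖τ b - τ a‖ < η / 2 := by
      have h1 : dist (τ a) (τ t) < η / 4 := haτ
      have h2 : dist (τ b) (τ t) < η / 4 := hbτ
      rw [← dist_eq_norm]
      linarith [dist_triangle_right (τ b) (τ a) (τ t)]
    -- Both vectors lie over the same element of the torus, and their norms add up to less than the
    -- gap `η`.
    have : τ b - τ a = w := by
      rw [← sub_eq_zero]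
      refine hΓ _ ?_ ((norm_sub_le _ _).trans_lt (by linarith))
      rw [← torusMk_eq_iff, torusMk_sub, hlift a haD, hlift b hbD, hw]
    rwa [this]

/-- The displacement of a path is read off from any lift. -/
theorem disp_comp_eq_of_lift {X : Type u} [TopologicalSpace X] (ψ : C(X, V ⧸ Γ)) {D : Set X}
    {τ : X → V} (hτ : ContinuousOn τ D)
    (hlift : ∀ t ∈ D, torusMk Γ (τ t) = ψ t) {s : C(I, X)} (hs : ∀ t, s t ∈ D) :
    disp Γ (ψ.comp s) = τ (s 1) - τ (s 0) := by
  let T : C(I, V) := ⟨fun t => τ (s t), hτ.comp_continuous s.continuous hs⟩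
  have : ψ.comp s = (torusMk Γ).comp T := by
    ext t
    exact (hlift _ (hs t)).symm
  rw [this, disp_torusMk_comp]
  rfl

/-- A map to the torus lifts over the domain of a chart with convex image. -/
theorem exists_lift_chart {X : Type u} [TopologicalSpace X] (ψ : C(X, V ⧸ Γ)) {F : Type*}
    [NormedAddCommGroup F] [NormedSpace ℝ F] (h : OpenPartialHomeomorph X F)
    (hc : Convex ℝ h.target) :
    ∃ τ : X → V, ContinuousOn τ h.source ∧ ∀ z ∈ h.source, torusMk Γ (τ z) = ψ z := by
  rcases h.target.eq_empty_or_nonempty with he | hne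
  · have : h.source = ∅ := by rw [← h.symm_image_target_eq_source, he, Set.image_empty]
    exact ⟨fun _ => 0, by simp [this], by simp [this]⟩
  have := hc.contractibleSpace hne
  let f : C(h.target, V ⧸ Γ) :=
    ⟨fun a => ψ (h.symm a), ψ.continuous.comp h.continuousOn_symm.domRestrict⟩
  obtain ⟨T, hT⟩ := exists_lift_of_contractible Γ f
  classical
  refine ⟨fun z => if hz : h z ∈ h.target then T ⟨h z, hz⟩ else 0, ?_, ?_⟩
  · rw [continuousOn_iff_continuous_domRestrict]
    have : Continuous fun z : h.source => T ⟨h z, h.map_source z.2⟩ :=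
      T.continuous.comp (Continuous.subtype_mk h.continuousOn.domRestrict _)
    convert this using 2 with z
    exact dif_pos (h.map_source z.2)
  · intro z hz
    beta_reduce
    rw [dif_pos (h.map_source hz)]
    refine (congrArg (fun q : C(h.target, V ⧸ Γ) => q ⟨h z, h.map_source hz⟩) hT).trans ?_
    simp [f, h.left_inv hz]

variable {n : ℕ} [ChartedSpace (EuclideanSpace ℝ (Fin n)) X]
  [Bundle.RiemannianBundle (fun x : X => TangentSpace (𝓡 n) x)]
  [IsManifold (𝓡 n) ∞ X]
  [IsContMDiffRiemannianBundle (𝓡 n) ∞ (EuclideanSpace ℝ (Fin n))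
      (fun x : X => TangentSpace (𝓡 n) x)]
  [IsRiemannianManifold (𝓡 n) X]

/-- A norming functional reduces the estimate to a real function along the path, to which
`edist_le_mul_pathLength` applies. -/
theorem IsTorusLipschitz.enorm_disp_le {ψ : C(X, V ⧸ Γ)} {K : ℝ≥0} {δ : ℝ≥0∞} (hδ : 0 < δ)
    (h : IsTorusLipschitz Γ ψ K δ) {s : C(I, X)} {K₀ : ℝ≥0} (hs : LipschitzWith K₀ s) :
    ‖disp Γ (ψ.comp s)‖ₑ ≤ 4 * K * pathLength n s := by
  set τ := pathLift Γ (ψ.comp s)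
  obtain ⟨ℓ, hℓ, hval⟩ := exists_dual_vector'' ℝ (disp Γ (ψ.comp s))
  have key := edist_le_mul_pathLength (n := n) hs (K := K)
    (g := fun t => ℓ (Set.IccExtend zero_le_one τ t)) (by
      intro t ht
      obtain ⟨u, hu, hlip⟩ := h.exists_nhds_lift_le Γ hδ (τ := Set.IccExtend zero_le_one τ)
        (s := Set.IccExtend zero_le_one s) (D := Set.univ) (t := t)
        τ.continuous.Icc_extend'.continuousOn s.continuous.Icc_extend'.continuousOn
        (fun a _ => torusMk_pathLift Γ (ψ.comp s) _) trivial
      refine ⟨u, nhdsWithin_mono _ (Set.subset_univ _) hu, fun a ha b hb => ?_⟩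
      refine le_trans ?_ (hlip a ha b hb)
      rw [edist_comm, edist_eq_enorm_sub, ← map_sub, ← ofReal_norm, ← ofReal_norm]
      refine ENNReal.ofReal_le_ofReal ((ℓ.le_opNorm _).trans ?_)
      exact mul_le_of_le_one_left (norm_nonneg _) hℓ)
  refine le_trans (le_of_eq ?_) key
  rw [edist_comm, edist_eq_enorm_sub, Set.IccExtend_right, Set.IccExtend_left, ← map_sub]
  change _ = ‖ℓ (disp Γ (ψ.comp s))‖ₑ
  rw [hval, ← ofReal_norm, ← ofReal_norm]
  simp

end Displacement

/-! ### Mass and Lipschitz chains. -/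

section Mass

variable (n : ℕ) {X : Type u} [EMetricSpace X]
  [ChartedSpace (EuclideanSpace ℝ (Fin n)) X]
  [Bundle.RiemannianBundle (fun x : X => TangentSpace (𝓡 n) x)]

theorem mass_zero : mass n (0 : C(I, X) →₀ ℝ) = 0 := by simp [mass]

theorem mass_single (s : C(I, X)) (r : ℝ) :
    mass n (Finsupp.single s r) = ‖r‖ₑ * pathLength n s := by
  simp [mass]

theorem mass_smul (r : ℝ) (c : C(I, X) →₀ ℝ) : mass n (r • c) = ‖r‖ₑ * mass n c := by
  rw [mass, mass, Finsupp.sum_smul_index (by simp), Finsupp.sum, Finsupp.sum, Finset.mul_sum]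
  simp [enorm_mul, mul_assoc]

theorem mass_add_le (c c' : C(I, X) →₀ ℝ) : mass n (c + c') ≤ mass n c + mass n c' := by
  classical
  have h : ∀ f : C(I, X) →₀ ℝ, f.support ⊆ c.support ∪ c'.support ∪ (c + c').support →
      mass n f = ∑ s ∈ c.support ∪ c'.support ∪ (c + c').support, ‖f s‖ₑ * pathLength n s :=
    fun f hf => Finsupp.sum_of_support_subset _ hf _ (by simp)
  rw [h c (by intro; simp +contextual), h c' (by intro; simp +contextual),
    h (c + c') Finset.subset_union_right, ← Finset.sum_add_distrib]
  refine Finset.sum_le_sum fun s _ => ?_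
  rw [← add_mul]
  gcongr
  exact enorm_add_le _ _

theorem mass_sub_le (c c' : C(I, X) →₀ ℝ) : mass n (c - c') ≤ mass n c + mass n c' := by
  have : c - c' = c + (-1 : ℝ) • c' := by simp [sub_eq_add_neg]
  rw [this]
  refine (mass_add_le n _ _).trans_eq ?_
  rw [mass_smul]
  simp


theorem IsLipChain.add {c c' : C(I, X) →₀ ℝ} (h : IsLipChain c) (h' : IsLipChain c') :
    IsLipChain (c + c') := by
  classical
  intro s hs
  rcases Finset.mem_union.1 (Finsupp.support_add hs) with h1 | h1
  exacts [h s h1, h' s h1]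

theorem IsLipChain.smul {c : C(I, X) →₀ ℝ} (h : IsLipChain c) (r : ℝ) : IsLipChain (r • c) :=
  fun s hs => h s (Finsupp.support_smul hs)

theorem IsLipChain.sub {c c' : C(I, X) →₀ ℝ} (h : IsLipChain c) (h' : IsLipChain c') :
    IsLipChain (c - c') := by
  have : c - c' = c + (-1 : ℝ) • c' := by simp [sub_eq_add_neg]
  rw [this]
  exact h.add (h'.smul _)

theorem isLipChain_zero : IsLipChain (0 : C(I, X) →₀ ℝ) := fun s hs => by simp at hs

theorem isLipChain_single {s : C(I, X)} {K : ℝ≥0} (hs : LipschitzWith K s) (r : ℝ) :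
    IsLipChain (Finsupp.single s r) := by
  classical
  intro s' hs'
  rw [Finset.mem_singleton.1 (Finsupp.support_single_subset hs')]
  exact ⟨K, hs⟩

end Mass

end AreaMap

namespace AreaMap

open Filter Topology Metric MeasureTheory

/-! ### Seminorm properties and homotopy invariance of the relative stable norm. -/

section RelNorm

variable {V : Type u} [NormedAddCommGroup V] [NormedSpace ℝ V] (Γ : Submodule ℤ V)
  [DiscreteTopology Γ] {n : ℕ} {X : Type u} [EMetricSpace X]
  [ChartedSpace (EuclideanSpace ℝ (Fin n)) X]
  [Bundle.RiemannianBundle (fun x : X => TangentSpace (𝓡 n) x)]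

theorem relStableNorm_le {φ : C(X, V ⧸ Γ)} {c : C(I, X) →₀ ℝ} (hc : IsLipChain c)
    (h0 : formalBoundary c = 0) : relStableNorm n Γ φ (chainDisp Γ φ c) ≤ mass n c := by
  rw [relStableNorm_eq]
  exact iInf₂_le_of_le c hc (iInf_le _ ⟨h0, rfl⟩)

theorem exists_cycle_of_relStableNorm_lt {φ : C(X, V ⧸ Γ)} {v : V} {a : ℝ≥0∞}
    (h : relStableNorm n Γ φ v < a) :
    ∃ c : C(I, X) →₀ ℝ, IsLipChain c ∧ formalBoundary c = 0 ∧ chainDisp Γ φ c = v ∧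
      mass n c < a := by
  rw [relStableNorm_eq] at h
  simp only [iInf_lt_iff] at h
  obtain ⟨c, hc, ⟨h0, h1⟩, hlt⟩ := h
  exact ⟨c, hc, h0, h1, hlt⟩

theorem relStableNorm_zero (φ : C(X, V ⧸ Γ)) : relStableNorm n Γ φ 0 = 0 := by
  have := relStableNorm_le (n := n) Γ (φ := φ) isLipChain_zero (map_zero _)
  rw [map_zero, mass_zero] at this
  exact le_antisymm this zero_le

theorem relStableNorm_add_le (φ : C(X, V ⧸ Γ)) (v w : V) :
    relStableNorm n Γ φ (v + w) ≤ relStableNorm n Γ φ v + relStableNorm n Γ φ w := by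
  refine ENNReal.le_of_forall_pos_le_add fun ε hε htop => ?_
  have hε2 : ((ε / 2 : ℝ≥0) : ℝ≥0∞) ≠ 0 := by
    rw [ENNReal.coe_ne_zero]
    positivity
  obtain ⟨hv, hw⟩ := ENNReal.add_lt_top.1 htop
  obtain ⟨c, hc, h0, h1, hlt⟩ := exists_cycle_of_relStableNorm_lt Γ (ENNReal.lt_add_right hv.ne hε2)
  obtain ⟨c', hc', h0', h1', hlt'⟩ :=
    exists_cycle_of_relStableNorm_lt Γ (ENNReal.lt_add_right hw.ne hε2)
  have := relStableNorm_le (n := n) Γ (φ := φ) (hc.add hc') (by rw [map_add, h0, h0', add_zero])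
  rw [map_add, h1, h1'] at this
  refine this.trans ((mass_add_le n c c').trans ((add_le_add hlt.le hlt'.le).trans_eq ?_))
  rw [add_add_add_comm, ← ENNReal.coe_add, add_halves]

theorem relStableNorm_smul_le (φ : C(X, V ⧸ Γ)) (r : ℝ) (v : V) :
    relStableNorm n Γ φ (r • v) ≤ ‖r‖ₑ * relStableNorm n Γ φ v := by
  rcases eq_or_ne r 0 with rfl | hr
  · rw [zero_smul, relStableNorm_zero]
    exact zero_le
  have hr' : ‖r‖ₑ ≠ 0 := by simpa using hr
  rw [mul_comm, ← ENNReal.div_le_iff_le_mul (.inl hr') (.inl enorm_ne_top)]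
  rw [relStableNorm_eq Γ n φ v]
  refine le_iInf fun c => le_iInf fun hc => le_iInf fun h => ?_
  rw [ENNReal.div_le_iff_le_mul (.inl hr') (.inl enorm_ne_top), mul_comm, ← mass_smul]
  have := relStableNorm_le (n := n) Γ (φ := φ) (hc.smul r) (by rw [map_smul, h.1, smul_zero])
  rwa [map_smul, h.2] at this

theorem disp_translate {X : Type u} [TopologicalSpace X] (φ : C(X, V ⧸ Γ)) (G : C(X, V))
    (s : C(I, X)) :
    disp Γ ((φ + (torusMk Γ).comp G).comp s) = disp Γ (φ.comp s) + (G (s 1) - G (s 0)) := by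
  have : (φ + (torusMk Γ).comp G).comp s =
      (torusMk Γ).comp (pathLift Γ (φ.comp s) + G.comp s) := by
    ext t
    change φ (s t) + torusMk Γ (G (s t)) = torusMk Γ (pathLift Γ (φ.comp s) t + G (s t))
    rw [torusMk_add, torusMk_pathLift]
    rfl
  rw [this, disp_torusMk_comp, disp]
  simp only [ContinuousMap.add_apply, ContinuousMap.comp_apply]
  abel

theorem chainDisp_translate {X : Type u} [TopologicalSpace X] (φ : C(X, V ⧸ Γ)) (G : C(X, V))
    (c : C(I, X) →₀ ℝ) :
    chainDisp Γ (φ + (torusMk Γ).comp G) c =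
      chainDisp Γ φ c + Finsupp.linearCombination ℝ G (formalBoundary c) := by
  have : chainDisp Γ (φ + (torusMk Γ).comp G) =
      chainDisp Γ φ + (Finsupp.linearCombination ℝ G).comp formalBoundary := by
    ext s
    simp only [chainDisp, formalBoundary, LinearMap.comp_apply, LinearMap.add_apply, Finsupp.lsingle_apply, Finsupp.linearCombination_single, one_smul, map_sub]
    exact disp_translate Γ φ G s
  rw [this]
  rfl

/-- The translation changes the displacement of a chain by the sum of `G` over its boundary, which
vanishes for cycles. Thus `φ` may be replaced by its Lipschitz representative. -/
theorem relStableNorm_translate (φ : C(X, V ⧸ Γ)) (G : C(X, V)) :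
    relStableNorm n Γ (φ + (torusMk Γ).comp G) = relStableNorm n Γ φ := by
  ext v
  rw [relStableNorm_eq, relStableNorm_eq]
  refine iInf_congr fun c => iInf_congr fun _ => ?_
  have : (formalBoundary c = 0 ∧ chainDisp Γ (φ + (torusMk Γ).comp G) c = v) ↔
      (formalBoundary c = 0 ∧ chainDisp Γ φ c = v) := by
    refine and_congr_right fun h => ?_
    rw [chainDisp_translate, h, map_zero, add_zero]
  rw [this]

end RelNorm

/-! ### Chains joining points, and coboundaries. -/

section Chains

variable {V : Type u} [NormedAddCommGroup V] [NormedSpace ℝ V] (Γ : Submodule ℤ V)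
  [DiscreteTopology Γ] {n : ℕ} {X : Type u} [EMetricSpace X]
  [ChartedSpace (EuclideanSpace ℝ (Fin n)) X]
  [Bundle.RiemannianBundle (fun x : X => TangentSpace (𝓡 n) x)]
  [IsManifold (𝓡 n) ∞ X]
  [IsContMDiffRiemannianBundle (𝓡 n) ∞ (EuclideanSpace ℝ (Fin n))
      (fun x : X => TangentSpace (𝓡 n) x)]
  [IsRiemannianManifold (𝓡 n) X]

theorem IsTorusLipschitz.enorm_chainDisp_le {ψ : C(X, V ⧸ Γ)} {K : ℝ≥0} {δ : ℝ≥0∞} (hδ : 0 < δ)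
    (h : IsTorusLipschitz Γ ψ K δ) {c : C(I, X) →₀ ℝ} (hc : IsLipChain c) :
    ‖chainDisp Γ ψ c‖ₑ ≤ 4 * K * mass n c := by
  rw [chainDisp, Finsupp.linearCombination_apply, Finsupp.sum, mass, Finsupp.sum, Finset.mul_sum]
  refine (enorm_sum_le _ _).trans (Finset.sum_le_sum fun s hs => ?_)
  obtain ⟨K₀, hs⟩ := hc s hs
  rw [enorm_smul, mul_left_comm]
  gcongr
  exact h.enorm_disp_le Γ hδ hs

/-- This bounds the unit ball of the relative stable norm, so that the seminorm is a norm. -/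
theorem IsTorusLipschitz.enorm_le_of_relStableNorm_lt {ψ : C(X, V ⧸ Γ)} {K : ℝ≥0} {δ : ℝ≥0∞}
    (hδ : 0 < δ) (h : IsTorusLipschitz Γ ψ K δ) {v : V} {a : ℝ≥0∞}
    (hv : relStableNorm n Γ ψ v < a) : ‖v‖ₑ ≤ 4 * K * a := by
  obtain ⟨c, hc, -, rfl, hlt⟩ := exists_cycle_of_relStableNorm_lt Γ hv
  exact (h.enorm_chainDisp_le Γ hδ hc).trans (by gcongr)

variable (n) in
/-- A Lipschitz chain of finite mass with boundary `z - x`. -/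
structure IsChainFrom (x z : X) (c : C(I, X) →₀ ℝ) : Prop where
  isLipChain : IsLipChain c
  mass_ne_top : mass n c ≠ ⊤
  boundary : formalBoundary c = Finsupp.single z 1 - Finsupp.single x 1

theorem isChainFrom_single {s : C(I, X)} {K : ℝ≥0} (hs : LipschitzWith K s)
    (hl : pathLength n s ≠ ⊤) : IsChainFrom n (s 0) (s 1) (Finsupp.single s 1) where
  isLipChain := isLipChain_single hs 1
  mass_ne_top := by simpa [mass_single] using hl
  boundary := by simp [formalBoundary]

theorem IsChainFrom.trans {x y z : X} {c c' : C(I, X) →₀ ℝ} (h : IsChainFrom n x y c)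
    (h' : IsChainFrom n y z c') : IsChainFrom n x z (c + c') where
  isLipChain := h.isLipChain.add h'.isLipChain
  mass_ne_top := ne_top_of_le_ne_top (ENNReal.add_ne_top.2 ⟨h.mass_ne_top, h'.mass_ne_top⟩)
    (mass_add_le n _ _)
  boundary := by rw [map_add, h.boundary, h'.boundary]; abel

theorem IsChainFrom.symm {x y : X} {c : C(I, X) →₀ ℝ} (h : IsChainFrom n x y c) :
    IsChainFrom n y x ((-1 : ℝ) • c) where
  isLipChain := h.isLipChain.smul _
  mass_ne_top := by
    rw [mass_smul]
    exact ENNReal.mul_ne_top enorm_ne_top h.mass_ne_top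
  boundary := by rw [map_smul, h.boundary]; simp

/-- The relation holds between nearby points, by chart segments, and it is symmetric and transitive;
connectedness does the rest. -/
theorem exists_isChainFrom [PreconnectedSpace X] (x z : X) : ∃ c, IsChainFrom n x z c := by
  refine PreconnectedSpace.induction₂' (fun x z : X => ∃ c, IsChainFrom n x z c) ?_ ?_ x z
  · intro x
    obtain ⟨h, hx, hc, hh⟩ := exists_almostIsometricChart_at n x one_pos
    filter_upwards [h.open_source.mem_nhds hx] with z hz
    obtain ⟨s, rfl, rfl, -, hK, hl⟩ := hh.exists_path hc hx hz
    have := isChainFrom_single hK (ne_top_of_le_ne_top ENNReal.ofReal_ne_top hl)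
    exact ⟨⟨_, this⟩, _, this.symm⟩
  · exact ⟨fun x y z ⟨c, hc⟩ ⟨c', hc'⟩ => ⟨_, hc.trans hc'⟩⟩

/-- The cycle made of two chains with a common starting point and a path. -/
theorem IsChainFrom.add_single_sub {x : X} {s : C(I, X)} {K : ℝ≥0} (hs : LipschitzWith K s)
    (hl : pathLength n s ≠ ⊤) {c c' : C(I, X) →₀ ℝ} (hc : IsChainFrom n x (s 0) c)
    (hc' : IsChainFrom n x (s 1) c') :
    IsLipChain (c + Finsupp.single s 1 - c') ∧ formalBoundary (c + Finsupp.single s 1 - c') = 0 ∧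
      mass n (c + Finsupp.single s 1 - c') ≠ ⊤ := by
  have h := hc.trans (isChainFrom_single hs hl)
  refine ⟨h.isLipChain.sub hc'.isLipChain, ?_, ?_⟩
  · rw [map_sub, h.boundary, hc'.boundary, sub_self]
  · exact ne_top_of_le_ne_top (ENNReal.add_ne_top.2 ⟨h.mass_ne_top, hc'.mass_ne_top⟩)
      (mass_sub_le n _ _)

/-- If a functional of the displacement is a coboundary on short Lipschitz paths, then it is one on
all continuous paths. -/
theorem coboundary_of_lipschitz (ψ : C(X, V ⧸ Γ)) (f : V →ₗ[ℝ] ℝ) (g : X → ℝ)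
    (H : ∀ (s : C(I, X)) (K : ℝ≥0), LipschitzWith K s → pathLength n s ≠ ⊤ →
      f (disp Γ (ψ.comp s)) = g (s 1) - g (s 0)) (p : C(I, X)) :
    f (disp Γ (ψ.comp p)) = g (p 1) - g (p 0) := by
  set τ := pathLift Γ (ψ.comp p)
  -- Over a chart, `τ` differs from the local lift along `p` by a continuous lattice-valued
  -- function, which is locally constant. A short stretch of `p` therefore has the displacement of a
  -- Lipschitz chart segment with the same endpoints, where `H` applies.
  have hloc : IsLocallyConstant fun t => f (τ t) - g (p t) := by
    rw [IsLocallyConstant.iff_eventually_eq]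
    intro t
    obtain ⟨h, hx, hc, hh⟩ := exists_almostIsometricChart_at n (p t) one_pos
    obtain ⟨T, hT, hTl⟩ := exists_lift_chart Γ ψ h hc
    obtain ⟨η, hη, hΓ⟩ := exists_pos_forall_mem_lattice Γ
    have hev : ∀ᶠ t' in 𝓝 t, p t' ∈ h.source :=
      p.continuous.continuousAt.eventually (h.open_source.mem_nhds hx)
    have hcont : ContinuousAt (fun t' => (τ t' - T (p t')) - (τ t - T (p t))) t := by
      have h1 : ContinuousAt (fun t' => T (p t')) t :=
        ContinuousAt.comp (hT.continuousAt (h.open_source.mem_nhds hx)) p.continuous.continuousAt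
      exact (τ.continuous.continuousAt.sub h1).sub continuousAt_const
    have hsmall : ∀ᶠ t' in 𝓝 t, ‖(τ t' - T (p t')) - (τ t - T (p t))‖ < η := by
      exact hcont.norm.tendsto.eventually_lt_const (by simpa using hη)
    have hmem : ∀ t', p t' ∈ h.source → τ t' - T (p t') ∈ Γ := by
      intro t' ht'
      rw [← torusMk_eq_iff, hTl _ ht']
      exact torusMk_pathLift Γ _ t'
    filter_upwards [hev, hsmall] with t' ht' hs'
    have h0 := hΓ _ (Γ.sub_mem (hmem t' ht') (hmem t hx)) hs'
    obtain ⟨s, hs0, hs1, hsrc, hK, hl⟩ := hh.exists_path hc hx ht'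
    have h2 := H s _ hK (ne_top_of_le_ne_top ENNReal.ofReal_ne_top hl)
    rw [disp_comp_eq_of_lift Γ ψ hT hTl hsrc, hs0, hs1] at h2
    have h3 : τ t' = T (p t') - T (p t) + τ t := by
      rw [← sub_eq_zero, ← h0]
      abel
    rw [h3, map_add, h2]
    ring
  have := hloc.apply_eq_of_preconnectedSpace 1 0
  rw [disp, map_sub]
  linarith

end Chains

/-! ### Lattice vectors as displacements of loops. -/

section Loops

variable {V : Type u} [NormedAddCommGroup V] [NormedSpace ℝ V] (Γ : Submodule ℤ V)
  [DiscreteTopology Γ]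

/-- Homotopic paths in `V/Γ` have the same displacement. -/
theorem disp_eq_of_homotopic {a b : V ⧸ Γ} {p q : Path a b} (h : p.Homotopic q) :
    disp Γ (p : C(I, V ⧸ Γ)) = disp Γ (q : C(I, V ⧸ Γ)) := by
  obtain ⟨H⟩ := h
  have : ContractibleSpace I := (convex_Icc (0 : ℝ) 1).contractibleSpace ⟨0, by simp⟩
  obtain ⟨F, hF⟩ := exists_lift_of_contractible Γ (H : C(I × I, V ⧸ Γ))
  have hF' : ∀ x, torusMk Γ (F x) = H x := fun x => congrArg (fun f : C(I × I, V ⧸ Γ) => f x) hF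
  have key : ∀ (u : I), disp Γ (H.eval u : C(I, V ⧸ Γ)) = F (u, 1) - F (u, 0) := by
    intro u
    have : (H.eval u : C(I, V ⧸ Γ)) =
        (torusMk Γ).comp (F.comp ⟨fun t => (u, t), by fun_prop⟩) := by
      ext t
      exact (hF' _).symm
    rw [this, disp_torusMk_comp]
    rfl
  have hconst : ∀ i : I, (i = 0 ∨ i = 1) → F (0, i) = F (1, i) := by
    intro i hi
    have := lift_sub_lift_eq Γ (F := fun u : I => F (u, i)) (G := fun _ => F (0, i))
      (by fun_prop) continuous_const (fun u => by
        rw [hF', hF']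
        rcases hi with rfl | rfl
        · rw [H.source, H.source]
        · rw [H.target, H.target]) 0 1
    simpa [sub_eq_zero] using this
  have h0 := key 0
  have h1 := key 1
  rw [H.eval_zero] at h0
  rw [H.eval_one] at h1
  rw [h0, h1, hconst 0 (.inl rfl), hconst 1 (.inr rfl)]

/-- If `φ` is surjective on fundamental groups, every lattice vector is the displacement of a
loop. -/
theorem exists_loop_disp_eq {X : Type u} [TopologicalSpace X] {φ : C(X, V ⧸ Γ)} {x₀ : X}
    (hφ : Function.Surjective (FundamentalGroup.map φ x₀)) {γ : V} (hγ : γ ∈ Γ) :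
    ∃ p : C(I, X), p 0 = x₀ ∧ p 1 = x₀ ∧ disp Γ (φ.comp p) = γ := by
  obtain ⟨v, hv⟩ := torusMk_surjective Γ (φ x₀)
  let τ : C(I, V) := ⟨fun t => v + (t : ℝ) • γ, by fun_prop⟩
  let q : Path (φ x₀) (φ x₀) :=
    { toContinuousMap := (torusMk Γ).comp τ
      source' := by simp [τ, hv]
      target' := by
        have : torusMk Γ (v + γ) = torusMk Γ v := by
          rw [torusMk_eq_iff]
          simpa using hγ
        simpa [τ, hv] using this }
  obtain ⟨b, hb⟩ := hφ (FundamentalGroup.fromPath (Path.Homotopic.Quotient.mk q))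
  obtain ⟨p, rfl⟩ := Path.Homotopic.Quotient.mk_surjective b
  refine ⟨p, p.source, p.target, ?_⟩
  have h1 : Path.Homotopic.Quotient.mk (p.map φ.continuous) = Path.Homotopic.Quotient.mk q := hb
  refine (disp_eq_of_homotopic Γ (Path.Homotopic.Quotient.exact h1)).trans ?_
  refine (disp_torusMk_comp Γ τ).trans ?_
  simp [τ]

end Loops

/-! ### Finiteness of the relative stable norm. -/

section Finite

variable {V : Type u} [NormedAddCommGroup V] [NormedSpace ℝ V] (Γ : Submodule ℤ V)
  [DiscreteTopology Γ] {n : ℕ} {X : Type u} [EMetricSpace X]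
  [ChartedSpace (EuclideanSpace ℝ (Fin n)) X]
  [Bundle.RiemannianBundle (fun x : X => TangentSpace (𝓡 n) x)]
  [IsManifold (𝓡 n) ∞ X]
  [IsContMDiffRiemannianBundle (𝓡 n) ∞ (EuclideanSpace ℝ (Fin n))
      (fun x : X => TangentSpace (𝓡 n) x)]
  [IsRiemannianManifold (𝓡 n) X]

/-- The relative stable norm is finite if the map is surjective on fundamental groups. -/
theorem relStableNorm_ne_top [FiniteDimensional ℝ V] [IsZLattice ℝ Γ] [PreconnectedSpace X]
    {φ : C(X, V ⧸ Γ)} {x₀ : X} (hφ : Function.Surjective (FundamentalGroup.map φ x₀)) (v : V) :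
    relStableNorm n Γ φ v ≠ ⊤ := by
  let S : Submodule ℝ V :=
    { carrier := {v | relStableNorm n Γ φ v ≠ ⊤}
      add_mem' := fun {a b} ha hb =>
        ne_top_of_le_ne_top (ENNReal.add_ne_top.2 ⟨ha, hb⟩) (relStableNorm_add_le Γ φ a b)
      zero_mem' := by simp [relStableNorm_zero]
      smul_mem' := fun r a ha => ne_top_of_le_ne_top (ENNReal.mul_ne_top enorm_ne_top ha)
        (relStableNorm_smul_le Γ φ r a) }
  suffices h : S = ⊤ by
    have : v ∈ S := h ▸ Submodule.mem_top
    exact this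
  by_contra hS
  -- A nonzero functional that kills every vector of finite norm. Closing a path by chains from the
  -- base point shows that `f` of its displacement is a coboundary, so it vanishes on loops. The
  -- loops that realize `Γ` are only continuous, hence the passage through
  -- `coboundary_of_lipschitz`.
  obtain ⟨f, hf, hker⟩ := Submodule.exists_le_ker_of_lt_top S (lt_top_iff_ne_top.2 hS)
  choose c hc using exists_isChainFrom (n := n) x₀
  have hcob := coboundary_of_lipschitz (n := n) Γ φ f (fun x => f (chainDisp Γ φ (c x))) (by
    intro s K hK hl
    obtain ⟨h1, h2, h3⟩ := IsChainFrom.add_single_sub hK hl (hc (s 0)) (hc (s 1))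
    have h4 : chainDisp Γ φ (c (s 0) + Finsupp.single s 1 - c (s 1)) ∈ S :=
      ne_top_of_le_ne_top h3 (relStableNorm_le Γ h1 h2)
    have h5 : f _ = 0 := hker h4
    have h6 : chainDisp Γ φ (Finsupp.single s 1) = disp Γ (φ.comp s) := by simp [chainDisp]
    rw [map_sub, map_add, map_sub, map_add, h6] at h5
    linarith)
  apply hf
  refine LinearMap.ext_on (s := (Γ : Set V)) (IsZLattice.span_top (K := ℝ) (L := Γ)) ?_
  intro γ hγ
  obtain ⟨p, h0, h1, rfl⟩ := exists_loop_disp_eq Γ hφ hγ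
  rw [hcob p, h0, h1, sub_self]
  rfl

end Finite

end AreaMap

namespace AreaMap

open Filter Topology Metric MeasureTheory

/-! ### Calibrating functions for dominated functionals. -/

section Calibration

variable {V : Type u} [NormedAddCommGroup V] [NormedSpace ℝ V] (Γ : Submodule ℤ V)
  [DiscreteTopology Γ] {n : ℕ} {X : Type u} [EMetricSpace X]
  [ChartedSpace (EuclideanSpace ℝ (Fin n)) X]
  [Bundle.RiemannianBundle (fun x : X => TangentSpace (𝓡 n) x)]
  [IsManifold (𝓡 n) ∞ X]
  [IsContMDiffRiemannianBundle (𝓡 n) ∞ (EuclideanSpace ℝ (Fin n))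
      (fun x : X => TangentSpace (𝓡 n) x)]
  [IsRiemannianManifold (𝓡 n) X]

/-- The relative stable norm is a seminorm if it is finite. -/
theorem exists_seminorm_eq_relStableNorm {φ : C(X, V ⧸ Γ)}
    (hfin : ∀ v, relStableNorm n Γ φ v ≠ ⊤) :
    ∃ p : Seminorm ℝ V, ∀ v, relStableNorm n Γ φ v = ENNReal.ofReal (p v) := by
  refine ⟨Seminorm.ofSMulLE (fun v => (relStableNorm n Γ φ v).toReal) ?_ ?_ ?_, ?_⟩
  · rw [relStableNorm_zero]
    rfl
  · intro v w
    rw [← ENNReal.toReal_add (hfin v) (hfin w)]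
    exact ENNReal.toReal_mono (ENNReal.add_ne_top.2 ⟨hfin v, hfin w⟩) (relStableNorm_add_le Γ φ v w)
  · intro r v
    rw [← toReal_enorm, ← ENNReal.toReal_mul]
    exact ENNReal.toReal_mono (ENNReal.mul_ne_top enorm_ne_top (hfin v))
      (relStableNorm_smul_le Γ φ r v)
  · intro v
    exact (ENNReal.ofReal_toReal (hfin v)).symm

/-- A functional that is bounded by the relative stable norm is calibrated by a function that
satisfies a Lipschitz estimate along paths. -/
theorem exists_calibration [PreconnectedSpace X] (ψ : C(X, V ⧸ Γ)) (f : V →ₗ[ℝ] ℝ)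
    (hf : ∀ v, ENNReal.ofReal (f v) ≤ relStableNorm n Γ ψ v) (x₀ : X) :
    ∃ g : X → ℝ, ∀ (s : C(I, X)) (K : ℝ≥0), LipschitzWith K s → pathLength n s ≠ ⊤ →
      |g (s 1) - g (s 0) + f (disp Γ (ψ.comp s))| ≤ (pathLength n s).toReal := by
  -- The calibrating function is the value function of a minimization: the least mass minus `f` of
  -- the displacement among chains from `x₀`.
  let A : X → Set ℝ := fun x =>
    (fun c => (mass n c).toReal - f (chainDisp Γ ψ c)) '' {c | IsChainFrom n x₀ x c}
  have hne : ∀ x, (A x).Nonempty := fun x => Set.Nonempty.image _ (exists_isChainFrom x₀ x)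
  -- The difference of two chains with the same endpoints is a cycle, on which `f` is at most the
  -- mass by `hf`.
  have hbdd : ∀ x, BddBelow (A x) := by
    intro x
    obtain ⟨c', hc'⟩ := exists_isChainFrom (n := n) x₀ x
    refine ⟨-(mass n c').toReal - f (chainDisp Γ ψ c'), ?_⟩
    rintro _ ⟨c, hc, rfl⟩
    have h1 := (hf _).trans (relStableNorm_le (n := n) Γ (φ := ψ)
      (hc.isLipChain.sub hc'.isLipChain) (by rw [map_sub, hc.boundary, hc'.boundary, sub_self]))
    have h2 := h1.trans (mass_sub_le n c c')
    rw [map_sub, map_sub, ENNReal.ofReal_le_iff_le_toReal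
      (ENNReal.add_ne_top.2 ⟨hc.mass_ne_top, hc'.mass_ne_top⟩),
      ENNReal.toReal_add hc.mass_ne_top hc'.mass_ne_top] at h2
    change _ ≤ (mass n c).toReal - f (chainDisp Γ ψ c)
    linarith
  have key : ∀ {x y : X} {e : C(I, X) →₀ ℝ}, IsChainFrom n x y e →
      sInf (A y) ≤ sInf (A x) + (mass n e).toReal - f (chainDisp Γ ψ e) := by
    intro x y e he
    have : sInf (A y) - (mass n e).toReal + f (chainDisp Γ ψ e) ≤ sInf (A x) := by
      refine le_csInf (hne x) ?_
      rintro _ ⟨c, hc, rfl⟩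
      have h1 := csInf_le (hbdd y) ⟨c + e, hc.trans he, rfl⟩
      have h2 : (mass n (c + e)).toReal ≤ (mass n c).toReal + (mass n e).toReal := by
        rw [← ENNReal.toReal_add hc.mass_ne_top he.mass_ne_top]
        exact ENNReal.toReal_mono (ENNReal.add_ne_top.2 ⟨hc.mass_ne_top, he.mass_ne_top⟩)
          (mass_add_le n c e)
      simp only [map_add] at h1
      simp only
      linarith
    linarith
  refine ⟨fun x => sInf (A x), fun s K hK hl => ?_⟩
  have h1 := isChainFrom_single hK hl
  have h2 := key h1
  -- The reversed path gives the other half of the absolute value.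
  have h3 := key h1.symm
  have h4 : chainDisp Γ ψ (Finsupp.single s 1) = disp Γ (ψ.comp s) := by simp [chainDisp]
  rw [mass_smul, map_smul, map_smul, h4] at h3
  rw [h4] at h2
  simp only [mass_single, enorm_neg, enorm_one, one_mul, smul_eq_mul] at h2 h3
  rw [abs_le]
  constructor <;> linarith

end Calibration

end AreaMap

namespace AreaMap

open Filter Topology Metric MeasureTheory

/-! ### Carathéodory's theorem and compactness of convex hulls. -/

section ConvexHull

/-- The convex hull of a compact set in a finite-dimensional space is compact. -/
theorem isCompact_convexHull {E : Type*} [AddCommGroup E] [Module ℝ E] [TopologicalSpace E]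
    [IsTopologicalAddGroup E] [ContinuousSMul ℝ E] [FiniteDimensional ℝ E] {K : Set E}
    (hK : IsCompact K) : IsCompact (convexHull ℝ K) := by
  -- The number of points in Carathéodory's theorem; shorter combinations are padded with weight
  -- zero at a point of `K`.
  let N := Module.finrank ℝ E + 1
  let Φ : (Fin N → ℝ) × (Fin N → E) → E := fun q => ∑ i, q.1 i • q.2 i
  have hΦ : Continuous Φ := by fun_prop
  have himg : Φ '' (stdSimplex ℝ (Fin N) ×ˢ Set.univ.pi fun _ => K) = convexHull ℝ K := by
    apply Set.Subset.antisymm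
    · rintro _ ⟨⟨w, z⟩, ⟨hw, hz⟩, rfl⟩
      exact mem_convexHull_of_exists_fintype w z hw.1 hw.2 (fun i => hz i trivial) rfl
    · intro x hx
      obtain ⟨ι, _, z, w, hz, hind, hw, hsum, rfl⟩ := eq_pos_convex_span_of_mem_convexHull hx
      have hcard : Fintype.card ι ≤ Fintype.card (Fin N) := by
        rw [Fintype.card_fin]
        exact hind.card_le_finrank_succ.trans
          (Nat.succ_le_succ (Submodule.finrank_le (vectorSpan ℝ (Set.range z))))
      obtain ⟨e⟩ := Function.Embedding.nonempty_of_card_le hcard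
      have hne : Nonempty ι := by
        by_contra h
        rw [not_nonempty_iff] at h
        simp at hsum
      obtain ⟨i₀⟩ := hne
      refine ⟨(Function.extend e w 0, Function.extend e z fun _ => z i₀), ⟨⟨?_, ?_⟩, ?_⟩, ?_⟩
      · intro i
        by_cases hi : ∃ j, e j = i
        · obtain ⟨j, rfl⟩ := hi
          simpa [e.injective.extend_apply] using (hw j).le
        · simp [Function.extend_apply' _ _ _ hi]
      · rw [← hsum]
        refine (Fintype.sum_of_injective e e.injective _ _ ?_ ?_).symm
        · intro i hi
          exact Function.extend_apply' _ _ _ hi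
        · intro j
          simp [e.injective.extend_apply]
      · intro i _
        by_cases hi : ∃ j, e j = i
        · obtain ⟨j, rfl⟩ := hi
          simpa [e.injective.extend_apply] using hz (Set.mem_range_self j)
        · simpa [Function.extend_apply' _ _ _ hi] using hz (Set.mem_range_self i₀)
      · refine (Fintype.sum_of_injective e e.injective _ _ ?_ ?_).symm
        · intro i hi
          simp [Function.extend_apply' w _ _ hi]
        · intro j
          simp [e.injective.extend_apply]
  rw [← himg]
  exact ((isCompact_stdSimplex ℝ (Fin N)).prod (isCompact_univ_pi fun _ => hK)).image hΦ

end ConvexHull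

/-! ### John's decomposition of the identity. -/

section Decomposition

variable {d : ℕ}

theorem det_toEuclideanLin (M : Matrix (Fin d) (Fin d) ℝ) :
    LinearMap.det (Matrix.toEuclideanLin M) = M.det := 
  LinearMap.det_toLin (PiLp.basisFun 2 ℝ (Fin d)) M

theorem hasDerivAt_det_one_add_smul (M : Matrix (Fin d) (Fin d) ℝ) :
    HasDerivAt (fun t : ℝ => (1 + t • M).det) M.trace 0 := by
  have h : (fun t : ℝ => (1 + t • M).det) = fun t => 1 + M.trace * t +
      (Polynomial.divX (Polynomial.divX
        (1 + (Polynomial.X : Polynomial ℝ) • M.map Polynomial.C).det)).eval t * t ^ 2 := by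
    ext t
    exact Matrix.det_one_add_smul t M
  rw [h]
  have h1 := ((hasDerivAt_id (0 : ℝ)).const_mul M.trace).const_add 1
  have h2 := (Polynomial.hasDerivAt (Polynomial.divX (Polynomial.divX
        (1 + (Polynomial.X : Polynomial ℝ) • M.map Polynomial.C).det)) 0).mul
        ((hasDerivAt_id (0 : ℝ)).pow 2)
  refine HasDerivAt.congr_deriv (h1.add h2) ?_
  simp

/-- An expansion of the determinant to first order. -/
theorem trace_le_of_det_sq_le (H : Matrix (Fin d) (Fin d) ℝ) (m C : ℝ)
    (h : ∀ t : ℝ, 0 < t → 0 < 1 + t * m + t ^ 2 * C →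
      (1 + (t / 2) • H).det ^ 2 ≤ (1 + t * m + t ^ 2 * C) ^ d) : H.trace ≤ d * m := by
  have hd1 : HasDerivAt (fun t : ℝ => (1 + t * m + t ^ 2 * C) ^ d) (d * m) 0 := by
    have h1 : HasDerivAt (fun t : ℝ => 1 + t * m + t ^ 2 * C) m 0 := by
      have := (((hasDerivAt_id (0 : ℝ)).mul_const m).const_add 1).add
        (((hasDerivAt_id (0 : ℝ)).pow 2).mul_const C)
      refine HasDerivAt.congr_deriv (this) ?_
      simp
    refine HasDerivAt.congr_deriv (h1.pow d) ?_
    simp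
  have hd2 : HasDerivAt (fun t : ℝ => (1 + (t / 2) • H).det ^ 2) H.trace 0 := by
    have h0 : HasDerivAt (fun t : ℝ => (1 + t • H).det) H.trace (id 0 / 2) := by
      simpa using hasDerivAt_det_one_add_smul H
    have h1 := (HasDerivAt.comp (0 : ℝ) h0 ((hasDerivAt_id (0 : ℝ)).div_const 2)).pow 2
    refine HasDerivAt.congr_deriv (h1) ?_
    simp
    ring
  -- Both sides equal one at zero, so the inequality for small positive `t` passes to the
  -- derivatives. The factor `t / 2` cancels the factor 2 from the square.
  have hd := (hd1.sub hd2).hasDerivWithinAt (s := Set.Ioi 0)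
  rw [hasDerivWithinAt_iff_tendsto_slope' (by simp)] at hd
  have hpos : ∀ᶠ t : ℝ in 𝓝[>] 0, 0 < 1 + t * m + t ^ 2 * C := by
    have : ContinuousAt (fun t : ℝ => 1 + t * m + t ^ 2 * C) 0 := by fun_prop
    exact (this.eventually_const_lt (by simp)).filter_mono nhdsWithin_le_nhds
  have := ge_of_tendsto hd (b := 0) (by
    filter_upwards [hpos, self_mem_nhdsWithin] with t ht ht0
    have ht0' : (0 : ℝ) < t := ht0
    rw [slope_def_field]
    refine div_nonneg ?_ (by linarith)
    have := h t ht0' ht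
    simp
    linarith)
  linarith

/-- Hahn–Banach, extending the functional that sends `y` to `q y` from the line through `y`. -/
theorem exists_dominated_eq {F : Type*} [AddCommGroup F] [Module ℝ F] (q : Seminorm ℝ F) (y : F) :
    ∃ f : F →ₗ[ℝ] ℝ, f y = q y ∧ ∀ x, f x ≤ q x := by
  rcases eq_or_ne y 0 with rfl | hy
  · exact ⟨0, by simp, fun x => by simp⟩
  obtain ⟨g, hg, hle⟩ := Module.Dual.exists_extension_of_le_seminorm_real (Submodule.span ℝ {y})
    (LinearPMap.mkSpanSingleton y (q y) hy).toFun (p := q) (by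
      rintro ⟨x, hx⟩
      obtain ⟨c, rfl⟩ := Submodule.mem_span_singleton.1 hx
      refine (LinearPMap.mkSpanSingleton'_apply y (q y) _ c hx).trans_le ?_
      change c • q y ≤ q (c • y)
      rw [map_smul_eq_mul, smul_eq_mul]
      exact mul_le_mul_of_nonneg_right (le_abs_self c) (apply_nonneg q y))
  refine ⟨g, ?_, fun x => (le_abs_self _).trans (hle x)⟩
  have h1 := hg ⟨y, Submodule.mem_span_singleton_self y⟩
  refine h1.trans ?_
  exact LinearPMap.mkSpanSingleton'_apply_self y (q y) _ _

theorem exists_inner_dominated_eq (q : Seminorm ℝ (EuclideanSpace ℝ (Fin d)))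
    (y : EuclideanSpace ℝ (Fin d)) :
    ∃ a : EuclideanSpace ℝ (Fin d), inner ℝ a y = q y ∧ ∀ x, inner ℝ a x ≤ q x := by
  obtain ⟨f, hf, hle⟩ := exists_dominated_eq q y
  refine ⟨(InnerProductSpace.toDual ℝ _).symm (LinearMap.toContinuousLinearMap f), ?_, fun x => ?_⟩
  · rw [InnerProductSpace.toDual_symm_apply]
    exact hf
  · rw [InnerProductSpace.toDual_symm_apply]
    exact hle x

/-- A linear functional on square matrices in coordinates. -/
theorem exists_matrix_repr (f : (Fin d → Fin d → ℝ) →ₗ[ℝ] ℝ) :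
    ∃ H : Matrix (Fin d) (Fin d) ℝ, ∀ A, f A = ∑ i, ∑ j, A i j * H i j := by
  refine ⟨fun i j => f (Pi.single i (Pi.single j 1)), fun A => ?_⟩
  have : A = ∑ i, ∑ j, A i j • Pi.single (M := fun _ => Fin d → ℝ) i (Pi.single j 1) := by
    ext k l
    simp [Finset.sum_apply, Pi.single_apply, ite_apply]
  conv_lhs => rw [this]
  simp [map_sum]

/-- John's decomposition of the identity: if the unit ball has largest volume among the ellipsoids
inscribed in the unit ball of the seminorm `q`, then the identity is a nonnegative combination of
the squares of functionals that are bounded by `q`. -/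
theorem exists_john_decomposition (q : Seminorm ℝ (EuclideanSpace ℝ (Fin d)))
    (hq : ∀ x, q x ≤ ‖x‖)
    (hdet : ∀ S : EuclideanSpace ℝ (Fin d) →ₗ[ℝ] EuclideanSpace ℝ (Fin d),
      (∀ x, q (S x) ≤ ‖x‖) → |LinearMap.det S| ≤ 1) :
    ∃ (ι : Type) (_ : Fintype ι) (l : ι → ℝ) (a : ι → EuclideanSpace ℝ (Fin d)),
      (∀ i, 0 ≤ l i) ∧ ∑ i, l i = d ∧ (∀ i x, inner ℝ (a i) x ≤ q x) ∧
        ∀ x, ∑ i, (l i * inner ℝ (a i) x) • a i = x := by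
  rcases Nat.eq_zero_or_pos d with rfl | hd
  · exact ⟨Empty, inferInstance, fun _ => 0, fun _ => 0, by simp, by simp, by simp,
      fun x => Subsingleton.elim _ _⟩
  let C : Set (EuclideanSpace ℝ (Fin d)) := {a | ∀ x, inner ℝ a x ≤ q x}
  have hCnorm : ∀ a ∈ C, ‖a‖ ≤ 1 := by
    intro a ha
    have h1 := (ha a).trans (hq a)
    rw [real_inner_self_eq_norm_sq] at h1
    nlinarith [norm_nonneg a]
  have hCcomp : IsCompact C := by
    refine (isCompact_closedBall (0 : EuclideanSpace ℝ (Fin d)) 1).of_isClosed_subset ?_ ?_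
    · have : C = ⋂ x, {a | inner ℝ a x ≤ q x} := by
        ext a
        simp [C]
      rw [this]
      exact isClosed_iInter fun x => isClosed_le (by fun_prop) continuous_const
    · intro a ha
      simpa using hCnorm a ha
  let R : EuclideanSpace ℝ (Fin d) → (Fin d → Fin d → ℝ) := fun a i j => a i * a j
  have hR : Continuous R := by fun_prop
  let D : Fin d → Fin d → ℝ := fun i j => if i = j then (d : ℝ)⁻¹ else 0
  have hd0 : (d : ℝ) ≠ 0 := by positivity
  -- `D` is the identity divided by `d`. If it were not a convex combination of the squares `a ⊗ a`,
  -- a separating matrix `H` would deform the ball into an inscribed ellipsoid of larger volume.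
  have hmem : D ∈ convexHull ℝ (R '' C) := by
    by_contra hD
    obtain ⟨f, m, hfm, hmD⟩ := geometric_hahn_banach_closed_point (convex_convexHull ℝ (R '' C))
      (isCompact_convexHull (hCcomp.image hR)).isClosed hD
    obtain ⟨H, hH⟩ := exists_matrix_repr (f : (Fin d → Fin d → ℝ) →ₗ[ℝ] ℝ)
    have hH' : ∀ A, f A = ∑ i, ∑ j, A i j * H i j := hH
    let Hl : EuclideanSpace ℝ (Fin d) →L[ℝ] EuclideanSpace ℝ (Fin d) :=
      LinearMap.toContinuousLinearMap (Matrix.toEuclideanLin H)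
    have hinner : ∀ a, inner ℝ a (Hl a) = f (R a) := by
      intro a
      rw [hH', PiLp.inner_apply]
      refine Finset.sum_congr rfl fun i _ => ?_
      have : Hl a i = ∑ j, H i j * a j := rfl
      simp only [this, R, RCLike.inner_apply, conj_trivial, Finset.sum_mul]
      exact Finset.sum_congr rfl fun j _ => by ring
    have htr : H.trace = d * f D := by
      rw [hH']
      simp only [D, ite_mul, zero_mul, Finset.sum_ite_eq, Finset.mem_univ, if_true]
      rw [← Finset.mul_sum, mul_inv_cancel_left₀ hd0]
      rfl
    have hle := trace_le_of_det_sq_le H m (‖Hl‖ ^ 2 / 4) (by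
      intro t ht hpos
      -- `c` bounds the norm of `a + (t / 2) H* a` for `a` in the polar `C`, since `‖a‖ ≤ 1` and
      -- `⟨a, H a⟩ ≤ m`. Hence the deformation divided by `c` still maps the ball into the unit ball
      -- of `q`, and its determinant is at most one.
      set c := √(1 + t * m + t ^ 2 * (‖Hl‖ ^ 2 / 4))
      have hc : 0 < c := Real.sqrt_pos.2 hpos
      have hcsq : c ^ 2 = 1 + t * m + t ^ 2 * (‖Hl‖ ^ 2 / 4) := Real.sq_sqrt hpos.le
      let S := c⁻¹ • Matrix.toEuclideanLin (1 + (t / 2) • H)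
      have hS : ∀ x, S x = c⁻¹ • (x + (t / 2) • Hl x) := by
        intro x
        simp [S, Hl, map_add, Matrix.toEuclideanLin]
      have h1 := hdet S (by
        intro x
        obtain ⟨a, hax, haC⟩ := exists_inner_dominated_eq q (S x)
        rw [← hax, hS, inner_smul_right]
        have hadj : inner ℝ a (x + (t / 2) • Hl x) =
            inner ℝ (a + (t / 2) • ContinuousLinearMap.adjoint Hl a) x := by
          rw [inner_add_right, inner_add_left, inner_smul_right, real_inner_smul_left,
            ContinuousLinearMap.adjoint_inner_left]
        have ha1 := hCnorm a haC
        have hn : ‖a + (t / 2) • ContinuousLinearMap.adjoint Hl a‖ ≤ c := by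
          refine le_of_sq_le_sq ?_ hc.le
          rw [hcsq, norm_add_sq_real, inner_smul_right, norm_smul, Real.norm_eq_abs,
            abs_of_pos (by positivity : 0 < t / 2), real_inner_comm,
            ContinuousLinearMap.adjoint_inner_left, hinner]
          have h2 : f (R a) ≤ m := (hfm _ (subset_convexHull ℝ _ ⟨a, haC, rfl⟩)).le
          have h3 : ‖ContinuousLinearMap.adjoint Hl a‖ ≤ ‖Hl‖ := by
            refine ((ContinuousLinearMap.adjoint Hl).le_opNorm a).trans ?_
            rw [LinearIsometryEquiv.norm_map]
            exact mul_le_of_le_one_right (norm_nonneg _) ha1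
          have h4 : ‖a‖ ^ 2 ≤ 1 := by nlinarith [norm_nonneg a]
          have h5 : ‖ContinuousLinearMap.adjoint Hl a‖ ^ 2 ≤ ‖Hl‖ ^ 2 := by gcongr
          have h6 : t * f (R a) ≤ t * m := by gcongr
          have h7 : t ^ 2 * ‖ContinuousLinearMap.adjoint Hl a‖ ^ 2 ≤ t ^ 2 * ‖Hl‖ ^ 2 := by gcongr
          nlinarith
        rw [hadj]
        calc c⁻¹ * inner ℝ (a + (t / 2) • ContinuousLinearMap.adjoint Hl a) x
            ≤ c⁻¹ * (c * ‖x‖) := by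
              gcongr
              exact (real_inner_le_norm _ _).trans (by gcongr)
          _ = ‖x‖ := by field_simp)
      have h2 : LinearMap.det S = (c⁻¹) ^ d * (1 + (t / 2) • H).det := by
        rw [LinearMap.det_smul, det_toEuclideanLin, finrank_euclideanSpace_fin]
      rw [h2, abs_mul, abs_of_pos (by positivity), inv_pow, inv_mul_le_iff₀ (by positivity),
        mul_one] at h1
      rw [← hcsq, ← pow_mul, mul_comm, pow_mul, ← sq_abs]
      gcongr)
    -- Maximality gives `d * f D ≤ d * m`, contrary to the separation `m < f D`.
    rw [htr] at hle
    have hdpos : (0 : ℝ) < d := by positivity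
    nlinarith
  obtain ⟨ι, _, w, z, hw, hsum, hz, hD⟩ := mem_convexHull_iff_exists_fintype.1 hmem
  choose a ha haz using hz
  refine ⟨ι, inferInstance, fun i => d * w i, a, fun i => by have := hw i; positivity, ?_, ha, ?_⟩
  · rw [← Finset.mul_sum, hsum, mul_one]
  · intro x
    ext k
    have hk : ∀ j, ∑ i, w i * (a i k * a i j) = if k = j then (d : ℝ)⁻¹ else 0 := by
      intro j
      have h1 := congrFun (congrFun hD k) j
      simp only [← haz, R, D, Finset.sum_apply, Pi.smul_apply, smul_eq_mul] at h1
      exact h1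
    have h2 : ∀ i, (d * w i * inner ℝ (a i) x) * a i k =
        ∑ j, d * (w i * (a i k * a i j)) * x j := by
      intro i
      rw [PiLp.inner_apply, Finset.mul_sum, Finset.sum_mul]
      refine Finset.sum_congr rfl fun j _ => ?_
      simp only [RCLike.inner_apply, conj_trivial]
      ring
    simp only [WithLp.ofLp_sum, WithLp.ofLp_smul, Finset.sum_apply, Pi.smul_apply, smul_eq_mul, h2]
    rw [Finset.sum_comm]
    simp only [← Finset.sum_mul, ← Finset.mul_sum, hk]
    simp [hd0]

end Decomposition

end AreaMap

namespace AreaMap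

open Filter Topology Metric MeasureTheory

/-! ### Existence of the John ellipsoid. -/

section John

variable {V : Type u} [NormedAddCommGroup V] [NormedSpace ℝ V] {d : ℕ}

/-- The Euclidean structure for which a given linear isomorphism with `ℝᵈ` is isometric. -/
@[reducible]
def coreOfEquiv (T : EuclideanSpace ℝ (Fin d) ≃ₗ[ℝ] V) : InnerProductSpace.Core ℝ V where
  inner v w := inner ℝ (T.symm v) (T.symm w)
  conj_inner_symm v w := by simp [real_inner_comm]
  re_inner_nonneg v := by simp
  add_left v w z := by rw [map_add, inner_add_left]
  smul_left v w r := by rw [map_smul, real_inner_smul_left]; rfl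
  definite v hv := by simpa using hv

theorem inner_coreOfEquiv (T : EuclideanSpace ℝ (Fin d) ≃ₗ[ℝ] V) (x y : EuclideanSpace ℝ (Fin d)) :
    (coreOfEquiv T).inner (T x) (T y) = inner ℝ x y := by
  change inner ℝ (T.symm (T x)) (T.symm (T y)) = _
  rw [T.symm_apply_apply, T.symm_apply_apply]

/-- Orthonormal coordinates for a Euclidean structure. -/
theorem exists_orthonormal_coordinates_of_core {V : Type*} [AddCommGroup V] [Module ℝ V]
    [FiniteDimensional ℝ V] (E : InnerProductSpace.Core ℝ V) :
    ∃ T : EuclideanSpace ℝ (Fin (Module.finrank ℝ V)) ≃ₗ[ℝ] V,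
      ∀ x y, E.inner (T x) (T y) = inner ℝ x y := by
  let _ : NormedAddCommGroup V := E.toNormedAddCommGroup
  let _ : InnerProductSpace ℝ V := InnerProductSpace.ofCore E.toCore
  let b := stdOrthonormalBasis ℝ V
  exact ⟨b.repr.symm.toLinearEquiv, fun x y => b.repr.symm.inner_map_map x y⟩

theorem exists_orthonormal_coordinates [FiniteDimensional ℝ V] (E : InnerProductSpace.Core ℝ V) :
    ∃ T : EuclideanSpace ℝ (Fin (Module.finrank ℝ V)) ≃ₗ[ℝ] V,
      ∀ x y, E.inner (T x) (T y) = inner ℝ x y :=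
  exists_orthonormal_coordinates_of_core E

theorem ellipsoid_eq_image {E : InnerProductSpace.Core ℝ V}
    {T : EuclideanSpace ℝ (Fin d) ≃ₗ[ℝ] V} (hT : ∀ x y, E.inner (T x) (T y) = inner ℝ x y) :
    ellipsoid E = T '' closedBall 0 1 := by
  ext v
  obtain ⟨x, rfl⟩ := T.surjective v
  rw [T.injective.mem_set_image, mem_closedBall_zero_iff]
  change E.inner (T x) (T x) ≤ 1 ↔ _
  rw [hT, real_inner_self_eq_norm_sq, sq_le_one_iff₀ (norm_nonneg x)]

variable [FiniteDimensional ℝ V] [MeasurableSpace V] [BorelSpace V]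

/-- Volumes of ellipsoids are measured against one reference image, so that maximal volume becomes
maximal `|det S|`. -/
theorem addHaar_image_comp (T : EuclideanSpace ℝ (Fin d) ≃ₗ[ℝ] V)
    (S : EuclideanSpace ℝ (Fin d) →ₗ[ℝ] EuclideanSpace ℝ (Fin d))
    (A : Set (EuclideanSpace ℝ (Fin d))) :
    Measure.addHaar ((fun x => T (S x)) '' A) =
      ENNReal.ofReal |LinearMap.det S| * Measure.addHaar (T '' A) := by
  have h := Measure.addHaar_image_linearMap (Measure.addHaar (G := V))
    ((T : EuclideanSpace ℝ (Fin d) →ₗ[ℝ] V) ∘ₗ S ∘ₗ (T.symm : V →ₗ[ℝ] EuclideanSpace ℝ (Fin d)))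
    (T '' A)
  rw [LinearMap.det_conj, Set.image_image] at h
  simpa using h

theorem addHaar_image_closedBall_ne_zero (T : EuclideanSpace ℝ (Fin d) ≃ₗ[ℝ] V) :
    Measure.addHaar (T '' closedBall 0 1) ≠ 0 := by
  have hopen : IsOpen (T '' ball 0 1) := T.toContinuousLinearEquiv.isOpenMap _ isOpen_ball
  refine (lt_of_lt_of_le (hopen.measure_pos _ ?_)
    (measure_mono (Set.image_mono ball_subset_closedBall))).ne'
  exact Set.Nonempty.image _ (nonempty_ball.2 one_pos)

theorem addHaar_image_closedBall_ne_top (T : EuclideanSpace ℝ (Fin d) ≃ₗ[ℝ] V) :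
    Measure.addHaar (T '' closedBall 0 1) ≠ ⊤ :=
  ((isCompact_closedBall _ _).image T.toContinuousLinearEquiv.continuous).measure_ne_top

theorem continuous_seminorm (p : Seminorm ℝ V) : Continuous p := by
  rw [← continuousOn_univ]
  exact p.convexOn.continuousOn isOpen_univ

/-- An ellipsoid in a symmetric convex set can be moved to the origin. -/
theorem ellipsoid_subset_of_translate_subset (p : Seminorm ℝ V) {E : InnerProductSpace.Core ℝ V}
    {x : V} (h : (fun v => x + v) '' ellipsoid E ⊆ {v | p v ≤ 1}) :
    ellipsoid E ⊆ {v | p v ≤ 1} := by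
  obtain ⟨T, hT⟩ := exists_orthonormal_coordinates E
  rw [ellipsoid_eq_image hT] at h ⊢
  rintro _ ⟨y, hy, rfl⟩
  have h1 : p (x + T y) ≤ 1 := h ⟨_, ⟨y, hy, rfl⟩, rfl⟩
  have h2 : p (x + T (-y)) ≤ 1 := h ⟨_, ⟨-y, by simpa using hy, rfl⟩, rfl⟩
  have h3 : T y = (1 / 2 : ℝ) • ((x + T y) - (x + T (-y))) := by
    rw [map_neg, add_sub_add_left_eq_sub, sub_neg_eq_add, ← two_smul ℝ, smul_smul]
    norm_num
  change p (T y) ≤ 1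
  rw [h3, map_smul_eq_mul]
  have h4 := map_sub_le_add p (x + T y) (x + T (-y))
  rw [Real.norm_eq_abs, abs_of_pos (by norm_num : (0 : ℝ) < 1 / 2)]
  linarith

/-- The unit ball of a norm has a John ellipsoid. -/
theorem exists_isJohn (p : Seminorm ℝ V) {C : ℝ} (hC : ∀ v, p v ≤ 1 → ‖v‖ ≤ C) :
    ∃ E : InnerProductSpace.Core ℝ V, IsJohn E {v | p v ≤ 1} := by
  let F := EuclideanSpace ℝ (Fin (Module.finrank ℝ V))
  let T₀ : F ≃ₗ[ℝ] V := LinearEquiv.ofFinrankEq F V (by simp [F])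
  let q : Seminorm ℝ F := p.comp (T₀ : F →ₗ[ℝ] V)
  have hq : Continuous q := continuous_seminorm q
  let A : Set (F →L[ℝ] F) := {S | ∀ x ∈ closedBall (0 : F) 1, q (S x) ≤ 1}
  obtain ⟨C', hC'⟩ : ∃ C', ∀ x, q x ≤ 1 → ‖x‖ ≤ C' := by
    refine ⟨‖(T₀.symm.toContinuousLinearEquiv : V →L[ℝ] F)‖ * C, fun x hx => ?_⟩
    have h1 := (T₀.symm.toContinuousLinearEquiv : V →L[ℝ] F).le_opNorm (T₀ x)
    have h2 : (T₀.symm.toContinuousLinearEquiv : V →L[ℝ] F) (T₀ x) = x := T₀.symm_apply_apply x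
    rw [h2] at h1
    exact h1.trans (mul_le_mul_of_nonneg_left (hC _ hx) (norm_nonneg _))
  have hC'0 : 0 ≤ C' := (norm_nonneg _).trans (hC' 0 (by simp))
  have hA : IsCompact A := by
    refine (isCompact_closedBall (0 : F →L[ℝ] F) C').of_isClosed_subset ?_ ?_
    · have : A = ⋂ x ∈ closedBall (0 : F) 1, ({S | q (S x) ≤ 1} : Set (F →L[ℝ] F)) := by
        ext S
        simp [A]
      rw [this]
      exact isClosed_biInter fun x _ => isClosed_le (by fun_prop) continuous_const
    · intro S hS
      rw [mem_closedBall_zero_iff]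
      refine S.opNorm_le_of_unit_norm hC'0 fun x hx => hC' _ (hS x ?_)
      simp [hx]
  have hne : A.Nonempty := ⟨0, fun x _ => by simp⟩
  obtain ⟨S, hSA, hS⟩ := hA.exists_isMaxOn hne
    (f := fun S : F →L[ℝ] F => |S.det|) ContinuousLinearMap.continuous_det.abs.continuousOn
  have hdet0 : LinearMap.det (S : F →ₗ[ℝ] F) ≠ 0 := by
    -- A small multiple of the identity is a competitor with nonzero determinant, so the maximizer
    -- is invertible.
    obtain ⟨M, hM0, hM⟩ : ∃ M > 0, ∀ x ∈ closedBall (0 : F) 1, q x ≤ M := by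
      obtain ⟨M, hM⟩ := (isCompact_closedBall (0 : F) 1).bddAbove_image hq.continuousOn
      exact ⟨max M 1, by positivity, fun x hx => (hM ⟨x, hx, rfl⟩).trans (le_max_left _ _)⟩
    have h1 : M⁻¹ • ContinuousLinearMap.id ℝ F ∈ A := by
      intro x hx
      have : (M⁻¹ • ContinuousLinearMap.id ℝ F) x = M⁻¹ • x := rfl
      rw [this, map_smul_eq_mul, Real.norm_eq_abs, abs_of_pos (by positivity), inv_mul_le_iff₀ hM0,
        mul_one]
      exact hM x hx
    have h2 : |(M⁻¹ • ContinuousLinearMap.id ℝ F).det| ≤ |S.det| := hS h1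
    have h3 : (M⁻¹ • ContinuousLinearMap.id ℝ F).det = M⁻¹ ^ Module.finrank ℝ F := by
      rw [ContinuousLinearMap.det, ContinuousLinearMap.toLinearMap_smul, LinearMap.det_smul,
        ContinuousLinearMap.coe_id, LinearMap.det_id, mul_one]
    rw [h3] at h2
    intro h0
    have h4 : S.det = 0 := h0
    rw [h4, abs_zero] at h2
    have : 0 < |M⁻¹ ^ Module.finrank ℝ F| := abs_pos.2 (by positivity)
    linarith
  let T₁ : F ≃ₗ[ℝ] V := (LinearMap.equivOfDetNeZero (S : F →ₗ[ℝ] F) hdet0).trans T₀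
  have hT₁ : ∀ x, T₁ x = T₀ (S x) := fun x => rfl
  have hE₁ : ellipsoid (coreOfEquiv T₁) = (fun x => T₀ ((S : F →ₗ[ℝ] F) x)) '' closedBall 0 1 :=
    ellipsoid_eq_image (T := T₁) fun x y => inner_coreOfEquiv T₁ x y
  refine ⟨coreOfEquiv T₁, ?_, ?_⟩
  · rw [hE₁]
    rintro _ ⟨x, hx, rfl⟩
    exact hSA x hx
  · intro E' x hx
    -- Competitors with another centre may be recentred, since translation does not change the
    -- volume.
    have hsub := ellipsoid_subset_of_translate_subset p hx
    obtain ⟨T', hT'⟩ := exists_orthonormal_coordinates E'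
    let S' : F →ₗ[ℝ] F := (T₀.symm : V →ₗ[ℝ] F) ∘ₗ (T' : F →ₗ[ℝ] V)
    have hS' : ∀ y, T₀ (S' y) = T' y := fun y => by simp [S']
    have hS'A : LinearMap.toContinuousLinearMap S' ∈ A := by
      intro y hy
      have : p (T' y) ≤ 1 := hsub (by
        rw [ellipsoid_eq_image hT']
        exact ⟨y, hy, rfl⟩)
      rw [← hS'] at this
      exact this
    have hle : |LinearMap.det S'| ≤ |LinearMap.det (S : F →ₗ[ℝ] F)| := hS hS'A
    rw [Set.image_add_left, measure_preimage_add, hE₁, addHaar_image_comp, ellipsoid_eq_image hT']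
    have : T' '' closedBall 0 1 = (fun x => T₀ (S' x)) '' closedBall 0 1 := by simp only [hS']
    rw [this, addHaar_image_comp]
    gcongr

/-- The John ellipsoid of the unit ball of a norm gives a decomposition of its Euclidean structure
into squares of functionals bounded by the norm. -/
theorem IsJohn.exists_decomposition {p : Seminorm ℝ V} {E : InnerProductSpace.Core ℝ V}
    (hE : IsJohn E {v | p v ≤ 1}) {T : EuclideanSpace ℝ (Fin d) ≃ₗ[ℝ] V}
    (hT : ∀ x y, E.inner (T x) (T y) = inner ℝ x y) :
    ∃ (ι : Type) (_ : Fintype ι) (l : ι → ℝ) (a : ι → EuclideanSpace ℝ (Fin d)),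
      (∀ i, 0 ≤ l i) ∧ ∑ i, l i = d ∧ (∀ i x, inner ℝ (a i) x ≤ p (T x)) ∧
        ∀ x, ∑ i, (l i * inner ℝ (a i) x) • a i = x := by
  have hell := ellipsoid_eq_image hT
  refine exists_john_decomposition (p.comp (T : EuclideanSpace ℝ (Fin d) →ₗ[ℝ] V)) ?_ ?_
  · intro x
    rcases eq_or_ne x 0 with rfl | hx
    · simp
    have hx' : ‖x‖ ≠ 0 := norm_ne_zero_iff.2 hx
    have h1 : p (T (‖x‖⁻¹ • x)) ≤ 1 := hE.1 (by
      rw [hell]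
      exact ⟨_, by simp [norm_smul, hx'], rfl⟩)
    rw [map_smul, map_smul_eq_mul, norm_inv, norm_norm, inv_mul_le_iff₀ (by positivity),
      mul_one] at h1
    exact h1
  · intro S hS
    by_cases h0 : LinearMap.det S = 0
    · rw [h0, abs_zero]
      exact zero_le_one
    let T' := (LinearMap.equivOfDetNeZero S h0).trans T
    have hE' : ellipsoid (coreOfEquiv T') = (fun x => T (S x)) '' closedBall 0 1 :=
      ellipsoid_eq_image (T := T') fun x y => inner_coreOfEquiv T' x y
    have h1 := hE.2 (coreOfEquiv T') 0 (by
      simp only [zero_add, Set.image_id']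
      rw [hE']
      rintro _ ⟨x, hx, rfl⟩
      exact (hS x).trans (by simpa using hx))
    simp only [zero_add, Set.image_id'] at h1
    rw [hE', addHaar_image_comp, hell, mul_comm] at h1
    have h2 := (ENNReal.mul_le_iff_le_inv (addHaar_image_closedBall_ne_zero T)
      (addHaar_image_closedBall_ne_top T)).1 h1
    rw [ENNReal.inv_mul_cancel (addHaar_image_closedBall_ne_zero T)
      (addHaar_image_closedBall_ne_top T), ENNReal.ofReal_le_one] at h2
    exact h2

end John

end AreaMap

namespace AreaMap

open Filter Topology Metric MeasureTheory

/-! ### The determinant bound and the area estimate in Euclidean space. -/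

section Hadamard

variable {d : ℕ} {ι : Type*} [Fintype ι] {l : ι → ℝ} {a : ι → EuclideanSpace ℝ (Fin d)}

/-- Pairing `w` with itself gives `‖w‖² = ∑ l c ⟨a, w⟩`, and Young's inequality bounds this by half
of `∑ l c²` plus half of `∑ l ⟨a, w⟩² = ‖w‖²`. -/
theorem norm_sq_sum_smul_le (hl : ∀ i, 0 ≤ l i)
    (hid : ∀ x, ∑ i, (l i * inner ℝ (a i) x) • a i = x) (c : ι → ℝ) :
    ‖∑ i, (l i * c i) • a i‖ ^ 2 ≤ ∑ i, l i * c i ^ 2 := by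
  set w := ∑ i, (l i * c i) • a i with hw
  have h1 : ‖w‖ ^ 2 = ∑ i, l i * c i * inner ℝ (a i) w := by
    rw [← real_inner_self_eq_norm_sq]
    conv_lhs => rw [hw, sum_inner]
    exact Finset.sum_congr rfl fun i _ => real_inner_smul_left _ _ _
  have h2 : ‖w‖ ^ 2 = ∑ i, l i * inner ℝ (a i) w ^ 2 := by
    rw [← real_inner_self_eq_norm_sq]
    conv_lhs => rw [← hid w, sum_inner]
    rw [hid w]
    refine Finset.sum_congr rfl fun i _ => ?_
    rw [real_inner_smul_left]
    ring
  have h3 : ∑ i, l i * c i * inner ℝ (a i) w ≤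
      ∑ i, (l i * c i ^ 2 + l i * inner ℝ (a i) w ^ 2) / 2 := by
    refine Finset.sum_le_sum fun i _ => ?_
    have := mul_nonneg (hl i) (sq_nonneg (c i - inner ℝ (a i) w))
    nlinarith
  rw [← Finset.sum_div, Finset.sum_add_distrib, ← h1, ← h2] at h3
  linarith

/-- Hadamard's inequality for linear maps. -/
theorem abs_det_le_prod_norm (D : EuclideanSpace ℝ (Fin d) →ₗ[ℝ] EuclideanSpace ℝ (Fin d)) :
    |LinearMap.det D| ≤ ∏ j, ‖D (EuclideanSpace.basisFun (Fin d) ℝ j)‖ := by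
  let b := EuclideanSpace.basisFun (Fin d) ℝ
  have : Fact (Module.finrank ℝ (EuclideanSpace ℝ (Fin d)) = d) := ⟨by simp⟩
  have h1 := b.toBasis.orientation.abs_volumeForm_apply_le fun j => D (b j)
  rw [Orientation.volumeForm_robust' _ b] at h1
  have h2 := b.toBasis.det_comp D b
  rw [← b.coe_toBasis, Module.Basis.det_self, mul_one] at h2
  rw [← h2]
  exact h1

/-- A product of nonnegative numbers with mean at most one is at most one. -/
theorem prod_le_one_of_sum_le_card {ι : Type*} (s : Finset ι) (x : ι → ℝ) (hx : ∀ j ∈ s, 0 ≤ x j)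
    (h : ∑ j ∈ s, x j ≤ s.card) : ∏ j ∈ s, x j ≤ 1 := by
  calc ∏ j ∈ s, x j ≤ ∏ j ∈ s, Real.exp (x j - 1) :=
        Finset.prod_le_prod hx fun j _ => by linarith [Real.add_one_le_exp (x j - 1)]
    _ = Real.exp (∑ j ∈ s, (x j - 1)) := (Real.exp_sum _ _).symm
    _ ≤ 1 := by
      rw [Real.exp_le_one_iff, Finset.sum_sub_distrib]
      simpa using h

/-- By `norm_sq_sum_smul_le`, the squared lengths of the columns of `D` add up to at most `∑ lᵢ
‖wᵢ‖² ≤ d K²`. Hadamard's inequality and the inequality of the means finish. -/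
theorem abs_det_sum_le (hl : ∀ i, 0 ≤ l i) (hsum : ∑ i, l i = d)
    (hid : ∀ x, ∑ i, (l i * inner ℝ (a i) x) • a i = x) {K : ℝ} (hK : 0 < K)
    (w : ι → EuclideanSpace ℝ (Fin d) →L[ℝ] ℝ) (hw : ∀ i, ‖w i‖ ≤ K)
    (D : EuclideanSpace ℝ (Fin d) →ₗ[ℝ] EuclideanSpace ℝ (Fin d))
    (hD : ∀ x, D x = ∑ i, (l i * w i x) • a i) : |LinearMap.det D| ≤ K ^ d := by
  let b := EuclideanSpace.basisFun (Fin d) ℝ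
  have h1 : ∀ i, ∑ j, w i (b j) ^ 2 ≤ K ^ 2 := by
    intro i
    let v := (InnerProductSpace.toDual ℝ (EuclideanSpace ℝ (Fin d))).symm (w i)
    have hv : ∀ j, w i (b j) = inner ℝ v (b j) := fun j =>
      (InnerProductSpace.toDual_symm_apply).symm
    simp only [hv]
    rw [b.sum_sq_inner_left, LinearIsometryEquiv.norm_map]
    have := hw i
    gcongr
  have h2 : ∑ j, ‖D (b j)‖ ^ 2 ≤ d * K ^ 2 := by
    calc ∑ j, ‖D (b j)‖ ^ 2 ≤ ∑ j, ∑ i, l i * w i (b j) ^ 2 :=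
          Finset.sum_le_sum fun j _ => by
            rw [hD]
            exact norm_sq_sum_smul_le hl hid _
      _ = ∑ i, l i * ∑ j, w i (b j) ^ 2 := by
          rw [Finset.sum_comm]
          simp only [Finset.mul_sum]
      _ ≤ ∑ i, l i * K ^ 2 :=
          Finset.sum_le_sum fun i _ => mul_le_mul_of_nonneg_left (h1 i) (hl i)
      _ = d * K ^ 2 := by rw [← Finset.sum_mul, hsum]
  have h3 : ∏ j, (‖D (b j)‖ / K) ^ 2 ≤ 1 := by
    refine prod_le_one_of_sum_le_card _ _ (fun j _ => sq_nonneg _) ?_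
    simp only [div_pow]
    rw [← Finset.sum_div, div_le_iff₀ (by positivity)]
    simpa using h2
  rw [Finset.prod_pow, Finset.prod_div_distrib, Finset.prod_const, Finset.card_univ,
    Fintype.card_fin, sq_le_one_iff₀ (by positivity), div_le_one (by positivity)] at h3
  exact (abs_det_le_prod_norm D).trans h3

/-- The area estimate for maps to `ℝᵈ` whose components along John's decomposition are
Lipschitz. -/
theorem hausdorffMeasure_image_le_of_components (hl : ∀ i, 0 ≤ l i) (hsum : ∑ i, l i = d)
    (hid : ∀ x, ∑ i, (l i * inner ℝ (a i) x) • a i = x) {K : ℝ≥0} (hK : 0 < K)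
    {v : ι → EuclideanSpace ℝ (Fin d) → ℝ} (hv : ∀ i, LipschitzWith K (v i))
    (S : Set (EuclideanSpace ℝ (Fin d))) :
    μH[d] ((fun y => ∑ i, (l i * v i y) • a i) '' S) ≤ (K : ℝ≥0∞) ^ d * μH[d] S := by
  set Φ : EuclideanSpace ℝ (Fin d) → EuclideanSpace ℝ (Fin d) :=
    fun y => ∑ i, (l i * v i y) • a i with hΦ
  obtain ⟨K', hK'⟩ : ∃ K', LipschitzWith K' Φ := by
    have : ∀ t : Finset ι, ∃ K', LipschitzWith K' fun y => ∑ i ∈ t, (l i * v i y) • a i := by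
      classical
      intro t
      induction t using Finset.induction_on with
      | empty => exact ⟨0, by simp⟩
      | insert i t hi ih =>
        obtain ⟨K', hK'⟩ := ih
        simp only [Finset.sum_insert hi]
        have h1 : LipschitzWith (‖(LinearMap.toSpanSingleton ℝ _ (a i)).toContinuousLinearMap‖₊ *
            (‖l i‖₊ * K)) fun y => (l i * v i y) • a i :=
          (LinearMap.toSpanSingleton ℝ _ (a i)).toContinuousLinearMap.lipschitz.comp
            ((lipschitzWith_smul (l i)).comp (hv i))
        exact ⟨_, h1.add hK'⟩
    exact this Finset.univ
  -- The area inequality needs a measurable set, while `S` is arbitrary; a measurable hull has the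
  -- same measure.
  let M := toMeasurable (μH[d] : Measure (EuclideanSpace ℝ (Fin d))) S
  -- By Rademacher's theorem the complement of `R` is null, and the Lipschitz map `Φ` sends it to a
  -- null set.
  let R : Set (EuclideanSpace ℝ (Fin d)) := {y | ∀ i, DifferentiableAt ℝ (v i) y}
  have hRm : MeasurableSet R := by
    have : R = ⋂ i, {y | DifferentiableAt ℝ (v i) y} := by
      ext y
      simp [R]
    rw [this]
    exact MeasurableSet.iInter fun i => measurableSet_of_differentiableAt ℝ (v i)
  have hR0 : (μH[d] : Measure (EuclideanSpace ℝ (Fin d))) Rᶜ = 0 := by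
    have : ∀ᵐ y ∂(μH[d] : Measure (EuclideanSpace ℝ (Fin d))), y ∈ R :=
      ae_all_iff.2 fun i => (hv i).ae_differentiableAt
    exact this
  have hnull : μH[d] (Φ '' Rᶜ) = 0 := by
    have := hK'.hausdorffMeasure_image_le (d := d) (Nat.cast_nonneg d) Rᶜ
    rw [hR0, mul_zero] at this
    exact le_antisymm this zero_le
  have hmain : μH[d] (Φ '' (M ∩ R)) ≤ (K : ℝ≥0∞) ^ d * μH[d] (M ∩ R) := by
    have hder : ∀ y ∈ M ∩ R, HasFDerivWithinAt Φ
        (∑ i, (l i • fderiv ℝ (v i) y).smulRight (a i)) (M ∩ R) y := by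
      intro y hy
      refine HasFDerivAt.hasFDerivWithinAt ?_
      refine HasFDerivAt.fun_sum fun i _ => ?_
      exact ((hy.2 i).hasFDerivAt.const_mul (l i)).smul_const (a i)
    refine (addHaar_image_le_lintegral_abs_det_fderiv μH[d]
      ((measurableSet_toMeasurable _ _).inter hRm) hder).trans ?_
    calc _ ≤ ∫⁻ _ in M ∩ R, (K : ℝ≥0∞) ^ d ∂μH[d] := by
          refine lintegral_mono fun y => ?_
          rw [← ENNReal.ofReal_coe_nnreal, ← ENNReal.ofReal_pow (NNReal.coe_nonneg K)]
          refine ENNReal.ofReal_le_ofReal ?_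
          refine abs_det_sum_le hl hsum hid (K := K) hK (fun i => fderiv ℝ (v i) y)
            (fun i => norm_fderiv_le_of_lipschitz ℝ (hv i)) _ fun x => ?_
          simp
      _ = _ := setLIntegral_const _ _
  calc μH[d] (Φ '' S) ≤ μH[d] (Φ '' (M ∩ R) ∪ Φ '' Rᶜ) := by
        refine measure_mono ?_
        rw [← Set.image_union]
        refine Set.image_mono fun y hy => ?_
        by_cases h : y ∈ R
        · exact .inl ⟨subset_toMeasurable _ _ hy, h⟩
        · exact .inr h
    _ ≤ μH[d] (Φ '' (M ∩ R)) + μH[d] (Φ '' Rᶜ) := measure_union_le _ _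
    _ ≤ (K : ℝ≥0∞) ^ d * μH[d] (M ∩ R) := by
        rw [hnull, add_zero]
        exact hmain
    _ ≤ (K : ℝ≥0∞) ^ d * μH[d] M := by
        gcongr
        exact Set.inter_subset_left
    _ = (K : ℝ≥0∞) ^ d * μH[d] S := by rw [measure_toMeasurable]

end Hadamard

/-! ### From local to global estimates. -/

section Localization

/-- An estimate of the measure of images that holds locally holds globally. -/
theorem measure_image_le_of_local {X Z : Type*} [TopologicalSpace X] [SecondCountableTopology X]
    [MeasurableSpace X] [BorelSpace X] [MeasurableSpace Z] (μ : Measure X) (ν : Measure Z)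
    (f : X → Z) (Y : Set X) (c : ℝ≥0∞)
    (h : ∀ y ∈ Y, ∃ U, IsOpen U ∧ y ∈ U ∧ ∀ S ⊆ Y ∩ U, ν (f '' S) ≤ c * μ S) :
    ν (f '' Y) ≤ c * μ Y := by
  rcases Y.eq_empty_or_nonempty with rfl | hne
  · simp
  choose! U hUo hUy hU using h
  obtain ⟨t, htY, htc, hcov⟩ := TopologicalSpace.countable_cover_nhdsWithin (f := U) (s := Y)
    fun y hy => mem_nhdsWithin_of_mem_nhds ((hUo y hy).mem_nhds (hUy y hy))
  have htne : t.Nonempty := by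
    obtain ⟨y, hy⟩ := hne
    obtain ⟨x, hx, -⟩ := Set.mem_iUnion₂.1 (hcov hy)
    exact ⟨x, hx⟩
  obtain ⟨x, rfl⟩ := htc.exists_eq_range htne
  have hxY : ∀ k, x k ∈ Y := fun k => htY ⟨k, rfl⟩
  -- The disjoint pieces are measurable even if `Y` is not, so the restriction of `μ` to `Y` is
  -- additive over them.
  let D : ℕ → Set X := disjointed fun k => U (x k)
  have hDm : ∀ k, MeasurableSet (D k) :=
    MeasurableSet.disjointed fun k => (hUo _ (hxY k)).measurableSet
  have hDU : ∀ k, D k ⊆ U (x k) := fun k => disjointed_subset _ k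
  have hDcov : Y ⊆ ⋃ k, D k := by
    rw [iUnion_disjointed]
    simpa using hcov
  calc ν (f '' Y) ≤ ν (⋃ k, f '' (Y ∩ D k)) := by
        refine measure_mono ?_
        rw [← Set.image_iUnion, ← Set.inter_iUnion]
        exact Set.image_mono fun y hy => ⟨hy, hDcov hy⟩
    _ ≤ ∑' k, ν (f '' (Y ∩ D k)) := measure_iUnion_le _
    _ ≤ ∑' k, c * μ (Y ∩ D k) := ENNReal.tsum_le_tsum fun k =>
        hU _ (hxY k) _ (Set.inter_subset_inter_right _ (hDU k))
    _ = c * ∑' k, μ.restrict Y (D k) := by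
        rw [ENNReal.tsum_mul_left]
        congr 1
        exact tsum_congr fun k => by rw [Measure.restrict_apply (hDm k), Set.inter_comm]
    _ = c * μ.restrict Y (⋃ k, D k) := by
        rw [measure_iUnion (disjoint_disjointed _) hDm]
    _ ≤ c * μ Y := by
        refine mul_le_mul_right ?_ c
        exact (measure_mono (Set.subset_univ _)).trans_eq (Measure.restrict_apply_univ Y)

/-- A map from a compact space that is Lipschitz locally with a uniform constant is Lipschitz. -/
theorem exists_lipschitzWith_of_local {X Z : Type*} [PseudoEMetricSpace X] [CompactSpace X]
    [PseudoMetricSpace Z] (f : X → Z) (K : ℝ≥0)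
    (h : ∀ x, ∃ ρ > 0, ∀ y ∈ eball x ρ, ∀ z ∈ eball x ρ, edist (f y) (f z) ≤ K * edist y z) :
    ∃ K' : ℝ≥0, LipschitzWith K' f := by
  choose ρ hρ hf using h
  have hcont : Continuous f := by
    rw [continuous_iff_continuousAt]
    intro x
    have : LipschitzOnWith K f (eball x (ρ x)) := hf x
    exact this.continuousOn.continuousAt (eball_mem_nhds x (hρ x))
  obtain ⟨δ, hδ, hleb⟩ := lebesgue_number_lemma_of_emetric_nhds (isCompact_univ (X := X))
    (c := fun x => eball x (ρ x)) fun x _ => eball_mem_nhds x (hρ x)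
  have hbdd : Bornology.IsBounded (Set.range f) := (isCompact_range hcont).isBounded
  set M := Metric.ediam (Set.range f)
  have hM : M ≠ ⊤ := hbdd.ediam_ne_top
  have hMδ : M / min δ 1 ≠ ⊤ := ENNReal.div_ne_top hM (lt_min hδ one_pos).ne'
  refine ⟨max K (M / min δ 1).toNNReal, fun y z => ?_⟩
  rcases lt_or_ge (edist y z) δ with hlt | hge
  · obtain ⟨x, hx⟩ := hleb y trivial
    refine (hf x y (hx (mem_eball_self hδ)) z (hx (by rwa [mem_eball']))).trans ?_
    gcongr
    exact le_max_left _ _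
  · calc edist (f y) (f z) ≤ M := Metric.edist_le_ediam_of_mem ⟨y, rfl⟩ ⟨z, rfl⟩
      _ = M / min δ 1 * min δ 1 := (ENNReal.div_mul_cancel (lt_min hδ one_pos).ne'
          (ne_top_of_le_ne_top ENNReal.one_ne_top (min_le_right _ _))).symm
      _ = (M / min δ 1).toNNReal * min δ 1 := by rw [ENNReal.coe_toNNReal hMδ]
      _ ≤ _ := by
        gcongr
        · exact le_max_right _ _
        · exact (min_le_left _ _).trans hge

end Localization

end AreaMap

namespace AreaMap

open Filter Topology Metric MeasureTheory

/-! ### The area estimate on a submanifold. -/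

section ChartArea

/-- The area estimate in a chart, for a set that the chart maps into a `d`-dimensional subspace. -/
theorem hausdorffMeasure_image_le_of_chart {n d : ℕ} {ι : Type*} [Fintype ι] {l : ι → ℝ}
    {a : ι → EuclideanSpace ℝ (Fin d)} (hl : ∀ i, 0 ≤ l i) (hsum : ∑ i, l i = d)
    (hid : ∀ x, ∑ i, (l i * inner ℝ (a i) x) • a i = x) {X Z : Type*} [EMetricSpace X]
    [MeasurableSpace X] [BorelSpace X] [EMetricSpace Z] [MeasurableSpace Z] [BorelSpace Z]
    {K : ℝ≥0} (hK : 0 < K) {Q : EuclideanSpace ℝ (Fin d) → Z} (hQ : LipschitzWith 1 Q)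
    {h : X → EuclideanSpace ℝ (Fin n)} {S : Set X} (hh : LipschitzOnWith K h S)
    {u : ι → X → ℝ} (hu : ∀ i, ∀ x ∈ S, ∀ z ∈ S, |u i x - u i z| ≤ K * dist (h x) (h z))
    {A : X → Z} (hA : ∀ x ∈ S, A x = Q (∑ i, (l i * u i x) • a i))
    (W : Submodule ℝ (EuclideanSpace ℝ (Fin n))) (hW : Module.finrank ℝ W = d)
    (hSW : ∀ x ∈ S, h x ∈ W) :
    μH[d] (A '' S) ≤ (K : ℝ≥0∞) ^ d * ((K : ℝ≥0∞) ^ d * μH[d] S) := by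
  let J : EuclideanSpace ℝ (Fin d) ≃ₗᵢ[ℝ] W :=
    ((stdOrthonormalBasis ℝ W).reindex (finCongr hW)).repr.symm
  let J' : EuclideanSpace ℝ (Fin d) → EuclideanSpace ℝ (Fin n) := fun y => J y
  have hJ' : Isometry J' := isometry_subtype_coe.comp J.isometry
  -- On `S` the function `u i` factors through `h`; McShane's extension then gives a Lipschitz
  -- function on the whole model space with the same constant.
  have hext : ∀ i, ∃ v : EuclideanSpace ℝ (Fin n) → ℝ, LipschitzWith K v ∧
      ∀ x ∈ S, v (h x) = u i x := by
    intro i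
    have huh : ∀ x ∈ S, ∀ z ∈ S, h x = h z → u i x = u i z := by
      intro x hx z hz hxz
      have := hu i x hx z hz
      rw [hxz, dist_self, mul_zero] at this
      exact sub_eq_zero.1 (abs_nonpos_iff.1 this)
    rcases isEmpty_or_nonempty X with hX | hX
    · exact ⟨0, LipschitzWith.const' 0, fun x => (hX.false x).elim⟩
    have hinv : ∀ w ∈ h '' S, Function.invFunOn h S w ∈ S ∧ h (Function.invFunOn h S w) = w :=
      fun w hw => Function.invFunOn_pos hw
    obtain ⟨v, hv, hvu⟩ := LipschitzOnWith.extend_real (K := K) (s := h '' S)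
      (f := fun w => u i (Function.invFunOn h S w)) (LipschitzOnWith.of_dist_le_mul
        fun w hw w' hw' => by
          have := hu i _ (hinv w hw).1 _ (hinv w' hw').1
          rwa [(hinv w hw).2, (hinv w' hw').2] at this)
    refine ⟨v, hv, fun x hx => ?_⟩
    have hxS : h x ∈ h '' S := ⟨x, hx, rfl⟩
    rw [← hvu hxS]
    exact huh _ (hinv _ hxS).1 _ hx (hinv _ hxS).2
  choose v hvK hv using hext
  let Φ : EuclideanSpace ℝ (Fin d) → EuclideanSpace ℝ (Fin d) :=
    fun y => ∑ i, (l i * (v i ∘ J') y) • a i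
  let S' : Set (EuclideanSpace ℝ (Fin d)) := J' ⁻¹' (h '' S)
  have himg : A '' S ⊆ Q '' (Φ '' S') := by
    rintro _ ⟨x, hx, rfl⟩
    have hJx : J' (J.symm ⟨h x, hSW x hx⟩) = h x := by simp [J']
    refine ⟨_, ⟨J.symm ⟨h x, hSW x hx⟩, ⟨x, hx, hJx.symm⟩, rfl⟩, ?_⟩
    rw [hA x hx]
    congr 1
    refine Finset.sum_congr rfl fun i _ => ?_
    rw [Function.comp_apply, hJx, hv i x hx]
  calc μH[d] (A '' S) ≤ μH[d] (Q '' (Φ '' S')) := measure_mono himg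
    _ ≤ μH[d] (Φ '' S') := by
      have := hQ.hausdorffMeasure_image_le (d := d) (Nat.cast_nonneg d) (Φ '' S')
      rwa [ENNReal.coe_one, ENNReal.one_rpow, one_mul] at this
    _ ≤ (K : ℝ≥0∞) ^ d * μH[d] S' := by
      refine hausdorffMeasure_image_le_of_components hl hsum hid hK (fun i => ?_) S'
      have := (hvK i).comp hJ'.lipschitz
      rwa [mul_one] at this
    _ = (K : ℝ≥0∞) ^ d * μH[d] (J' '' S') := by
      rw [hJ'.hausdorffMeasure_image (.inl (Nat.cast_nonneg d))]
    _ ≤ (K : ℝ≥0∞) ^ d * μH[d] (h '' S) := by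
      gcongr
      exact Set.image_preimage_subset _ _
    _ ≤ (K : ℝ≥0∞) ^ d * ((K : ℝ≥0∞) ^ d * μH[d] S) := by
      gcongr
      have := hh.hausdorffMeasure_image_le (d := d) (Nat.cast_nonneg d)
      rwa [ENNReal.rpow_natCast] at this

end ChartArea

section FlatCoordinates

variable {V : Type u} [NormedAddCommGroup V] [NormedSpace ℝ V] [FiniteDimensional ℝ V]
  (Γ : Submodule ℤ V) [DiscreteTopology Γ] {d : ℕ}

theorem lipschitzWith_toFlat {E : InnerProductSpace.Core ℝ V}
    {T : EuclideanSpace ℝ (Fin d) ≃ₗ[ℝ] V} (hT : ∀ x y, E.inner (T x) (T y) = inner ℝ x y) :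
    LipschitzWith 1 fun y => toFlat E Γ (torusMk Γ (T y)) := by
  refine LipschitzWith.of_dist_le_mul fun x y => ?_
  rw [dist_toFlat, NNReal.coe_one, one_mul, dist_eq_norm]
  refine (ciInf_le ⟨0, ?_⟩ (0 : Γ)).trans_eq ?_
  · rintro _ ⟨γ, rfl⟩
    exact Real.sqrt_nonneg _
  · rw [Submodule.coe_zero, sub_zero, ← map_sub, hT, real_inner_self_eq_norm_sq,
      Real.sqrt_sq (norm_nonneg _)]

end FlatCoordinates

/-! ### The area-nonexpanding map. -/

section Map

variable {V : Type u} [NormedAddCommGroup V] [NormedSpace ℝ V] [FiniteDimensional ℝ V]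
  (Γ : Submodule ℤ V) [DiscreteTopology Γ] {n : ℕ} {X : Type u} [EMetricSpace X]
  [ChartedSpace (EuclideanSpace ℝ (Fin n)) X]
  [Bundle.RiemannianBundle (fun x : X => TangentSpace (𝓡 n) x)]
  [IsManifold (𝓡 n) ∞ X]
  [IsContMDiffRiemannianBundle (𝓡 n) ∞ (EuclideanSpace ℝ (Fin n))
      (fun x : X => TangentSpace (𝓡 n) x)]
  [IsRiemannianManifold (𝓡 n) X]

variable (n) in
/-- The function `g` calibrates the functional `f`: the closed `1`-form `dg + f` has norm at
most one. -/
def IsCalibration (ψ : C(X, V ⧸ Γ)) (f : V →ₗ[ℝ] ℝ) (g : X → ℝ) : Prop :=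
  ∀ (s : C(I, X)) (K : ℝ≥0), LipschitzWith K s → pathLength n s ≠ ⊤ →
    |g (s 1) - g (s 0) + f (disp Γ (ψ.comp s))| ≤ (pathLength n s).toReal

/-- The calibration inequality is applied to the preimage of a chart segment, whose length is at
most `1 + ε` times that of the segment. -/
theorem IsCalibration.abs_sub_le {ψ : C(X, V ⧸ Γ)} {f : V →ₗ[ℝ] ℝ} {g : X → ℝ}
    (hg : IsCalibration Γ n ψ f g) {ε : ℝ} (hε : 0 ≤ ε)
    {h : OpenPartialHomeomorph X (EuclideanSpace ℝ (Fin n))}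
    (hh : IsAlmostIsometricChart n ε h) (hc : Convex ℝ h.target) {τ : X → V}
    (hτ : ContinuousOn τ h.source) (hlift : ∀ t ∈ h.source, torusMk Γ (τ t) = ψ t)
    {x z : X} (hx : x ∈ h.source) (hz : z ∈ h.source) :
    |(g z + f (τ z)) - (g x + f (τ x))| ≤ (1 + ε) * ‖h x - h z‖ := by
  obtain ⟨s, rfl, rfl, hsrc, hK, hl⟩ := hh.exists_path hc hx hz
  have h1 := hg s _ hK (ne_top_of_le_ne_top ENNReal.ofReal_ne_top hl)
  have h2 := ENNReal.toReal_mono ENNReal.ofReal_ne_top hl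
  rw [ENNReal.toReal_ofReal (by positivity)] at h2
  rw [disp_comp_eq_of_lift Γ ψ hτ hlift hsrc, map_sub] at h1
  refine le_trans (le_of_eq ?_) (h1.trans h2)
  congr 1
  ring

theorem IsCalibration.continuous {ψ : C(X, V ⧸ Γ)} {f : V →ₗ[ℝ] ℝ} {g : X → ℝ}
    (hg : IsCalibration Γ n ψ f g) : Continuous g := by
  rw [continuous_iff_continuousAt]
  intro x
  obtain ⟨h, hx, hc, hh⟩ := exists_almostIsometricChart_at n x one_pos
  obtain ⟨τ, hτ, hlift⟩ := exists_lift_chart Γ ψ h hc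
  have hsrc := h.open_source.mem_nhds hx
  have hfτ : ContinuousAt (fun z => f (τ z)) x :=
    f.continuous_of_finiteDimensional.continuousAt.comp (hτ.continuousAt hsrc)
  have hu : ContinuousAt (fun z => g z + f (τ z)) x := by
    rw [ContinuousAt, tendsto_iff_dist_tendsto_zero]
    have h0 : Tendsto (fun z => (1 + 1) * ‖h x - h z‖) (𝓝 x) (𝓝 0) := by
      have : ContinuousAt (fun z => (1 + 1) * ‖h x - h z‖) x :=
        ((continuousAt_const.sub (h.continuousAt hx)).norm).const_mul _
      simpa [ContinuousAt] using this
    refine squeeze_zero' (.of_forall fun z => dist_nonneg) ?_ h0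
    filter_upwards [hsrc] with z hz
    exact hg.abs_sub_le Γ zero_le_one hh hc hτ hlift hx hz
  refine (hu.sub hfτ).congr (.of_forall fun z => ?_)
  simp

variable [CompactSpace X] [PreconnectedSpace X] [Nonempty X] [MeasurableSpace X] [BorelSpace X]
  [MeasurableSpace V] [BorelSpace V]

/-- The area-nonexpanding map. -/
theorem exists_areaNonexpanding (ψ : C(X, V ⧸ Γ)) {p : Seminorm ℝ V}
    (hp : ∀ v, relStableNorm n Γ ψ v = ENNReal.ofReal (p v)) {E : InnerProductSpace.Core ℝ V}
    (hE : IsJohn E {v | p v ≤ 1}) {d : ℕ} {T : EuclideanSpace ℝ (Fin d) ≃ₗ[ℝ] V}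
    (hT : ∀ x y, E.inner (T x) (T y) = inner ℝ x y) :
    ∃ G : C(X, V), (∃ K : ℝ≥0, LipschitzWith K fun x =>
        toFlat E Γ ((ψ + (torusMk Γ).comp G) x)) ∧
      AreaNonexpanding n d fun x =>
        toFlat E Γ ((ψ + (torusMk Γ).comp G) x) := by
  obtain ⟨x₀⟩ := ‹Nonempty X›
  obtain ⟨ι, _, l, a, hl, hsum, hap, hid⟩ := hE.exists_decomposition hT
  let f : ι → V →ₗ[ℝ] ℝ := fun i =>
    (innerₗ (EuclideanSpace ℝ (Fin d)) (a i)) ∘ₗ (T.symm : V →ₗ[ℝ] EuclideanSpace ℝ (Fin d))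
  have hf : ∀ i v, f i v = inner ℝ (a i) (T.symm v) := fun i v => rfl
  have hcal : ∀ i, ∃ g, IsCalibration Γ n ψ (f i) g := by
    intro i
    refine exists_calibration Γ ψ (f i) (fun v => ?_) x₀
    rw [hp]
    refine ENNReal.ofReal_le_ofReal ?_
    have := hap i (T.symm v)
    rwa [T.apply_symm_apply] at this
  choose g hg using hcal
  let G : C(X, V) := ⟨fun x => T (∑ i, (l i * g i x) • a i), by
    refine T.toContinuousLinearEquiv.continuous.comp ?_
    have := fun i => (hg i).continuous
    fun_prop⟩
  let Q : EuclideanSpace ℝ (Fin d) → FlatTorus E Γ := fun y => toFlat E Γ (torusMk Γ (T y))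
  have hQ : LipschitzWith 1 Q := lipschitzWith_toFlat Γ hT
  set A : X → FlatTorus E Γ := fun x => toFlat E Γ ((ψ + (torusMk Γ).comp G) x) with hA
  -- The decomposition of the identity, applied to the lift `τ`, merges it with the translation:
  -- locally the map has components `gᵢ + fᵢ ∘ τ`, which are nearly 1-Lipschitz.
  have hrep : ∀ {D : Set X} {τ : X → V}, (∀ t ∈ D, torusMk Γ (τ t) = ψ t) → ∀ x ∈ D,
      A x = Q (∑ i, (l i * (g i x + f i (τ x))) • a i) := by
    intro D τ hlift x hx
    have h1 : ∑ i, (l i * (g i x + f i (τ x))) • a i = ∑ i, (l i * g i x) • a i + T.symm (τ x) := by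
      conv_rhs => rw [← hid (T.symm (τ x)), ← Finset.sum_add_distrib]
      refine Finset.sum_congr rfl fun i _ => ?_
      rw [← add_smul, mul_add, hf]
    simp only [Q, A]
    rw [h1, map_add, T.apply_symm_apply, torusMk_add, hlift x hx]
    exact congrArg (toFlat E Γ) (add_comm _ _)
  refine ⟨G, ?_, ?_⟩
  · refine exists_lipschitzWith_of_local A
      (Real.toNNReal ((∑ i, l i * ‖a i‖) * (1 + 1)) * Real.toNNReal (1 + 1)) fun x => ?_
    obtain ⟨h, hx, hc, hh⟩ := exists_almostIsometricChart_at n x one_pos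
    obtain ⟨τ, hτ, hlift⟩ := exists_lift_chart Γ ψ h hc
    obtain ⟨ρ, hρ, hsub, hρl⟩ := hh.eventually_edist_le zero_le_one hx
    refine ⟨ρ, hρ, fun y hy z hz => ?_⟩
    rw [hrep hlift y (hsub hy), hrep hlift z (hsub hz)]
    refine (hQ _ _).trans ?_
    rw [ENNReal.coe_one, one_mul, ENNReal.coe_mul, mul_assoc]
    have h1 : dist (∑ i, (l i * (g i y + f i (τ y))) • a i)
        (∑ i, (l i * (g i z + f i (τ z))) • a i) ≤
          (∑ i, l i * ‖a i‖) * (1 + 1) * dist (h y) (h z) := by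
      rw [dist_eq_norm, ← Finset.sum_sub_distrib, Finset.sum_mul, Finset.sum_mul]
      refine (norm_sum_le _ _).trans (Finset.sum_le_sum fun i _ => ?_)
      rw [← sub_smul, ← mul_sub, norm_smul, norm_mul, Real.norm_eq_abs, abs_of_nonneg (hl i),
        Real.norm_eq_abs]
      have h2 := (hg i).abs_sub_le Γ zero_le_one hh hc hτ hlift (hsub hz) (hsub hy)
      rw [dist_comm, dist_eq_norm]
      have h3 := mul_le_mul_of_nonneg_left h2 (mul_nonneg (hl i) (norm_nonneg (a i)))
      linarith
    refine le_trans ?_ (mul_le_mul_right (hρl y hy z hz) _)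
    rw [edist_dist, edist_dist]
    refine (ENNReal.ofReal_le_ofReal h1).trans_eq ?_
    refine ENNReal.ofReal_mul ?_
    have : ∀ i, 0 ≤ l i * ‖a i‖ := fun i => mul_nonneg (hl i) (norm_nonneg _)
    exact mul_nonneg (Finset.sum_nonneg fun i _ => this i) (by norm_num)
  · intro Y hY
    change μH[d] (A '' Y) ≤ μH[d] Y
    -- One factor `(1 + ε) ^ d` comes from the Lipschitz constant of the components in the chart,
    -- the other from the chart itself.
    have key : ∀ ε : ℝ, 0 < ε →
        μH[d] (A '' Y) ≤ ENNReal.ofReal ((1 + ε) ^ d * (1 + ε) ^ d) * μH[d] Y := by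
      intro ε hε
      refine measure_image_le_of_local _ _ A Y _ fun y hy => ?_
      obtain ⟨e, he, hye, W, hW, hWY⟩ := hY y hy
      have he1 : e ∈ IsManifold.maximalAtlas (𝓡 n) 1 X :=
        IsManifold.maximalAtlas_subset_of_le (by simp) he
      have hM : IsManifold (𝓡 n) 1 X := IsManifold.of_le (n := ∞) (by simp)
      obtain ⟨T', h, hyh, hhe, hhT, hc, hh⟩ := exists_almostIsometricChart n e he1 hye hε
      obtain ⟨τ, hτ, hlift⟩ := exists_lift_chart Γ ψ h hc
      obtain ⟨ρ, hρ, hsub, hρl⟩ := hh.eventually_edist_le hε.le hyh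
      refine ⟨eball y ρ, isOpen_eball, mem_eball_self hρ, fun S hS => ?_⟩
      have hK : (Real.toNNReal (1 + ε) : ℝ) = 1 + ε := Real.coe_toNNReal _ (by linarith)
      have hsrc : ∀ x ∈ S, x ∈ h.source := fun x hx => hsub (hS hx).2
      have := hausdorffMeasure_image_le_of_chart hl hsum hid
        (K := Real.toNNReal (1 + ε)) (Real.toNNReal_pos.2 (by linarith)) hQ (h := h) (S := S)
        (fun x hx z hz => hρl x (hS hx).2 z (hS hz).2)
        (u := fun i x => g i x + f i (τ x)) (fun i x hx z hz => by
          rw [hK, dist_comm, dist_eq_norm]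
          exact (hg i).abs_sub_le Γ hε.le hh hc hτ hlift (hsrc z hz) (hsrc x hx))
        (fun x hx => hrep hlift x (hsrc x hx))
        (W.map (T'.toLinearEquiv : EuclideanSpace ℝ (Fin n) →ₗ[ℝ] EuclideanSpace ℝ (Fin n)))
        ((LinearEquiv.finrank_map_eq T'.toLinearEquiv W).trans hW) (fun x hx => by
          rw [hhT]
          exact ⟨e x, (hWY x (hhe (hsrc x hx))).1 (hS hx).1, rfl⟩)
      refine this.trans_eq ?_
      rw [← mul_assoc, ENNReal.ofReal_mul (by positivity), ENNReal.ofReal_pow (by positivity)]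
      rfl
    -- Multiplication by an infinite measure would not be covered by the continuity argument below.
    rcases eq_or_ne (μH[d] Y) ⊤ with htop | htop
    · rw [htop]
      exact le_top
    have hlim : Tendsto (fun ε : ℝ => ENNReal.ofReal ((1 + ε) ^ d * (1 + ε) ^ d) * μH[d] Y)
        (𝓝[>] 0) (𝓝 (μH[d] Y)) := by
      have h1 : Tendsto (fun ε : ℝ => (1 + ε) ^ d * (1 + ε) ^ d) (𝓝[>] 0) (𝓝 1) := by
        have : ContinuousAt (fun ε : ℝ => (1 + ε) ^ d * (1 + ε) ^ d) 0 := by fun_prop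
        have h2 := this.tendsto.mono_left (nhdsWithin_le_nhds (s := Set.Ioi 0))
        simpa using h2
      have h2 := ENNReal.Tendsto.mul_const (b := μH[d] Y) (ENNReal.tendsto_ofReal h1) (.inr htop)
      simpa using h2
    exact ge_of_tendsto hlim (eventually_nhdsWithin_of_forall fun ε hε => key ε hε)

end Map

end AreaMap

namespace AreaMap

/-! ### Translations and homotopy. -/

section Translation

variable {V : Type u} [NormedAddCommGroup V] [NormedSpace ℝ V] (Γ : Submodule ℤ V)
  {X : Type u} [TopologicalSpace X]

theorem translate_add (φ : C(X, V ⧸ Γ)) (G G' : C(X, V)) :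
    φ + (torusMk Γ).comp (G + G') = φ + (torusMk Γ).comp G + (torusMk Γ).comp G' := by
  ext x
  exact (add_assoc (φ x) (torusMk Γ (G x)) (torusMk Γ (G' x))).symm

/-- A translation by a vector-valued map does not change the homotopy class. -/
theorem homotopic_translate (φ : C(X, V ⧸ Γ)) (G : C(X, V)) :
    ContinuousMap.Homotopic φ (φ + (torusMk Γ).comp G) := by
  have hG : ContinuousMap.Homotopic (0 : C(X, V)) G :=
    ⟨{ toFun := fun q => (q.1 : ℝ) • G q.2
       continuous_toFun := by fun_prop
       map_zero_left := fun x => by simp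
       map_one_left := fun x => by simp }⟩
  obtain ⟨H⟩ := hG
  refine ⟨{ toFun := fun q => φ q.2 + torusMk Γ (H q)
            continuous_toFun := by fun_prop
            map_zero_left := fun x => ?_
            map_one_left := fun x => ?_ }⟩
  · rw [H.apply_zero]
    exact add_zero (φ x)
  · rw [H.apply_one]
    rfl

end Translation

end AreaMap

end

theorem proposition7p2 (n : ℕ)
    -- a compact connected Riemannian manifold
    (X : Type u) [EMetricSpace X] [ChartedSpace (EuclideanSpace ℝ (Fin n)) X]
    [IsManifold (𝓡 n) ∞ X] [Bundle.RiemannianBundle (fun x : X => TangentSpace (𝓡 n) x)]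
    [IsContMDiffRiemannianBundle (𝓡 n) ∞ (EuclideanSpace ℝ (Fin n))
      (fun x : X => TangentSpace (𝓡 n) x)]
    [IsRiemannianManifold (𝓡 n) X] [CompactSpace X] [ConnectedSpace X]
    [MeasurableSpace X] [BorelSpace X]
    -- a finite-dimensional real vector space (its norm is used only for the topology) and a lattice
    (V : Type u) [NormedAddCommGroup V] [NormedSpace ℝ V] [FiniteDimensional ℝ V]
    [MeasurableSpace V] [BorelSpace V]
    (Γ : Submodule ℤ V) [DiscreteTopology Γ] [IsZLattice ℝ Γ]
    (φ : C(X, V ⧸ Γ)) (x₀ : X) (hφ : Function.Surjective (FundamentalGroup.map φ x₀)) :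
    -- the unit ball of the relative stable norm has a John ellipsoid
    (∃ E : InnerProductSpace.Core ℝ V,
      AreaMap.IsJohn E {v | AreaMap.relStableNorm n Γ φ v ≤ 1}) ∧
    -- for the Euclidean structure that it defines, there is a map as claimed
    ∀ E : InnerProductSpace.Core ℝ V,
      AreaMap.IsJohn E {v | AreaMap.relStableNorm n Γ φ v ≤ 1} →
      ∃ A : C(X, V ⧸ Γ), ContinuousMap.Homotopic φ A ∧
        (∃ K : ℝ≥0, LipschitzWith K (fun x => AreaMap.toFlat E Γ (A x))) ∧
        AreaMap.AreaNonexpanding n (Module.finrank ℝ V) (fun x => AreaMap.toFlat E Γ (A x)) := by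
  obtain ⟨G₀, K, δ, hδ, hψ⟩ := AreaMap.exists_isTorusLipschitz Γ φ
  set ψ : C(X, V ⧸ Γ) := φ + (AreaMap.torusMk Γ).comp G₀ with hψdef
  obtain ⟨p, hp⟩ := AreaMap.exists_seminorm_eq_relStableNorm (n := n) Γ
    (AreaMap.relStableNorm_ne_top (n := n) Γ hφ)
  have hpψ : ∀ v, AreaMap.relStableNorm n Γ ψ v = ENNReal.ofReal (p v) := by
    intro v
    rw [hψdef, AreaMap.relStableNorm_translate]
    exact hp v
  have hball : {v | AreaMap.relStableNorm n Γ φ v ≤ 1} = {v | p v ≤ 1} := by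
    ext v
    change AreaMap.relStableNorm n Γ φ v ≤ 1 ↔ p v ≤ 1
    rw [hp, ENNReal.ofReal_le_one]
  rw [hball]
  constructor
  -- The constant is `4 * K * 2`: the norm bound needs a strict inequality, so the unit ball is
  -- placed in the ball of radius 2.
  · refine AreaMap.exists_isJohn p (C := 8 * K) fun v hv => ?_
    have h1 : AreaMap.relStableNorm n Γ ψ v < 2 := by
      rw [hpψ]
      exact (ENNReal.ofReal_le_one.2 hv).trans_lt ENNReal.one_lt_two
    have h2 := hψ.enorm_le_of_relStableNorm_lt Γ hδ h1
    have h3 : (4 * K * 2 : ℝ≥0∞) = ENNReal.ofReal (8 * K) := by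
      rw [ENNReal.ofReal_mul (by norm_num), ENNReal.ofReal_coe_nnreal, ENNReal.ofReal_ofNat,
        mul_right_comm]
      norm_num
    rwa [h3, ← ofReal_norm, ENNReal.ofReal_le_ofReal_iff (by positivity)] at h2
  · intro E hE
    obtain ⟨T, hT⟩ := AreaMap.exists_orthonormal_coordinates E
    obtain ⟨G, hL, hA⟩ := AreaMap.exists_areaNonexpanding Γ ψ hpψ hE hT
    refine ⟨ψ + (AreaMap.torusMk Γ).comp G, ?_, hL, hA⟩
    have h := AreaMap.homotopic_translate Γ φ (G₀ + G)
    rwa [AreaMap.translate_add] at h
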